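/- In the Steiner tree problem the input is a finite undirected graph $G=(V,E)$ with non-negative (rational) edge costs $c_e$ and a set $T\subseteq V$ of terminals; a feasible solution is a connected subgraph of $G$ that contains all terminals, and an optimal solution is a feasible solution of minimum total edge cost. For a set $S$ of edges write $c(S)=\sum_{e\in S}c_e$. For every $\varepsilon>0$ there is a polynomial-time algorithm for the Steiner tree problem such that, on every instance that has a feasible solution, the output is the edge set $\mathrm{ALG}$ of a subtree of $G$ containing all terminals, and for every optimal solution, with edge set $\mathrm{OPT}$, $$c(\mathrm{ALG}\setminus \mathrm{OPT})\;\le\;(4+\varepsilon)\cdot c(\mathrm{OPT}\setminus \mathrm{ALG}).$$ (Costs are encoded in binary, and the running time is polynomial in the size of the encoded instance for fixed $\varepsilon$.) -/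

import Mathlib

/-! ### A model of computation with a step count

Programs transform binary trees (finite binary trees with unlabelled nodes, i.e. the
S-expressions built from one atom).  Every elementary operation is charged the size of the
tree it is applied to, so one unit of cost is a bounded number of symbol operations, all
intermediate results are no larger than the cost spent, and polynomial time in this model is
polynomial time on (multi-tape) Turing machines. -/

namespace SteinerTree

/-- The data on which programs work: `nil`, or a node with a left and a right subtree. -/
abbrev Data : Type := BinaryTree Unit

/-- Programs of a small deterministic while-language, each denoting a partial function
`Data → Data`. -/
inductive Prog : Type where
  /-- return the input -/
  | id : Prog
  /-- return `nil` -/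
  | nil : Prog
  /-- return the left subtree of the input (`nil` on `nil`) -/
  | fst : Prog
  /-- return the right subtree of the input (`nil` on `nil`) -/
  | snd : Prog
  /-- run both programs on the input and join the two results by a node -/
  | pair (p q : Prog) : Prog
  /-- run the first program, then the second one on the result -/
  | seq (p q : Prog) : Prog
  /-- if the test `t` does not return `nil` on the input, run `p` on it, otherwise run `q` -/
  | ite (t p q : Prog) : Prog
  /-- as long as the test `t` does not return `nil` on the current tree, replace this tree by
  the result of the body `b` on it -/
  | while (t b : Prog) : Prog

/-- `Prog.Eval p x y k`: on input `x` the program `p` halts with output `y` after exactly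
`k` steps.  Executing any construct at the tree `x` costs `1 + |x|` steps, where `|x|` is the
number of nodes of `x`, in addition to the steps of its parts. -/
inductive Prog.Eval : Prog → Data → Data → ℕ → Prop where
  | id (x : Data) : Prog.Eval .id x x (1 + x.numNodes)
  | nil (x : Data) : Prog.Eval .nil x .nil (1 + x.numNodes)
  | fst (x : Data) : Prog.Eval .fst x x.left (1 + x.numNodes)
  | snd (x : Data) : Prog.Eval .snd x x.right (1 + x.numNodes)
  | pair {p q : Prog} {x y z : Data} {k l : ℕ} (hp : Prog.Eval p x y k)
      (hq : Prog.Eval q x z l) :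
      Prog.Eval (.pair p q) x (.node () y z) (1 + x.numNodes + k + l)
  | seq {p q : Prog} {x y z : Data} {k l : ℕ} (hp : Prog.Eval p x y k)
      (hq : Prog.Eval q y z l) :
      Prog.Eval (.seq p q) x z (1 + x.numNodes + k + l)
  | ite_true {t p q : Prog} {x v y : Data} {k l : ℕ} (ht : Prog.Eval t x v k)
      (hv : v ≠ .nil) (hp : Prog.Eval p x y l) :
      Prog.Eval (.ite t p q) x y (1 + x.numNodes + k + l)
  | ite_false {t p q : Prog} {x y : Data} {k l : ℕ} (ht : Prog.Eval t x .nil k)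
      (hq : Prog.Eval q x y l) :
      Prog.Eval (.ite t p q) x y (1 + x.numNodes + k + l)
  | while_stop {t b : Prog} {x : Data} {k : ℕ} (ht : Prog.Eval t x .nil k) :
      Prog.Eval (.while t b) x x (1 + x.numNodes + k)
  | while_step {t b : Prog} {x v y z : Data} {k l m : ℕ} (ht : Prog.Eval t x v k)
      (hv : v ≠ .nil) (hb : Prog.Eval b x y l) (hw : Prog.Eval (.while t b) y z m) :
      Prog.Eval (.while t b) x z (1 + x.numNodes + k + l + m)

/-! ### Encodings of finite objects as trees -/

/-- A list is encoded as `nil` or as a node joining the head and the encoding of the tail. -/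
def encodeList : List Data → Data
  | [] => .nil
  | a :: l => .node () a (encodeList l)

/-- Truth values. -/
def encodeBool : Bool → Data
  | false => .nil
  | true => .node () .nil .nil

/-- Natural numbers in binary, least significant digit first. -/
def encodeNat (n : ℕ) : Data := encodeList (n.bits.map encodeBool)

/-- Non-negative rational numbers as reduced fractions with binary numerator and
denominator. -/
def encodeRat (r : ℚ≥0) : Data := .node () (encodeNat r.num) (encodeNat r.den)

/-- A square matrix, row by row. -/
def encodeMatrix {n : ℕ} (M : Fin n → Fin n → Data) : Data :=
  encodeList (List.ofFn fun u => encodeList (List.ofFn fun v => M u v))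

/-- A set of vertex pairs as its `n × n` matrix of truth values. -/
def encodeEdges {n : ℕ} (S : Finset (Sym2 (Fin n))) : Data :=
  encodeMatrix fun u v => encodeBool (decide (s(u, v) ∈ S))

/-! ### The Steiner tree problem -/

/-- An instance of the Steiner tree problem: a finite undirected graph with non-negative edge
costs and a set of terminals.  Only the values of `cost` on edges of the graph matter. -/
structure Instance where
  /-- the number of vertices -/
  n : ℕ
  /-- the graph -/
  graph : SimpleGraph (Fin n)
  /-- the edge costs -/
  cost : Sym2 (Fin n) → ℚ≥0
  /-- the terminals -/
  terminals : Finset (Fin n)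

namespace Instance

open Classical in
/-- The input of an algorithm: the matrix that holds the cost of `uv` if `uv` is an edge and
`nil` otherwise, together with the indicator vector of the set of terminals. -/
noncomputable def encode (I : Instance) : Data :=
  .node ()
    (encodeMatrix fun u v => if I.graph.Adj u v then encodeRat (I.cost s(u, v)) else .nil)
    (encodeList (List.ofFn fun u => encodeBool (decide (u ∈ I.terminals))))

/-- The total cost `c(S)` of a set of edges. -/
def totalCost (I : Instance) (S : Finset (Sym2 (Fin I.n))) : ℚ≥0 := ∑ e ∈ S, I.cost e

/-- `S` is the edge set of a feasible solution: of a connected subgraph of the graph that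
contains all terminals. -/
def IsSolution (I : Instance) (S : Finset (Sym2 (Fin I.n))) : Prop :=
  ∃ H : I.graph.Subgraph, H.Connected ∧ ↑I.terminals ⊆ H.verts ∧ H.edgeSet = ↑S

/-- `S` is the edge set of a subgraph of the graph that is a tree and contains all
terminals. -/
def IsSteinerTree (I : Instance) (S : Finset (Sym2 (Fin I.n))) : Prop :=
  ∃ H : I.graph.Subgraph, H.coe.IsTree ∧ ↑I.terminals ⊆ H.verts ∧ H.edgeSet = ↑S

/-- `S` is the edge set of an optimal solution. -/
def IsOptimal (I : Instance) (S : Finset (Sym2 (Fin I.n))) : Prop :=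
  I.IsSolution S ∧ ∀ S', I.IsSolution S' → I.totalCost S ≤ I.totalCost S'

end Instance

/-- The map `alg`, which assigns a set of edges to every instance, is computed by an algorithm
(one program for all instances) whose running time is bounded by a polynomial in the size of
the encoded instance. -/
def IsPolyTime (alg : (I : Instance) → Finset (Sym2 (Fin I.n))) : Prop :=
  ∃ (P : Prog) (q : Polynomial ℕ), ∀ I : Instance,
    ∃ k ≤ q.eval I.encode.numNodes, P.Eval I.encode (encodeEdges (alg I)) k

end SteinerTree

/-! The algorithm is a local search over inclusion-minimal solutions `A` with a root `r`. A move
picks an edge `e` of `A` and vertices `u`, `v`. It deletes the segment of `e`, that is, all edges of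
`A` whose removal splits the terminals together with `u` and `v` in the same way as the removal of
`e`, and inserts a cheapest walk from `u` to `v`, where the edges that are kept are free.

Suppose that no move helps, and let `F` connect the terminals. Consider the vertices joined to `r`
both in `A` and in `F`. Removing an edge of `A \ F` cuts some of them off from `r`; the parts cut
off form a laminar family, and a part is weighted by the total cost of the edges that produce it. A
walk of `F` that leaves a part can replace all these edges at once, so outside `A` it costs at least
the weight of the part. Now follow a closed walk in `F` that uses every edge at most twice. By
laminarity, each newly met common vertex creates at most two new traces of the family on the
vertices met so far. The sets charged for them separate the new vertex from the common vertex met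
last, so each weighs at most the piece of the walk in between. Two traces times two uses of an edge
give the factor 4; if the best move still gains `g`, the error is at most `2 * g * n`. This is
`TraceBound.insert`, `TraceBound.walk` and `difference_bound`.

A polynomial number of rounds cannot rely on a gain that is small relative to `c(A)`, because `c(OPT
\ A)` does not control `c(A)`; the gain must be small relative to `c(A \ OPT)`. The result `C` of a
first run of fixed length stands in for the unknown optimum: a second run from the same start stops
at the first `A` whose gain is at most `(c(A) - c(C)) / m`. As `c(C) ≥ c(OPT)`, this is at most `c(A
\ OPT) / m`, and `m = K * n` makes the error a `2 / K` fraction of `c(A \ OPT)`. Without such an `A`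
the distance to `c(C)` would halve every `2 * m` rounds, so a number of rounds linear in the bit
length of the initial cost suffices (`exists_almost_stationary`).

The running time is handled by showing that the class `PT` is closed under composition, list
operations, size-bounded iteration and binary arithmetic. Rational costs become integral after
multiplication by the product of all denominators. -/

namespace SteinerTree

open Polynomial

/-! ### Polynomial-time functions between encodable types -/

/-- Types whose elements are represented by trees. -/
class Enc (α : Type) where
  /-- the representation of an element -/
  enc : α → Data

open Enc (enc)

instance : Enc Bool := ⟨encodeBool⟩
instance : Enc Unit := ⟨fun _ => .nil⟩
instance {α β : Type} [Enc α] [Enc β] : Enc (α × β) := ⟨fun x => .node () (enc x.1) (enc x.2)⟩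
instance {α : Type} [Enc α] : Enc (List α) := ⟨fun l => encodeList (l.map enc)⟩

/-- Natural numbers in unary. -/
instance : Enc ℕ := ⟨fun n => enc (List.replicate n ())⟩

/-- The size of the representation. -/
def sz {α : Type} [Enc α] (a : α) : ℕ := (enc a).numNodes

/-- Functions computed by a program in polynomial time. -/
@[fun_prop]
def PT {α β : Type} [Enc α] [Enc β] (f : α → β) : Prop :=
  ∃ (P : Prog) (q : ℕ[X]), ∀ a, ∃ k ≤ q.eval (sz a), P.Eval (enc a) (enc (f a)) k

theorem eval_mono (q : ℕ[X]) {m n : ℕ} (h : m ≤ n) : q.eval m ≤ q.eval n := by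
  rw [Polynomial.eval_eq_sum, Polynomial.eval_eq_sum]
  exact Finset.sum_le_sum fun i _ => Nat.mul_le_mul_left _ (Nat.pow_le_pow_left h i)

/-- Every construct pays for the size of the tree it reads, so an output cannot outgrow the time
spent. A time bound is therefore also a size bound, which is what composition needs. -/
theorem Prog.Eval.size_le {p : Prog} {x y : Data} {k : ℕ} (h : p.Eval x y k) :
    y.numNodes ≤ k := by
  induction h with
  | id x => omega
  | nil x => simp [BinaryTree.numNodes]
  | fst x => cases x <;> simp [BinaryTree.numNodes, BinaryTree.left]; omega
  | snd x => cases x <;> simp [BinaryTree.numNodes, BinaryTree.right]; omega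
  | pair _ _ h1 h2 => simp only [BinaryTree.numNodes]; omega
  | seq => omega
  | ite_true => omega
  | ite_false => omega
  | while_stop => omega
  | while_step => omega

section
variable {α β γ δ : Type} [Enc α] [Enc β] [Enc γ] [Enc δ]

theorem sz_pair (a : α) (b : β) : sz (a, b) = sz a + sz b + 1 := rfl

theorem sz_nil : sz ([] : List α) = 0 := rfl

theorem sz_cons (a : α) (l : List α) : sz (a :: l) = sz a + sz l + 1 := rfl

theorem sz_append (l m : List α) : sz (l ++ m) = sz l + sz m := by
  induction l with
  | nil => simp [sz_nil]
  | cons a l ih => simp only [List.cons_append, sz_cons, ih]; omega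

theorem length_le_sz (l : List α) : l.length ≤ sz l := by
  induction l with
  | nil => simp
  | cons a l ih => simp only [List.length_cons, sz_cons]; omega

theorem sz_le_of_sublist {l m : List α} (h : l.Sublist m) : sz l ≤ sz m := by
  induction h with
  | slnil => rfl
  | cons a _ ih => rw [sz_cons]; omega
  | cons_cons a _ ih => rw [sz_cons, sz_cons]; omega

theorem sz_le_of_mem {l : List α} {a : α} (h : a ∈ l) : sz a < sz l := by
  induction l with
  | nil => simp at h
  | cons b l ih =>
    rw [sz_cons]
    rcases List.mem_cons.1 h with rfl | h
    · omega
    · have := ih h; omega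

theorem sz_list_le (l : List α) (B : ℕ) (h : ∀ a ∈ l, sz a ≤ B) : sz l ≤ l.length * (B + 1) := by
  induction l with
  | nil => simp [sz_nil]
  | cons a l ih =>
    rw [sz_cons, List.length_cons, add_mul, one_mul]
    have := ih fun b hb => h b (List.mem_cons_of_mem _ hb)
    have := h a List.mem_cons_self
    omega

theorem sz_replicate (n : ℕ) : sz (List.replicate n ()) = n := by
  induction n with
  | zero => rfl
  | succ n ih => rw [List.replicate_succ, sz_cons, ih]; simp [sz, enc, BinaryTree.numNodes]

theorem sz_nat (n : ℕ) : sz n = n := sz_replicate n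

theorem sz_bool (b : Bool) : sz b ≤ 1 := by
  cases b <;> simp [sz, enc, encodeBool, BinaryTree.numNodes]

theorem PT.size_le {f : α → β} (hf : PT f) : ∃ q : ℕ[X], ∀ a, sz (f a) ≤ q.eval (sz a) := by
  obtain ⟨P, q, h⟩ := hf
  refine ⟨q, fun a => ?_⟩
  obtain ⟨k, hk, he⟩ := h a
  exact he.size_le.trans hk

@[fun_prop]
theorem PT.id : PT (fun a : α => a) :=
  ⟨.id, 1 + X, fun a => ⟨_, by simp [sz], .id _⟩⟩

@[fun_prop]
theorem PT.comp {g : β → γ} {f : α → β} (hg : PT g) (hf : PT f) : PT fun a => g (f a) := by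
  obtain ⟨r, hr⟩ := hf.size_le
  obtain ⟨P, p, hP⟩ := hf
  obtain ⟨Q, q, hQ⟩ := hg
  refine ⟨.seq P Q, 1 + X + p + q.comp r, fun a => ?_⟩
  obtain ⟨k, hk, h1⟩ := hP a
  obtain ⟨l, hl, h2⟩ := hQ (f a)
  refine ⟨_, ?_, .seq h1 h2⟩
  have := hl.trans (eval_mono q (hr a))
  simp only [eval_add, eval_one, eval_X, eval_comp]
  change 1 + sz a + k + l ≤ _
  omega

@[fun_prop]
theorem PT.pair {f : α → β} {g : α → γ} (hf : PT f) (hg : PT g) : PT fun a => (f a, g a) := by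
  obtain ⟨P, p, hP⟩ := hf
  obtain ⟨Q, q, hQ⟩ := hg
  refine ⟨.pair P Q, 1 + X + p + q, fun a => ?_⟩
  obtain ⟨k, hk, h1⟩ := hP a
  obtain ⟨l, hl, h2⟩ := hQ a
  refine ⟨_, ?_, .pair h1 h2⟩
  simp only [eval_add, eval_one, eval_X]
  change 1 + sz a + k + l ≤ _
  omega

/-- Functions that agree with a polynomial-time function on the level of representations. -/
theorem PT.of_prog {f : α → β} (P : Prog) (c : ℕ)
    (h : ∀ a, ∃ k ≤ c * (1 + sz a), P.Eval (enc a) (enc (f a)) k) : PT f :=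
  ⟨P, C c * (1 + X), fun a => by simpa using h a⟩

theorem PT.fst' : PT (fun x : α × β => x.1) :=
  .of_prog .fst 1 fun a => ⟨_, by simp [sz], .fst _⟩

theorem PT.snd' : PT (fun x : α × β => x.2) :=
  .of_prog .snd 1 fun a => ⟨_, by simp [sz], .snd _⟩

@[fun_prop]
theorem PT.fst {f : α → β × γ} (hf : PT f) : PT fun a => (f a).1 := PT.fst'.comp hf

@[fun_prop]
theorem PT.snd {f : α → β × γ} (hf : PT f) : PT fun a => (f a).2 := PT.snd'.comp hf

/-- A change of type that leaves the underlying tree alone is computed by the identity program. -/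
theorem PT.recode {f : α → β} {g : β → γ} (hf : PT f) (h : ∀ b, enc (g b) = enc b) :
    PT fun a => g (f a) :=
  PT.comp (g := g) (.of_prog .id 1 fun a => ⟨1 + sz a, by simp, by rw [h]; exact .id _⟩) hf

theorem Prog.exists_const (d : Data) :
    ∃ (P : Prog) (c : ℕ), ∀ x : Data, ∃ k ≤ c * (1 + x.numNodes), P.Eval x d k := by
  induction d with
  | nil => exact ⟨.nil, 1, fun x => ⟨_, by simp, .nil _⟩⟩
  | node u l r ihl ihr =>
    obtain ⟨P, c, hP⟩ := ihl
    obtain ⟨Q, d, hQ⟩ := ihr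
    refine ⟨.pair P Q, 1 + c + d, fun x => ?_⟩
    obtain ⟨k, hk, h1⟩ := hP x
    obtain ⟨m, hm, h2⟩ := hQ x
    exact ⟨_, by linarith, .pair h1 h2⟩

@[fun_prop]
theorem PT.const (b : β) : PT (fun _ : α => b) := by
  obtain ⟨P, c, h⟩ := Prog.exists_const (enc b)
  exact .of_prog P c fun a => h _

@[fun_prop]
theorem PT.ite {c : α → Bool} {f g : α → β} (hc : PT c) (hf : PT f) (hg : PT g) :
    PT fun a => if c a = true then f a else g a := by
  obtain ⟨R, r, hR⟩ := hc
  obtain ⟨P, p, hP⟩ := hf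
  obtain ⟨Q, q, hQ⟩ := hg
  refine ⟨.ite R P Q, 1 + X + r + p + q, fun a => ?_⟩
  obtain ⟨j, hj, h0⟩ := hR a
  obtain ⟨k, hk, h1⟩ := hP a
  obtain ⟨l, hl, h2⟩ := hQ a
  simp only [eval_add, eval_one, eval_X]
  cases h : c a
  · rw [h] at h0
    refine ⟨_, ?_, .ite_false h0 (by simpa using h2)⟩
    change 1 + sz a + j + l ≤ _
    omega
  · rw [h] at h0
    refine ⟨_, ?_, .ite_true h0 (by simp [enc, encodeBool]) (by simpa using h1)⟩
    change 1 + sz a + j + k ≤ _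
    omega

/-- Each round costs at most `1 + 3 * K`: the size of the state, the test and the body. The final
failing test accounts for the extra round. -/
theorem Prog.exists_eval_while {t b : Prog} {K : ℕ} (m : ℕ) (x : ℕ → Data)
    (ht : ∀ i < m, ∃ v ≠ BinaryTree.nil, ∃ k ≤ K, t.Eval (x i) v k)
    (hb : ∀ i < m, ∃ k ≤ K, b.Eval (x i) (x (i + 1)) k)
    (hhalt : ∃ k ≤ K, t.Eval (x m) .nil k) (hsz : ∀ i ≤ m, (x i).numNodes ≤ K) :
    ∃ k ≤ (m + 1) * (1 + 3 * K), (Prog.while t b).Eval (x 0) (x m) k := by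
  induction m generalizing x with
  | zero =>
    obtain ⟨k, hk, h⟩ := hhalt
    have := hsz 0 le_rfl
    exact ⟨_, by omega, Prog.Eval.while_stop h⟩
  | succ m ih =>
    obtain ⟨k, hk, hw⟩ := ih (fun i => x (i + 1)) (fun i hi => ht _ (by omega))
      (fun i hi => hb _ (by omega)) hhalt (fun i hi => hsz _ (by omega))
    obtain ⟨v, hv, k1, hk1, h1⟩ := ht 0 (by omega)
    obtain ⟨k2, hk2, h2⟩ := hb 0 (by omega)
    have := hsz 0 (by omega)
    refine ⟨_, ?_, .while_step h1 hv h2 hw⟩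
    rw [add_mul (m + 1)]
    omega

/-- Left folds whose intermediate results have polynomial size. -/
theorem PT.foldl {l : α → List β} {s : α → γ} {f : α → γ → β → γ} (hl : PT l) (hs : PT s)
    (hf : PT fun x : (α × γ) × β => f x.1.1 x.1.2 x.2)
    (hb : ∃ q : ℕ[X], ∀ a, ∀ l', l' <+: l a → sz (l'.foldl (f a) (s a)) ≤ q.eval (sz a)) :
    PT fun a => (l a).foldl (f a) (s a) := by
  obtain ⟨q, hq⟩ := hb
  obtain ⟨r, hr⟩ := hl.size_le
  obtain ⟨P, p, hP⟩ := PT.id.pair (hl.pair hs)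
  obtain ⟨T, t, hT⟩ := (PT.id (α := α × (List β × γ))).snd.fst
  obtain ⟨B, b, hB⟩ : PT fun x : α × ((β × List β) × γ) =>
      (x.1, (x.2.1.2, f x.1 x.2.2 x.2.1.1)) :=
    PT.id.fst.pair (PT.id.snd.fst.snd.pair
      (hf.comp ((PT.id.fst.pair PT.id.snd.snd).pair PT.id.snd.fst.fst)))
  -- The loop state consists of the parameter, the unread part of the list and the accumulator. The
  -- test `T` returns the unread part, which is `nil` exactly when the loop must stop.
  suffices h : PT fun a => (a, (([] : List β), (l a).foldl (f a) (s a))) from h.snd.snd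
  set Z : ℕ[X] := X + (r + q + 1) + 1 with hZ
  set K : ℕ[X] := Z + t.comp Z + b.comp Z with hK
  refine ⟨.seq P (.while T B), 1 + X + p + (r + 1) * (1 + 3 * K), fun a => ?_⟩
  let x : ℕ → α × (List β × γ) := fun i =>
    (a, ((l a).drop i, ((l a).take i).foldl (f a) (s a)))
  have hx : ∀ i, sz (x i) ≤ Z.eval (sz a) := fun i => by
    have h1 := hq a _ ((l a).take_prefix i)
    have h2 := (sz_le_of_sublist ((l a).drop_sublist i)).trans (hr a)
    simp only [x, sz_pair, hZ, eval_add, eval_one, eval_X]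
    omega
  have hKe : K.eval (sz a) = Z.eval (sz a) + t.eval (Z.eval (sz a)) + b.eval (Z.eval (sz a)) := by
    simp [hK]
  obtain ⟨k, hk, hw⟩ := Prog.exists_eval_while (t := T) (b := B) (K := K.eval (sz a)) (l a).length
    (fun i => enc (x i))
    (fun i hi => by
      obtain ⟨k, hk, h⟩ := hT (x i)
      refine ⟨_, ?_, k, ?_, h⟩
      · change enc ((l a).drop i) ≠ _
        rw [List.drop_eq_getElem_cons hi]
        exact nofun
      · have := hk.trans (eval_mono t (hx i)); omega)
    (fun i hi => by
      have he : x i = (a, ((l a)[i] :: (l a).drop (i + 1), ((l a).take i).foldl (f a) (s a))) := by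
        simp only [x]; rw [← List.drop_eq_getElem_cons hi]
      obtain ⟨k, hk, h⟩ := hB (a, (((l a)[i], (l a).drop (i + 1)),
        ((l a).take i).foldl (f a) (s a)))
      refine ⟨k, ?_, ?_⟩
      · have h0 : sz (x i) ≤ _ := hx i
        rw [he] at h0
        have := hk.trans (eval_mono b h0); omega
      · rw [he]
        have he' : x (i + 1) = (a, ((l a).drop (i + 1),
            f a (((l a).take i).foldl (f a) (s a)) (l a)[i])) := by
          simp only [x]
          rw [← List.take_append_getElem hi, List.foldl_append]
          rfl
        rw [he']
        exact h)
    (by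
      obtain ⟨k, hk, h⟩ := hT (x (l a).length)
      refine ⟨k, ?_, ?_⟩
      · have := hk.trans (eval_mono t (hx (l a).length)); omega
      · simpa [x, enc, encodeList] using h)
    (fun i _ => by have : sz (x i) ≤ _ := hx i; change sz (x i) ≤ _; omega)
  obtain ⟨j, hj, h0⟩ := hP a
  refine ⟨_, ?_, .seq h0 (by simpa [x] using hw)⟩
  have h1 : ((l a).length + 1) * (1 + 3 * K.eval (sz a)) ≤
      (r.eval (sz a) + 1) * (1 + 3 * K.eval (sz a)) :=
    Nat.mul_le_mul_right _ (Nat.succ_le_succ ((length_le_sz _).trans (hr a)))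
  simp only [eval_add, eval_one, eval_X, eval_mul, eval_ofNat]
  change 1 + sz a + j + k ≤ _
  omega
end

/-! ### List operations and unary arithmetic in polynomial time -/

section
variable {α β γ δ : Type} [Enc α] [Enc β] [Enc γ] [Enc δ]

@[fun_prop]
theorem PT.cons {f : α → β} {g : α → List β} (hf : PT f) (hg : PT g) :
    PT fun a => f a :: g a :=
  PT.recode (g := fun x : β × List β => x.1 :: x.2) (hf.pair hg) fun _ => rfl

@[fun_prop]
theorem PT.and {f g : α → Bool} (hf : PT f) (hg : PT g) : PT fun a => f a && g a := by
  have : PT fun a => if f a = true then g a else false := by fun_prop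
  convert this using 2 with a
  cases f a <;> rfl

@[fun_prop]
theorem PT.or {f g : α → Bool} (hf : PT f) (hg : PT g) : PT fun a => f a || g a := by
  have : PT fun a => if f a = true then true else g a := by fun_prop
  convert this using 2 with a
  cases f a <;> rfl

@[fun_prop]
theorem PT.not {f : α → Bool} (hf : PT f) : PT fun a => !f a := by
  have : PT fun a => if f a = true then false else true := by fun_prop
  convert this using 2 with a
  cases f a <;> rfl

@[fun_prop]
theorem PT.beq_bool {f g : α → Bool} (hf : PT f) (hg : PT g) : PT fun a => f a == g a := by
  have : PT fun a => if f a = true then g a else !g a := by fun_prop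
  convert this using 2 with a
  cases f a <;> cases g a <;> rfl

@[fun_prop]
theorem PT.xor {f g : α → Bool} (hf : PT f) (hg : PT g) : PT fun a => (f a ^^ g a) := by
  have : PT fun a => !(f a == g a) := by fun_prop
  convert this using 2 with a
  cases f a <;> cases g a <;> rfl

@[fun_prop]
theorem PT.tail {f : α → List β} (hf : PT f) : PT fun a => (f a).tail :=
  PT.comp (g := List.tail) (.of_prog .snd 1 fun l =>
    ⟨1 + sz l, by simp, by cases l <;> exact .snd _⟩) hf

@[fun_prop]
theorem PT.isEmpty {f : α → List β} (hf : PT f) : PT fun a => (f a).isEmpty :=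
  PT.comp (g := List.isEmpty) (.of_prog (.ite .id .nil (.pair .nil .nil)) 5 fun l => by
    cases l with
    | nil =>
      refine ⟨_, ?_, .ite_false (.id _) (.pair (.nil _) (.nil _))⟩
      simp [enc, encodeList, BinaryTree.numNodes]
    | cons a l =>
      refine ⟨_, ?_, .ite_true (.id _) nofun (.nil _)⟩
      simp only [sz]; omega) hf

@[fun_prop]
theorem PT.headD {f : α → List β} {d : α → β} (hf : PT f) (hd : PT d) :
    PT fun a => (f a).headD (d a) :=
  PT.comp (g := fun x : List β × β => x.1.headD x.2)
    (.of_prog (.ite .fst (.seq .fst .fst) .snd) 5 fun x => by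
      obtain ⟨l, b⟩ := x
      cases l with
      | nil => exact ⟨_, by simp [sz]; omega, .ite_false (.fst _) (.snd _)⟩
      | cons a l =>
        refine ⟨_, ?_, .ite_true (.fst _) nofun (.seq (.fst _) (.fst _))⟩
        simp [sz, enc, BinaryTree.left, BinaryTree.numNodes, encodeList]; omega) (hf.pair hd)

/-- Left folds in which every step enlarges the intermediate result by a bounded amount. -/
theorem PT.foldl_add {l : α → List β} {s : α → γ} {f : α → γ → β → γ} (hl : PT l) (hs : PT s)
    (hf : PT fun x : (α × γ) × β => f x.1.1 x.1.2 x.2)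
    (hb : ∃ q : ℕ[X], ∀ a c b, b ∈ l a → sz (f a c b) ≤ sz c + q.eval (sz a + sz b)) :
    PT fun a => (l a).foldl (f a) (s a) := by
  refine PT.foldl hl hs hf ?_
  obtain ⟨q, hq⟩ := hb
  obtain ⟨r, hr⟩ := hl.size_le
  obtain ⟨t, ht⟩ := hs.size_le
  refine ⟨t + r * q.comp (X + r), fun a l' hl' => ?_⟩
  have key : ∀ m : List β, m ⊆ l a → ∀ c, sz (m.foldl (f a) c) ≤
      sz c + m.length * q.eval (sz a + r.eval (sz a)) := by
    intro m
    induction m with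
    | nil => intro _ c; simp
    | cons b m ih =>
      intro hm c
      have h1 := ih (fun x hx => hm (List.mem_cons_of_mem _ hx)) (f a c b)
      have hbm : b ∈ l a := hm List.mem_cons_self
      have h2 := hq a c b hbm
      have h3 := eval_mono q (Nat.add_le_add_left ((sz_le_of_mem hbm).le.trans (hr a)) (sz a))
      rw [List.foldl_cons, List.length_cons, add_mul]
      omega
  have h1 := key l' hl'.subset (s a)
  have h2 : l'.length ≤ r.eval (sz a) := hl'.length_le.trans ((length_le_sz _).trans (hr a))
  have h3 := Nat.mul_le_mul_right (q.eval (sz a + r.eval (sz a))) h2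
  have h4 := ht a
  simp only [eval_add, eval_mul, eval_comp, eval_X]
  omega

@[fun_prop]
theorem PT.reverse {f : α → List β} (hf : PT f) : PT fun a => (f a).reverse := by
  have : PT fun a => (f a).foldl (fun l b => b :: l) [] := by
    refine PT.foldl_add (f := fun _ l b => b :: l) hf (.const _) (by fun_prop)
      ⟨X + 1, fun a c b _ => ?_⟩
    simp [sz_cons]; omega
  convert this using 2 with a
  simp

theorem PT.foldr_add {l : α → List β} {s : α → γ} {f : α → β → γ → γ} (hl : PT l) (hs : PT s)
    (hf : PT fun x : (α × γ) × β => f x.1.1 x.2 x.1.2)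
    (hb : ∃ q : ℕ[X], ∀ a c b, b ∈ l a → sz (f a b c) ≤ sz c + q.eval (sz a + sz b)) :
    PT fun a => (l a).foldr (f a) (s a) := by
  have := PT.foldl_add (f := fun a c b => f a b c) hl.reverse hs hf
    (hb.imp fun q hq a c b h => hq a c b (by simpa using h))
  convert this using 2 with a
  rw [List.foldl_reverse]

@[fun_prop]
theorem PT.map {l : α → List β} {f : α → β → γ} (hl : PT l)
    (hf : PT fun x : α × β => f x.1 x.2) : PT fun a => (l a).map (f a) := by
  have : PT fun a => (l a).foldr (fun b c => f a b :: c) [] := by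
    obtain ⟨q, hq⟩ := hf.size_le
    refine PT.foldr_add (f := fun a b c => f a b :: c) hl (.const _)
      (.cons (hf.comp (f := fun x : (α × List γ) × β => (x.1.1, x.2)) (by fun_prop))
        (by fun_prop)) ⟨q.comp (X + 1) + 1, fun a c b _ => ?_⟩
    have := hq (a, b)
    simp only [sz_pair] at this
    simp [sz_cons]; omega
  convert this using 2 with a
  rw [List.map_eq_foldr]

@[fun_prop]
theorem PT.append {l m : α → List β} (hl : PT l) (hm : PT m) : PT fun a => l a ++ m a := by
  have : PT fun a => (l a).foldr (fun b c => b :: c) (m a) := by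
    refine PT.foldr_add (f := fun _ b c => b :: c) hl hm (by fun_prop)
      ⟨X + 1, fun a c b _ => ?_⟩
    simp [sz_cons]; omega
  convert this using 2 with a
  simp

@[fun_prop]
theorem PT.filter {l : α → List β} {f : α → β → Bool} (hl : PT l)
    (hf : PT fun x : α × β => f x.1 x.2) : PT fun a => (l a).filter (f a) := by
  have : PT fun a => (l a).foldr (fun b c => if f a b = true then b :: c else c) [] := by
    refine PT.foldr_add (f := fun a b c => if f a b = true then b :: c else c) hl (.const _)
      (.ite (hf.comp (f := fun x : (α × List β) × β => (x.1.1, x.2)) (by fun_prop))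
        (by fun_prop) (by fun_prop)) ⟨X + 1, fun a c b _ => ?_⟩
    split
    · simp [sz_cons]; omega
    · omega
  convert this using 2 with a
  induction l a with
  | nil => rfl
  | cons b m ih => simp only [List.filter_cons, List.foldr_cons, ih]

@[fun_prop]
theorem PT.any {l : α → List β} {f : α → β → Bool} (hl : PT l)
    (hf : PT fun x : α × β => f x.1 x.2) : PT fun a => (l a).any (f a) := by
  have : PT fun a => !((l a).filter (f a)).isEmpty := by fun_prop
  convert this using 2 with a
  induction l a with
  | nil => rfl
  | cons b m ih => cases h : f a b <;> simp [h, ih]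

@[fun_prop]
theorem PT.all {l : α → List β} {f : α → β → Bool} (hl : PT l)
    (hf : PT fun x : α × β => f x.1 x.2) : PT fun a => (l a).all (f a) := by
  have : PT fun a => !((l a).any fun b => !f a b) := by fun_prop
  convert this using 2 with a
  induction l a with
  | nil => rfl
  | cons b m ih => simp only [List.all_cons, List.any_cons, ih, Bool.not_or, Bool.not_not]

@[fun_prop]
theorem PT.flatten {l : α → List (List β)} (hl : PT l) : PT fun a => (l a).flatten := by
  have : PT fun a => (l a).foldr (fun b c => b ++ c) [] := by
    refine PT.foldr_add (f := fun _ b c => b ++ c) hl (.const _) (by fun_prop)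
      ⟨X, fun a c b _ => ?_⟩
    simp [sz_append]; omega
  convert this using 2 with a
  induction l a with
  | nil => rfl
  | cons b m ih => simp [ih]

@[fun_prop]
theorem PT.flatMap {l : α → List β} {f : α → β → List γ} (hl : PT l)
    (hf : PT fun x : α × β => f x.1 x.2) : PT fun a => (l a).flatMap (f a) := by
  simp only [List.flatMap_def]
  fun_prop

/-! Unary numbers -/

@[fun_prop]
theorem PT.replicate {f : α → ℕ} (hf : PT f) : PT fun a => List.replicate (f a) () :=
  hf.recode fun _ => rfl

/-- A unary number and the list of that many units are the same tree, so unary arithmetic reduces to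
list operations. -/
theorem PT.of_replicate {f : α → ℕ} (hf : PT fun a => List.replicate (f a) ()) : PT f := by
  have := hf.recode (g := List.length) fun l => by
    change enc (List.replicate l.length ()) = enc l
    rw [← List.eq_replicate_of_mem (a := ()) (l := l) fun _ _ => rfl]
  simpa using this

@[fun_prop]
theorem PT.succ {f : α → ℕ} (hf : PT f) : PT fun a => f a + 1 := by
  apply PT.of_replicate
  simp only [List.replicate_succ]
  fun_prop

@[fun_prop]
theorem PT.length {f : α → List β} (hf : PT f) : PT fun a => (f a).length := by
  apply PT.of_replicate
  have : PT fun a => (f a).map fun _ => () := by fun_prop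
  convert this using 2 with a
  simp

/-- Iteration with intermediate results of polynomial size. -/
theorem PT.iterate {n : α → ℕ} {s : α → γ} {f : α → γ → γ} (hn : PT n) (hs : PT s)
    (hf : PT fun x : α × γ => f x.1 x.2)
    (hb : ∃ q : ℕ[X], ∀ a, ∀ i ≤ n a, sz ((f a)^[i] (s a)) ≤ q.eval (sz a)) :
    PT fun a => (f a)^[n a] (s a) := by
  have key : ∀ a (l : List Unit) c, l.foldl (fun c _ => f a c) c = (f a)^[l.length] c := by
    intro a l
    induction l with
    | nil => intro c; rfl
    | cons u l ih => intro c; exact ih _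
  have : PT fun a => (List.replicate (n a) ()).foldl (fun c _ => f a c) (s a) := by
    refine PT.foldl (f := fun a c _ => f a c) hn.replicate hs
      (hf.comp (f := fun x : (α × γ) × Unit => (x.1.1, x.1.2)) (by fun_prop)) ?_
    obtain ⟨q, hq⟩ := hb
    refine ⟨q, fun a l' hl' => ?_⟩
    rw [key]
    exact hq a _ (by simpa using hl'.length_le)
  convert this using 2 with a
  simp [key]

@[fun_prop]
theorem PT.drop {n : α → ℕ} {l : α → List β} (hn : PT n) (hl : PT l) :
    PT fun a => (l a).drop (n a) := by
  have key : ∀ n (m : List β), List.tail^[n] m = m.drop n := by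
    intro n m
    induction n generalizing m with
    | zero => rfl
    | succ n ih => rw [Function.iterate_succ_apply, ih, List.drop_tail]
  have : PT fun a => List.tail^[n a] (l a) := by
    refine PT.iterate (f := fun _ => List.tail) hn hl (by fun_prop) ?_
    obtain ⟨q, hq⟩ := hl.size_le
    exact ⟨q, fun a i _ => by
      rw [key]; exact (sz_le_of_sublist (List.drop_sublist _ _)).trans (hq a)⟩
  simpa only [key] using this

@[fun_prop]
theorem PT.getD {n : α → ℕ} {l : α → List β} {d : α → β} (hn : PT n) (hl : PT l) (hd : PT d) :
    PT fun a => (l a).getD (n a) (d a) := by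
  have : PT fun a => ((l a).drop (n a)).headD (d a) := by fun_prop
  convert this using 2 with a
  simp [List.getD_eq_getElem?_getD]

@[fun_prop]
theorem PT.sub {f g : α → ℕ} (hf : PT f) (hg : PT g) : PT fun a => f a - g a := by
  apply PT.of_replicate
  have : PT fun a => (List.replicate (f a) ()).drop (g a) := by fun_prop
  simpa using this

@[fun_prop]
theorem PT.blt {f g : α → ℕ} (hf : PT f) (hg : PT g) : PT fun a => (f a).blt (g a) := by
  have : PT fun a => !(List.replicate (g a - f a) ()).isEmpty := by fun_prop
  convert this using 2 with a
  rw [Bool.eq_iff_iff]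
  simp [Nat.blt_eq, Nat.sub_eq_zero_iff_le]

@[fun_prop]
theorem PT.beq {f g : α → ℕ} (hf : PT f) (hg : PT g) : PT fun a => f a == g a := by
  have : PT fun a => !((f a).blt (g a) || (g a).blt (f a)) := by fun_prop
  convert this using 2 with a
  have e : ∀ m n : ℕ, m.blt n = decide (m < n) := fun m n => by
    rw [Bool.eq_iff_iff]; simp [Nat.blt_eq]
  rw [Bool.eq_iff_iff, e, e]
  simp
  omega

@[fun_prop]
theorem PT.add {f g : α → ℕ} (hf : PT f) (hg : PT g) : PT fun a => f a + g a := by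
  apply PT.of_replicate
  simp only [List.replicate_add]
  fun_prop

@[fun_prop]
theorem PT.mul {f g : α → ℕ} (hf : PT f) (hg : PT g) : PT fun a => f a * g a := by
  apply PT.of_replicate
  have : PT fun a => (List.replicate (f a) ()).flatMap fun _ => List.replicate (g a) () := by
    fun_prop
  convert this using 2 with a
  simp [List.flatMap_def]

@[fun_prop]
theorem PT.range {f : α → ℕ} (hf : PT f) : PT fun a => List.range (f a) := by
  have key : ∀ n, (fun l : List ℕ => 0 :: l.map (· + 1))^[n] [] = List.range n := by
    intro n
    induction n with
    | zero => rfl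
    | succ n ih => rw [Function.iterate_succ_apply', ih, List.range_succ_eq_map]
  have : PT fun a => (fun l : List ℕ => 0 :: l.map (· + 1))^[f a] [] := by
    refine PT.iterate (f := fun _ (l : List ℕ) => 0 :: l.map (· + 1)) hf (.const _)
      (by fun_prop) ?_
    obtain ⟨q, hq⟩ := hf.size_le
    refine ⟨q * (q + 1), fun a i hi => ?_⟩
    rw [key]
    have h1 : i ≤ q.eval (sz a) := hi.trans (by simpa [sz_nat] using hq a)
    refine (sz_list_le _ i fun b hb => ?_).trans ?_
    · rw [sz_nat]; exact (List.mem_range.1 hb).le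
    · simp only [List.length_range, eval_mul, eval_add, eval_one]
      gcongr
  simpa only [key] using this

end

/-! ### Binary arithmetic -/

/-- Natural numbers in binary. -/
@[ext]
structure Bin where
  /-- the number -/
  val : ℕ

instance : Enc Bin := ⟨fun b => encodeNat b.val⟩

/-- The value of a list of binary digits. -/
def bval (l : List Bool) : ℕ := l.foldr Nat.bit 0

theorem bval_bits (n : ℕ) : bval n.bits = n := by
  induction n using Nat.binaryRec' with
  | zero => simp [bval]
  | bit b n h ih => rw [Nat.bits_append_bit _ _ h]; exact congrArg (Nat.bit b) ih

/-- Remove leading zeros. -/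
def trim (l : List Bool) : List Bool :=
  l.foldr (fun b c => if (!b && c.isEmpty) = true then [] else b :: c) []

/-- `encodeNat` has no leading zeros, whereas digitwise arithmetic produces them; trimming restores
the canonical digits. -/
theorem trim_eq (l : List Bool) : trim l = (bval l).bits := by
  induction l with
  | nil => simp [trim, bval]
  | cons b l ih =>
    have h1 : trim (b :: l) = if (!b && (trim l).isEmpty) = true then [] else b :: trim l := rfl
    have h2 : bval (b :: l) = Nat.bit b (bval l) := rfl
    rw [h1, h2, ih]
    by_cases h : bval l = 0
    · cases b
      · simp [h]
      · rw [Nat.bits_append_bit _ _ fun _ => rfl]; simp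
    · rw [Nat.bits_append_bit _ _ fun h' => absurd h' h, if_neg]
      have : (bval l).bits ≠ [] := fun h' => h (by rw [← bval_bits (bval l), h']; rfl)
      simp [this]

theorem Bin.sz_eq (b : Bin) : sz b = sz b.val.bits := rfl

theorem Bin.size_le_sz (b : Bin) : b.val.size ≤ sz b := by
  rw [Bin.sz_eq, ← Nat.size_eq_bits_len]
  exact length_le_sz _

theorem Bin.sz_le (b : Bin) : sz b ≤ 2 * b.val.size := by
  rw [Bin.sz_eq, ← Nat.size_eq_bits_len, mul_comm]
  exact sz_list_le _ 1 fun b _ => sz_bool b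

section
variable {α β γ δ : Type} [Enc α] [Enc β] [Enc γ] [Enc δ]

@[fun_prop]
theorem PT.bits {f : α → Bin} (hf : PT f) : PT fun a => (f a).val.bits :=
  hf.recode (g := fun b : Bin => b.val.bits) fun _ => rfl

theorem PT.of_bits {f : α → Bin} (hf : PT fun a => (f a).val.bits) : PT f := hf

@[fun_prop]
theorem PT.trim {f : α → List Bool} (hf : PT f) : PT fun a => trim (f a) := by
  refine PT.foldr_add (f := fun _ b c => if (!b && c.isEmpty) = true then [] else b :: c) hf
    (.const _) (by fun_prop) ⟨X + 1, fun a c b _ => ?_⟩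
  split
  · simp [sz_nil]
  · simp [sz_cons]; omega

@[fun_prop]
theorem PT.ofBits {f : α → List Bool} (hf : PT f) : PT fun a => (⟨bval (f a)⟩ : Bin) := by
  apply PT.of_bits
  simp only [← trim_eq]
  fun_prop

/-- Pair up the digits of two numbers, padding with zeros. -/
def zipPad (a b : List Bool) : List (Bool × Bool) :=
  (List.range (a.length + b.length)).map fun i => (a.getD i false, b.getD i false)

theorem bval_getD (a : List Bool) (k : ℕ) (h : a.length ≤ k) :
    bval ((List.range k).map fun i => a.getD i false) = bval a := by
  induction k generalizing a with
  | zero => simp at h; simp [h, bval]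
  | succ k ih =>
    rw [List.range_succ_eq_map]
    cases a with
    | nil =>
      have := ih [] (by simp)
      simp only [List.getD_nil, List.map_cons, List.map_map] at this ⊢
      change Nat.bit false (bval (List.map (fun _ => false) (List.range k))) = _
      rw [this]; rfl
    | cons b a =>
      simp only [List.map_cons, List.map_map]
      exact congrArg (Nat.bit b) (ih a (by simpa using h))

theorem zipPad_fst (a b : List Bool) : bval ((zipPad a b).map Prod.fst) = bval a := by
  rw [← bval_getD a (a.length + b.length) (by omega), zipPad, List.map_map]; rfl

theorem zipPad_snd (a b : List Bool) : bval ((zipPad a b).map Prod.snd) = bval b := by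
  rw [← bval_getD b (a.length + b.length) (by omega), zipPad, List.map_map]; rfl

@[fun_prop]
theorem PT.zipPad {f g : α → List Bool} (hf : PT f) (hg : PT g) :
    PT fun a => zipPad (f a) (g a) := by
  unfold SteinerTree.zipPad
  fun_prop

/-- Addition of pairs of digits with carry. -/
def addc : List (Bool × Bool) → Bool → List Bool
  | [], c => [c]
  | x :: l, c => (x.1 ^^ (x.2 ^^ c)) :: addc l ((x.1 && x.2) || (c && (x.1 || x.2)))

theorem bval_addc (l : List (Bool × Bool)) (c : Bool) :
    bval (addc l c) = bval (l.map Prod.fst) + bval (l.map Prod.snd) + c.toNat := by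
  induction l generalizing c with
  | nil => cases c <;> rfl
  | cons x l ih =>
    obtain ⟨x, y⟩ := x
    change Nat.bit _ (bval (addc l _)) = Nat.bit x (bval (l.map Prod.fst)) +
      Nat.bit y (bval (l.map Prod.snd)) + _
    rw [ih]
    simp only [Nat.bit_val]
    cases x <;> cases y <;> cases c <;> simp <;> omega

/-- Turns the recursion of `addc` into a left fold whose state is the carry and the reversed output,
the form for which polynomial time is available. -/
theorem addc_eq (l : List (Bool × Bool)) (c : Bool) (o : List Bool) :
    (fun s : Bool × List Bool => (s.1 :: s.2).reverse)
      (l.foldl (fun s x => ((x.1 && x.2) || (s.1 && (x.1 || x.2)),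
        (x.1 ^^ (x.2 ^^ s.1)) :: s.2)) (c, o)) = o.reverse ++ addc l c := by
  induction l generalizing c o with
  | nil => simp [addc]
  | cons x l ih => rw [List.foldl_cons, ih]; simp [addc]

@[fun_prop]
theorem PT.addc {f : α → List (Bool × Bool)} (hf : PT f) : PT fun a => addc (f a) false := by
  have h : PT fun a => ((f a).foldl (fun s x => ((x.1 && x.2) || (s.1 && (x.1 || x.2)),
        (x.1 ^^ (x.2 ^^ s.1)) :: s.2)) (false, ([] : List Bool))) := by
    refine PT.foldl_add (f := fun (_ : α) (s : Bool × List Bool) (x : Bool × Bool) =>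
      ((x.1 && x.2) || (s.1 && (x.1 || x.2)), (x.1 ^^ (x.2 ^^ s.1)) :: s.2)) hf (.const _)
      (by fun_prop) ⟨3, fun a c b _ => ?_⟩
    have h1 := sz_bool (b.1 && b.2 || c.1 && (b.1 || b.2))
    have h2 := sz_bool (b.1 ^^ (b.2 ^^ c.1))
    obtain ⟨c, d⟩ := c
    simp [sz_pair, sz_cons] at *; omega
  have : PT fun a => (fun s : Bool × List Bool => (s.1 :: s.2).reverse)
      ((f a).foldl (fun s x => ((x.1 && x.2) || (s.1 && (x.1 || x.2)),
        (x.1 ^^ (x.2 ^^ s.1)) :: s.2)) (false, ([] : List Bool))) :=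
    PT.comp (g := fun s : Bool × List Bool => (s.1 :: s.2).reverse) (by fun_prop) h
  simpa only [addc_eq, List.reverse_nil, List.nil_append] using this

/-- Addition. -/
def Bin.add (a b : Bin) : Bin := ⟨a.val + b.val⟩

/-- Multiplication. -/
def Bin.mul (a b : Bin) : Bin := ⟨a.val * b.val⟩

/-- Comparison. -/
def Bin.le (a b : Bin) : Bool := decide (a.val ≤ b.val)

@[fun_prop]
theorem PT.binAdd {f g : α → Bin} (hf : PT f) (hg : PT g) : PT fun a => (f a).add (g a) := by
  have : PT fun a => (⟨bval (SteinerTree.addc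
    (SteinerTree.zipPad (f a).val.bits (g a).val.bits) false)⟩ : Bin) := by fun_prop
  convert this using 3 with a
  simp [bval_addc, zipPad_fst, zipPad_snd, bval_bits, Bin.add]

/-- Digits come least significant first, so the last position where they differ decides; `r` is the
verdict when they agree everywhere. -/
theorem foldl_le_iff (l : List (Bool × Bool)) (r : Bool) :
    l.foldl (fun r x => if (x.1 == x.2) = true then r else x.2) r = true ↔
      (r = true ∧ bval (l.map Prod.fst) = bval (l.map Prod.snd)) ∨
        bval (l.map Prod.fst) < bval (l.map Prod.snd) := by
  induction l generalizing r with
  | nil => simp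
  | cons x l ih =>
    obtain ⟨x, y⟩ := x
    rw [List.foldl_cons, ih]
    change _ ↔ (_ ∧ Nat.bit x (bval (l.map Prod.fst)) = Nat.bit y (bval (l.map Prod.snd))) ∨
      Nat.bit x (bval (l.map Prod.fst)) < Nat.bit y (bval (l.map Prod.snd))
    simp only [Nat.bit_val]
    cases x <;> cases y <;> cases r <;> simp <;> omega

@[fun_prop]
theorem PT.binLe {f g : α → Bin} (hf : PT f) (hg : PT g) : PT fun a => (f a).le (g a) := by
  have : PT fun a => (SteinerTree.zipPad (f a).val.bits (g a).val.bits).foldl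
      (fun r x => if (x.1 == x.2) = true then r else x.2) true := by
    refine PT.foldl (f := fun (_ : α) (r : Bool) (x : Bool × Bool) =>
      if (x.1 == x.2) = true then r else x.2) (by fun_prop) (.const _) (by fun_prop)
      ⟨1, fun a l _ => ?_⟩
    simpa using sz_bool _
  convert this using 2 with a
  rw [Bool.eq_iff_iff, foldl_le_iff, zipPad_fst, zipPad_snd, bval_bits, bval_bits, Bin.le]
  simp [le_iff_eq_or_lt]

theorem size_add_le (a b : ℕ) : (a + b).size ≤ a.size + b.size + 1 := by
  rw [Nat.size_le]
  have h1 := Nat.lt_size_self a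
  have h2 := Nat.lt_size_self b
  have h3 : 2 ^ a.size ≤ 2 ^ (a.size + b.size) := Nat.pow_le_pow_right (by omega) (by omega)
  have h4 : 2 ^ b.size ≤ 2 ^ (a.size + b.size) := Nat.pow_le_pow_right (by omega) (by omega)
  rw [pow_succ]
  omega

theorem size_mul_le (a b : ℕ) : (a * b).size ≤ a.size + b.size := by
  rw [Nat.size_le, pow_add]
  exact Nat.mul_lt_mul'' (Nat.lt_size_self a) (Nat.lt_size_self b)

/-- One step of binary multiplication. -/
def mulStep (y : Bin) (c : Bin) (b : Bool) : Bin :=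
  (c.add c).add (if b = true then y else ⟨0⟩)

/-- One step sends `c` to `2 * c` or `2 * c + y`, so `c + y` at most doubles. This keeps all
intermediate products of polynomial length. -/
theorem foldl_mulStep_le (y : Bin) (l : List Bool) (c : Bin) :
    (l.foldl (mulStep y) c).val + y.val ≤ 2 ^ l.length * (c.val + y.val) := by
  induction l generalizing c with
  | nil => simp
  | cons b l ih =>
    refine (ih _).trans ?_
    rw [List.length_cons, pow_succ, mul_assoc]
    refine Nat.mul_le_mul_left _ ?_
    cases b <;> simp [mulStep, Bin.add] <;> omega

theorem foldr_mulStep (y : Bin) (l : List Bool) :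
    l.foldr (fun b c => mulStep y c b) ⟨0⟩ = ⟨bval l * y.val⟩ := by
  induction l with
  | nil => simp [bval]
  | cons b l ih =>
    rw [List.foldr_cons, ih]
    change _ = (⟨Nat.bit b (bval l) * y.val⟩ : Bin)
    ext
    rw [Nat.bit_val]
    cases b <;> simp [mulStep, Bin.add] <;> ring

@[fun_prop]
theorem PT.mulStep {f g : α → Bin} {h : α → Bool} (hf : PT f) (hg : PT g) (hh : PT h) :
    PT fun a => mulStep (f a) (g a) (h a) := by
  unfold SteinerTree.mulStep
  fun_prop

@[fun_prop]
theorem PT.binMul {f g : α → Bin} (hf : PT f) (hg : PT g) : PT fun a => (f a).mul (g a) := by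
  have : PT fun a => (f a).val.bits.reverse.foldl (SteinerTree.mulStep (g a)) ⟨0⟩ := by
    refine PT.foldl (f := fun a => SteinerTree.mulStep (g a)) (by fun_prop) (.const _)
      (by fun_prop) ?_
    obtain ⟨p, hp⟩ := hf.size_le
    obtain ⟨q, hq⟩ := hg.size_le
    refine ⟨2 * (p + q), fun a l hl => (Bin.sz_le _).trans ?_⟩
    have h1 := foldl_mulStep_le (g a) l ⟨0⟩
    have h2 : l.length ≤ p.eval (sz a) := by
      refine le_trans ?_ (hp a)
      have := hl.length_le
      rw [List.length_reverse] at this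
      exact this.trans (length_le_sz _)
    have h3 := (Bin.size_le_sz (g a)).trans (hq a)
    have h4 : (l.foldl (SteinerTree.mulStep (g a)) ⟨0⟩).val.size ≤ l.length + (g a).val.size := by
      rw [Nat.size_le, pow_add]
      have h5 := Nat.mul_lt_mul_of_pos_left (Nat.lt_size_self (g a).val)
        (Nat.two_pow_pos l.length)
      simp only [zero_add] at h1
      omega
    simp only [eval_mul, eval_add, eval_ofNat]
    omega
  convert this using 2 with a
  rw [List.foldl_reverse, foldr_mulStep, bval_bits]
  rfl

/-- The sum of a list of numbers. -/
def binSum (l : List Bin) : Bin := l.foldl Bin.add ⟨0⟩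

/-- The product of a list of numbers. -/
def binProd (l : List Bin) : Bin := l.foldl Bin.mul ⟨1⟩

theorem foldl_binAdd (l : List Bin) (c : Bin) :
    (l.foldl Bin.add c).val = c.val + (l.map Bin.val).sum := by
  induction l generalizing c with
  | nil => simp
  | cons b l ih => simp [ih, Bin.add, add_assoc]

theorem foldl_binMul (l : List Bin) (c : Bin) :
    (l.foldl Bin.mul c).val = c.val * (l.map Bin.val).prod := by
  induction l generalizing c with
  | nil => simp
  | cons b l ih => simp [ih, Bin.mul, mul_assoc]

theorem binSum_val (l : List Bin) : (binSum l).val = (l.map Bin.val).sum := by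
  simp [binSum, foldl_binAdd]

theorem binProd_val (l : List Bin) : (binProd l).val = (l.map Bin.val).prod := by
  simp [binProd, foldl_binMul]

theorem size_sum_le (l : List Bin) : (l.map Bin.val).sum.size ≤ sz l := by
  induction l with
  | nil => simp
  | cons b l ih =>
    rw [List.map_cons, List.sum_cons, sz_cons]
    have := size_add_le b.val (l.map Bin.val).sum
    have := b.size_le_sz
    omega

theorem size_prod_le (l : List Bin) : (l.map Bin.val).prod.size ≤ sz l + 1 := by
  induction l with
  | nil => simp
  | cons b l ih =>
    rw [List.map_cons, List.prod_cons, sz_cons]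
    have := size_mul_le b.val (l.map Bin.val).prod
    have := b.size_le_sz
    omega

@[fun_prop]
theorem PT.binSum {l : α → List Bin} (hl : PT l) : PT fun a => binSum (l a) := by
  refine PT.foldl (f := fun _ => Bin.add) hl (.const _) (by fun_prop) ?_
  obtain ⟨q, hq⟩ := hl.size_le
  refine ⟨2 * q, fun a l' hl' => (Bin.sz_le _).trans ?_⟩
  have h1 := (sz_le_of_sublist hl'.sublist).trans (hq a)
  have h2 := size_sum_le l'
  simp only [eval_mul, eval_ofNat, foldl_binAdd, zero_add]
  omega

@[fun_prop]
theorem PT.binProd {l : α → List Bin} (hl : PT l) : PT fun a => binProd (l a) := by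
  refine PT.foldl (f := fun _ => Bin.mul) hl (.const _) (by fun_prop) ?_
  obtain ⟨q, hq⟩ := hl.size_le
  refine ⟨2 * (q + 1), fun a l' hl' => (Bin.sz_le _).trans ?_⟩
  have h1 := (sz_le_of_sublist hl'.sublist).trans (hq a)
  have h2 := size_prod_le l'
  simp only [eval_mul, eval_add, eval_ofNat, foldl_binMul, one_mul, eval_one]
  omega

end

/-! ### Reachability after the removal of edges -/

section Graph
variable {V : Type}

/-- The graph with a given set of edges. -/
abbrev gr (A : Finset (Sym2 V)) : SimpleGraph V := SimpleGraph.fromEdgeSet (A : Set (Sym2 V))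

theorem reachable_of_walk {B C : Finset (Sym2 V)} {u v : V} (p : (gr B).Walk u v)
    (h : ∀ e ∈ p.edges, e ∈ C) : (gr C).Reachable u v := by
  refine ⟨p.transfer (gr C) fun e he => ?_⟩
  have := p.edges_subset_edgeSet he
  rw [SimpleGraph.edgeSet_fromEdgeSet] at this ⊢
  exact ⟨h e he, this.2⟩

theorem mem_of_mem_edges {B : Finset (Sym2 V)} {u v : V} (p : (gr B).Walk u v) {e : Sym2 V}
    (he : e ∈ p.edges) : e ∈ B := by
  have := p.edges_subset_edgeSet he
  rw [SimpleGraph.edgeSet_fromEdgeSet] at this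
  exact this.1

theorem reachable_mono {B C : Finset (Sym2 V)} (h : B ⊆ C) {u v : V}
    (p : (gr B).Reachable u v) : (gr C).Reachable u v :=
  p.elim fun p => reachable_of_walk p fun _ he => h (mem_of_mem_edges p he)

variable [DecidableEq V]

theorem reachable_adj {A : Finset (Sym2 V)} {u v : V} (h : s(u, v) ∈ A) :
    (gr A).Reachable u v := by
  by_cases huv : u = v
  · rw [huv]
  · exact SimpleGraph.Adj.reachable ((SimpleGraph.fromEdgeSet_adj _).2 ⟨h, huv⟩)

/-- The connection that avoids `e'` must pass through `e`, so an initial piece of it reaches each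
end of `e`. -/
theorem reachable_endpoint {A : Finset (Sym2 V)} {e e' : Sym2 V} {u v x : V}
    (h : (gr (A.erase e')).Reachable u v) (hn : ¬ (gr (A.erase e)).Reachable u v) (hx : x ∈ e) :
    (gr (A.erase e')).Reachable u x := by
  obtain ⟨p⟩ := h
  by_cases he : e ∈ p.edges
  · have hs : x ∈ p.support := SimpleGraph.Walk.mem_support_of_mem_edges he hx
    exact ⟨p.takeUntil x hs⟩
  · refine absurd (reachable_of_walk p fun f hf => ?_) hn
    exact Finset.mem_erase.2 ⟨fun h => he (h ▸ hf), Finset.mem_of_mem_erase (mem_of_mem_edges p hf)⟩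

theorem reachable_erase_or {A : Finset (Sym2 V)} {u v x y : V} (h : (gr A).Reachable u v) :
    (gr (A.erase s(x, y))).Reachable u v ∨ (gr (A.erase s(x, y))).Reachable u x ∨
      (gr (A.erase s(x, y))).Reachable u y := by
  obtain ⟨p⟩ := h
  induction p with
  | nil => exact .inl (.refl _)
  | @cons u w v hadj p ih =>
    by_cases he : s(u, w) = s(x, y)
    · rcases Sym2.eq_iff.1 he with ⟨rfl, rfl⟩ | ⟨rfl, rfl⟩
      · exact .inr (.inl (.refl _))
      · exact .inr (.inr (.refl _))
    · have h1 : (gr (A.erase s(x, y))).Reachable u w :=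
        reachable_adj (Finset.mem_erase.2 ⟨he, ((SimpleGraph.fromEdgeSet_adj _).1 hadj).1⟩)
      exact ih.imp h1.trans (.imp h1.trans h1.trans)

/-- Removing an edge leaves at most two components. -/
theorem reachable_erase_of_not {A : Finset (Sym2 V)} {e : Sym2 V} {r a b : V}
    (ha : (gr A).Reachable r a) (hb : (gr A).Reachable r b)
    (hna : ¬ (gr (A.erase e)).Reachable r a) (hnb : ¬ (gr (A.erase e)).Reachable r b) :
    (gr (A.erase e)).Reachable a b := by
  induction e with | _ x y
  have h0 := (reachable_erase_or (x := x) (y := y) ha).resolve_left hna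
  have h1 := (reachable_erase_or (x := x) (y := y) ha.symm).resolve_left fun h => hna h.symm
  have h2 := (reachable_erase_or (x := x) (y := y) hb.symm).resolve_left fun h => hnb h.symm
  rcases h0 with h0 | h0
  · exact (h1.resolve_left fun h => hna (h0.trans h.symm)).trans
      (h2.resolve_left fun h => hnb (h0.trans h.symm)).symm
  · exact (h1.resolve_right fun h => hna (h0.trans h.symm)).trans
      (h2.resolve_right fun h => hnb (h0.trans h.symm)).symm

/-- Crossing sides are impossible. Let `x` be an end of `e`. The connection from `r` to `b` avoiding
`e'` uses `e`, so `r` reaches `x` without `e'`. The vertices `a` and `d` are both cut off by `e'`,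
hence joined without `e'`; since `e` separates them, that connection uses `e` too, and `a` reaches
`x` without `e'`. Then `r` reaches `a` without `e'`. -/
theorem laminar_aux {A : Finset (Sym2 V)} {e e' : Sym2 V} {r a b d : V}
    (ha : (gr A).Reachable r a) (hd : (gr A).Reachable r d)
    (hae : ¬ (gr (A.erase e)).Reachable r a) (hae' : ¬ (gr (A.erase e')).Reachable r a)
    (hbe : ¬ (gr (A.erase e)).Reachable r b) (hbe' : (gr (A.erase e')).Reachable r b)
    (hde : (gr (A.erase e)).Reachable r d) (hde' : ¬ (gr (A.erase e')).Reachable r d) : False := by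
  obtain ⟨x, hx⟩ : ∃ x, x ∈ e := by induction e with | _ x y; exact ⟨x, by simp⟩
  have h1 := reachable_endpoint hbe' hbe hx
  have h2 := reachable_endpoint (reachable_erase_of_not ha hd hae' hde')
    (fun h => hae (hde.trans h.symm)) hx
  exact hae' (h1.trans h2.symm)

/-- An inclusion-minimal set of edges that connects `r` to all elements of `T`. -/
structure IsMinConn (A : Finset (Sym2 V)) (r : V) (T : Finset V) : Prop where
  conn : ∀ t ∈ T, (gr A).Reachable r t
  min : ∀ e ∈ A, ∃ t ∈ T, ¬ (gr (A.erase e)).Reachable r t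

namespace IsMinConn
variable {A : Finset (Sym2 V)} {r : V} {T : Finset V}

theorem not_reachable (hA : IsMinConn A r T) {x y : V} (he : s(x, y) ∈ A) :
    ¬ (gr (A.erase s(x, y))).Reachable x y := fun hxy => by
  have key : ∀ u v, (gr A).Reachable u v → (gr (A.erase s(x, y))).Reachable u v := by
    rintro u v ⟨p⟩
    induction p with
    | nil => exact .refl _
    | @cons u w v hadj p ih =>
      refine SimpleGraph.Reachable.trans ?_ ih
      by_cases he : s(u, w) = s(x, y)
      · rcases Sym2.eq_iff.1 he with ⟨rfl, rfl⟩ | ⟨rfl, rfl⟩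
        · exact hxy
        · exact hxy.symm
      · exact reachable_adj (Finset.mem_erase.2 ⟨he, ((SimpleGraph.fromEdgeSet_adj _).1 hadj).1⟩)
  obtain ⟨t, ht, hn⟩ := hA.min _ he
  exact hn (key _ _ (hA.conn t ht))

theorem isAcyclic (hA : IsMinConn A r T) : (gr A).IsAcyclic := by
  rw [SimpleGraph.isAcyclic_iff_forall_isBridge]
  intro e he
  induction e with | _ x y
  rw [SimpleGraph.isBridge_iff]
  rw [SimpleGraph.edgeSet_fromEdgeSet] at he
  have := hA.not_reachable he.1
  rwa [gr, Finset.coe_erase, ← SimpleGraph.deleteEdges_fromEdgeSet] at this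

/-- Paths in a forest are unique, so a connection avoiding `e` would shorten to the given path,
which contains `e`. -/
theorem not_reachable_of_mem_path (hA : IsMinConn A r T) {s t : V} {p : (gr A).Walk s t}
    (hp : p.IsPath) {e : Sym2 V} (he : e ∈ p.edges) : ¬ (gr (A.erase e)).Reachable s t := by
  rintro ⟨q⟩
  have hle : gr (A.erase e) ≤ gr A :=
    SimpleGraph.fromEdgeSet_mono (by exact_mod_cast A.erase_subset e)
  have h2 := (SimpleGraph.isAcyclic_iff_subsingleton_path.1 hA.isAcyclic s t).elim
    ⟨p, hp⟩ ((q.mapLe hle).toPath)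
  have h3 : p = (q.mapLe hle).bypass := congrArg Subtype.val h2
  rw [h3] at he
  have h4 := SimpleGraph.Walk.edges_bypass_subset_edges _ he
  rw [SimpleGraph.Walk.edges_mapLe_eq_edges] at h4
  exact Finset.notMem_erase e A (mem_of_mem_edges q h4)

/-- Removing edges that do not separate `s` from `t` leaves `s` and `t` connected. -/
theorem reachable_sdiff (hA : IsMinConn A r T) {s t : V} (hs : (gr A).Reachable r s)
    (ht : (gr A).Reachable r t) {D : Finset (Sym2 V)}
    (hD : ∀ e ∈ D, (gr (A.erase e)).Reachable r s ↔ (gr (A.erase e)).Reachable r t) :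
    (gr (A \ D)).Reachable s t := by
  obtain ⟨p, hp⟩ := (hs.symm.trans ht).exists_isPath
  refine reachable_of_walk p fun e he => Finset.mem_sdiff.2 ⟨mem_of_mem_edges p he, fun heD => ?_⟩
  refine hA.not_reachable_of_mem_path hp he ?_
  by_cases h : (gr (A.erase e)).Reachable r s
  · exact h.symm.trans ((hD e heD).1 h)
  · exact reachable_erase_of_not hs ht h fun h' => h ((hD e heD).2 h')

end IsMinConn

/-! ### Closed walks that use every edge at most twice -/

/-- A closed walk that misses a reachable vertex has an edge `xy` from a visited `x` to an unvisited
`y`; insert the detour `x, y, x`. This edge was not used before, because `y` was not visited. The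
induction is on the number of unvisited vertices. -/
theorem exists_double_tour [Fintype V] (G : SimpleGraph V) (r : V) :
    ∃ q : G.Walk r r, (∀ v, G.Reachable r v → v ∈ q.support) ∧ ∀ e, q.edges.count e ≤ 2 := by
  suffices h : ∀ k, ∀ q : G.Walk r r, (∀ e, q.edges.count e ≤ 2) →
      Fintype.card V - q.support.toFinset.card = k →
      ∃ q : G.Walk r r, (∀ v, G.Reachable r v → v ∈ q.support) ∧ ∀ e, q.edges.count e ≤ 2 from
    h _ .nil (by simp) rfl
  intro k
  induction k using Nat.strong_induction_on with
  | _ k ih =>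
    intro q hq hk
    by_cases hall : ∀ v, G.Reachable r v → v ∈ q.support
    · exact ⟨q, hall, hq⟩
    push Not at hall
    obtain ⟨v, ⟨p⟩, hv⟩ := hall
    obtain ⟨d, _, hx, hy⟩ := p.exists_boundary_dart {v | v ∈ q.support} q.start_mem_support hv
    obtain ⟨⟨x, y⟩, hadj⟩ := d
    simp only [Set.mem_ofPred_eq] at hx hy
    let q' : G.Walk r r := (q.takeUntil x hx).append (.cons hadj (.cons hadj.symm (q.dropUntil x hx)))
    have hspec := q.take_spec hx
    have hE : ∀ e, q'.edges.count e = q.edges.count e + if s(x, y) = e then 2 else 0 := by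
      intro e
      rw [← congrArg SimpleGraph.Walk.edges hspec]
      simp only [q', SimpleGraph.Walk.edges_append, SimpleGraph.Walk.edges_cons, List.count_append,
        List.count_cons, Sym2.eq_swap (a := y) (b := x), beq_iff_eq]
      split <;> omega
    have hsub : insert y q.support.toFinset ⊆ q'.support.toFinset := by
      intro z hz
      simp only [q', List.mem_toFinset, SimpleGraph.Walk.mem_support_append_iff,
        SimpleGraph.Walk.support_cons, List.mem_cons, Finset.mem_insert] at hz ⊢
      rcases hz with rfl | hz
      · simp
      · rw [← congrArg SimpleGraph.Walk.support hspec,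
          SimpleGraph.Walk.mem_support_append_iff] at hz
        tauto
    have hcard := Finset.card_le_card hsub
    rw [Finset.card_insert_of_notMem (by simpa using hy)] at hcard
    have hle := Finset.card_le_univ q'.support.toFinset
    refine ih _ ?_ q' (fun e => ?_) rfl
    · have : Fintype.card V = (Finset.univ : Finset V).card := rfl
      omega
    · rw [hE]
      split
      · next h =>
        subst h
        have : q.edges.count s(x, y) = 0 := List.count_eq_zero.2 fun h =>
          hy (SimpleGraph.Walk.snd_mem_support_of_mem_edges _ h)
        omega
      · exact hq e

end Graph

/-! ### Weighted laminar families and connecting walks -/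

section Laminar
variable {V : Type} [DecidableEq V]

/-- Every subfamily of `𝓛` with distinct non-empty traces on `S` has weight at most `B`. -/
def TraceBound (𝓛 : Finset (Finset V)) (w : Finset V → ℕ) (S : Finset V) (B : ℕ) : Prop :=
  ∀ I ⊆ 𝓛, (∀ Z ∈ I, (Z ∩ S).Nonempty) → (∀ Z ∈ I, ∀ Z' ∈ I, Z ∩ S = Z' ∩ S → Z = Z') →
    ∑ Z ∈ I, w Z ≤ B

theorem TraceBound.mono {𝓛 : Finset (Finset V)} {w : Finset V → ℕ} {S : Finset V} {B B' : ℕ}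
    (h : TraceBound 𝓛 w S B) (hB : B ≤ B') : TraceBound 𝓛 w S B' :=
  fun I h1 h2 h3 => (h I h1 h2 h3).trans hB

theorem sum_le_of_card_le_one {ι : Type} {s : Finset ι} {w : ι → ℕ} {c : ℕ} (h1 : s.card ≤ 1)
    (h : ∀ i ∈ s, w i ≤ c) : ∑ i ∈ s, w i ≤ c := by
  refine (Finset.sum_le_card_nsmul s w c h).trans ?_
  rw [smul_eq_mul]
  exact (Nat.mul_le_mul_right c h1).trans (one_mul c).le

/-- Adding a point `u` linked to an old point `v` creates at most two new traces, and both can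
be chosen to separate `u` from `v`. -/
theorem TraceBound.insert {𝓛 : Finset (Finset V)} {w : Finset V → ℕ} {S : Finset V} {B c : ℕ}
    {u v : V} (h : TraceBound 𝓛 w S B)
    (hlam : ∀ Z ∈ 𝓛, ∀ Z' ∈ 𝓛, Z ⊆ Z' ∨ Z' ⊆ Z ∨ Disjoint Z Z') (hu : u ∉ S) (hv : v ∈ S)
    (hc : ∀ Z ∈ 𝓛, ¬ (u ∈ Z ↔ v ∈ Z) → w Z ≤ c) :
    TraceBound 𝓛 w (insert u S) (B + 2 * c) := by
  intro I hI hne hinj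
  have ext' : ∀ Z ∈ I, ∀ Z' ∈ I, Z ∩ S = Z' ∩ S → (u ∈ Z ↔ u ∈ Z') → Z = Z' := by
    intro Z hZ Z' hZ' h1 h2
    refine hinj Z hZ Z' hZ' (Finset.ext fun x => ?_)
    have := Finset.ext_iff.1 h1 x
    simp only [Finset.mem_inter, Finset.mem_insert] at this ⊢
    by_cases hx : x = u
    · subst hx; tauto
    · tauto
  have trace_iff : ∀ {Z Z' : Finset V}, Z ∩ S = Z' ∩ S → ∀ x ∈ S, (x ∈ Z ↔ x ∈ Z') := by
    intro Z Z' h x hx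
    have := Finset.ext_iff.1 h x
    simp only [Finset.mem_inter] at this
    tauto
  -- `P` marks the sets whose trace on `insert u S` is `{u}`. `Q` marks the sets that separate `u`
  -- from `v` and have a twin in `I` with the same trace on `S`. Each kind occurs at most once
  -- (within `J` for `Q`), and the remaining sets have distinct non-empty traces on `S`.
  set P : Finset V → Prop := fun Z => Z ∩ S = ∅ with hP
  set Q : Finset V → Prop := fun Z => ¬ (u ∈ Z ↔ v ∈ Z) ∧ ∃ Z' ∈ I, Z' ≠ Z ∧ Z' ∩ S = Z ∩ S
    with hQ
  classical
  set J := I.filter fun Z => ¬ P Z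
  have hP1 : ∑ Z ∈ I.filter P, w Z ≤ c := by
    have hmem : ∀ Z ∈ I.filter P, u ∈ Z := by
      intro Z hZ
      rw [Finset.mem_filter] at hZ
      obtain ⟨x, hx⟩ := hne Z hZ.1
      rw [Finset.mem_inter, Finset.mem_insert] at hx
      rcases hx.2 with rfl | h
      · exact hx.1
      · exact absurd (Finset.mem_inter.2 ⟨hx.1, h⟩) (by rw [hZ.2]; exact Finset.notMem_empty x)
    refine sum_le_of_card_le_one (Finset.card_le_one.2 fun Z hZ Z' hZ' => ?_) fun Z hZ => ?_
    · have h1 := hmem Z hZ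
      have h2 := hmem Z' hZ'
      rw [Finset.mem_filter] at hZ hZ'
      exact ext' Z hZ.1 Z' hZ'.1 (hZ.2.trans hZ'.2.symm) (iff_of_true h1 h2)
    · have h1 := hmem Z hZ
      rw [Finset.mem_filter] at hZ
      refine hc Z (hI hZ.1) fun h' => ?_
      exact absurd (Finset.mem_inter.2 ⟨h'.1 h1, hv⟩) (by rw [hZ.2]; exact Finset.notMem_empty v)
  have nested : ∀ Z ∈ I, ∀ Z' ∈ I, (Z ∩ Z').Nonempty → Z ⊆ Z' ∨ Z' ⊆ Z := by
    intro Z hZ Z' hZ' hn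
    rcases hlam Z (hI hZ) Z' (hI hZ') with h | h | h
    · exact .inl h
    · exact .inr h
    · exact absurd (Finset.disjoint_iff_inter_eq_empty.1 h) hn.ne_empty
  -- the pairs `Z ⊂ Z ∪ {u}` on `S ∪ {u}`
  have pair_sub : ∀ N ∈ I, ∀ M ∈ I, ∀ N' ∈ I, ∀ M' ∈ I, (N ∩ S).Nonempty → N ∩ S = M ∩ S →
      N' ∩ S = M' ∩ S → u ∈ M → u ∉ N → u ∈ M' → u ∉ N' → M ⊆ M' → N ∩ S = N' ∩ S := by
    intro N hN M hM N' hN' M' hM' hn h1 h2 huM huN huM' huN' hMM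
    obtain ⟨x, hx⟩ := hn
    rw [Finset.mem_inter] at hx
    have hxM := (trace_iff h1 x hx.2).1 hx.1
    have hxN' := (trace_iff h2 x hx.2).2 (hMM hxM)
    -- `N'` shares with `M` a point of `S` but misses `u ∈ M`, so laminarity leaves only this
    -- inclusion. Hence the traces are squeezed together.
    have hsub : N' ⊆ M := (nested N' hN' M hM ⟨x, Finset.mem_inter.2 ⟨hxN', hxM⟩⟩).resolve_right
      fun h => huN' (h huM)
    refine Finset.Subset.antisymm (fun z hz => ?_) fun z hz => ?_
    · rw [Finset.mem_inter] at hz ⊢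
      exact ⟨(trace_iff h2 z hz.2).2 (hMM ((trace_iff h1 z hz.2).1 hz.1)), hz.2⟩
    · rw [Finset.mem_inter] at hz ⊢
      exact ⟨(trace_iff h1 z hz.2).2 (hsub hz.1), hz.2⟩
  have hQ1 : ∑ Z ∈ J.filter Q, w Z ≤ c := by
    refine sum_le_of_card_le_one (Finset.card_le_one.2 fun Z hZ Z' hZ' => ?_) fun Z hZ => ?_
    · simp only [J, Finset.mem_filter] at hZ hZ'
      obtain ⟨⟨hZI, hZP⟩, hZx, W, hW, hWne, hWS⟩ := hZ
      obtain ⟨⟨hZI', hZP'⟩, hZx', W', hW', hWne', hWS'⟩ := hZ'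
      have hZn : (Z ∩ S).Nonempty := Finset.nonempty_iff_ne_empty.2 hZP
      have hZn' : (Z' ∩ S).Nonempty := Finset.nonempty_iff_ne_empty.2 hZP'
      have hu1 : ¬ (u ∈ W ↔ u ∈ Z) := fun h => hWne (ext' W hW Z hZI hWS h)
      have hu2 : ¬ (u ∈ W' ↔ u ∈ Z') := fun h => hWne' (ext' W' hW' Z' hZI' hWS' h)
      have t1 : u ∈ W ↔ u ∉ Z := by clear * - hu1; tauto
      have t2 : u ∈ W' ↔ u ∉ Z' := by clear * - hu2; tauto
      -- In each pair of twins exactly one set contains `u`. The case distinction only decides which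
      -- member of each pair plays this role.
      have same : Z ∩ S = Z' ∩ S := by
        have main : ∀ N ∈ I, ∀ M ∈ I, ∀ N' ∈ I, ∀ M' ∈ I, (N ∩ S).Nonempty → (N' ∩ S).Nonempty →
            N ∩ S = M ∩ S → N' ∩ S = M' ∩ S → u ∈ M → u ∉ N → u ∈ M' → u ∉ N' →
            N ∩ S = N' ∩ S := by
          intro N hN M hM N' hN' M' hM' hn hn' h1 h2 huM huN huM' huN'
          rcases nested M hM M' hM' ⟨u, Finset.mem_inter.2 ⟨huM, huM'⟩⟩ with h | h
          · exact pair_sub N hN M hM N' hN' M' hM' hn h1 h2 huM huN huM' huN' h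
          · exact (pair_sub N' hN' M' hM' N hN M hM hn' h2 h1 huM' huN' huM huN h).symm
        by_cases a1 : u ∈ Z <;> by_cases a2 : u ∈ Z'
        · have := main W hW Z hZI W' hW' Z' hZI' (hWS ▸ hZn) (hWS' ▸ hZn') hWS hWS' a1
            (fun h => t1.1 h a1) a2 (fun h => t2.1 h a2)
          rw [← hWS, ← hWS', this]
        · have := main W hW Z hZI Z' hZI' W' hW' (hWS ▸ hZn) hZn' hWS hWS'.symm a1
            (fun h => t1.1 h a1) (t2.2 a2) a2
          rw [← hWS, this]
        · have := main Z hZI W hW W' hW' Z' hZI' hZn (hWS' ▸ hZn') hWS.symm hWS' (t1.2 a1)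
            a1 a2 (fun h => t2.1 h a2)
          rw [← hWS', this]
        · exact main Z hZI W hW Z' hZI' W' hW' hZn hZn' hWS.symm hWS'.symm (t1.2 a1)
            a1 (t2.2 a2) a2
      have := trace_iff same v hv
      exact ext' Z hZI Z' hZI' same (by clear * - hZx hZx' this; tauto)
    · simp only [J, Finset.mem_filter] at hZ
      exact hc Z (hI hZ.1.1) hZ.2.1
  -- Twins agree on `v` and differ on `u`, so one of them separates `u` from `v` and has been
  -- removed through `Q`.
  have hR : ∑ Z ∈ J.filter (fun Z => ¬ Q Z), w Z ≤ B := by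
    refine h _ (fun Z hZ => ?_) (fun Z hZ => ?_) fun Z hZ Z' hZ' hS => ?_
    · simp only [J, Finset.mem_filter] at hZ; exact hI hZ.1.1
    · simp only [J, Finset.mem_filter] at hZ; exact Finset.nonempty_iff_ne_empty.2 hZ.1.2
    · simp only [J, Finset.mem_filter] at hZ hZ'
      by_contra hne'
      have h1 : (u ∈ Z ↔ v ∈ Z) := by
        by_contra h'; exact hZ.2 ⟨h', Z', hZ'.1.1, fun h => hne' h.symm, hS.symm⟩
      have h2 : (u ∈ Z' ↔ v ∈ Z') := by
        by_contra h'; exact hZ'.2 ⟨h', Z, hZ.1.1, hne', hS⟩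
      have := trace_iff hS v hv
      exact hne' (ext' Z hZ.1.1 Z' hZ'.1.1 hS (by clear * - h1 h2 this; tauto))
  have e1 : ∑ Z ∈ I.filter P, w Z + ∑ Z ∈ J, w Z = ∑ Z ∈ I, w Z := by
    convert Finset.sum_filter_add_sum_filter_not I P w
  have e2 : ∑ Z ∈ J.filter Q, w Z + ∑ Z ∈ J.filter (fun Z => ¬ Q Z), w Z = ∑ Z ∈ J, w Z := by
    convert Finset.sum_filter_add_sum_filter_not J Q w
  omega

/-- Induction along `q`, with `S` the points of `Sp` met so far, `v` the last of them and `p` the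
walk from `v` to the current vertex whose cost is not yet charged. On arrival at a new point of
`Sp`, `TraceBound.insert` charges twice the cost of `p` plus `2 * g`; the latter is absorbed by the
growth of the cardinality. -/
theorem TraceBound.walk {𝓛 : Finset (Finset V)} {w : Finset V → ℕ} {Sp : Finset V} {g : ℕ}
    {G : SimpleGraph V} {c : Sym2 V → ℕ}
    (hlam : ∀ Z ∈ 𝓛, ∀ Z' ∈ 𝓛, Z ⊆ Z' ∨ Z' ⊆ Z ∨ Disjoint Z Z')
    (hcross : ∀ Z ∈ 𝓛, ∀ u ∈ Sp, ∀ v ∈ Sp, u ∈ Z → v ∉ Z → ∀ p : G.Walk u v,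
      w Z ≤ (p.edges.map c).sum + g)
    {x y : V} (q : G.Walk x y) : ∀ (S : Finset V) (v : V) (p : G.Walk v x) (B : ℕ), v ∈ S →
      S ⊆ Sp → TraceBound 𝓛 w S (B + 2 * g * S.card) →
      ∃ S' ⊆ Sp, S ⊆ S' ∧ (∀ z ∈ q.support, z ∈ Sp → z ∈ S') ∧
        TraceBound 𝓛 w S' (B + 2 * ((p.edges.map c).sum + (q.edges.map c).sum) +
          2 * g * S'.card) := by
  have visit : ∀ (x : V) (S : Finset V) (v : V) (p : G.Walk v x) (B : ℕ), v ∈ S → S ⊆ Sp →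
      TraceBound 𝓛 w S (B + 2 * g * S.card) → x ∈ Sp → TraceBound 𝓛 w (Insert.insert x S)
        (B + 2 * (p.edges.map c).sum + 2 * g * (Insert.insert x S).card) := by
    intro x S v p B hv hS hB hx
    by_cases hxS : x ∈ S
    · rw [Finset.insert_eq_of_mem hxS]
      exact hB.mono (by omega)
    · rw [Finset.card_insert_of_notMem hxS]
      refine (hB.insert (c := (p.edges.map c).sum + g) hlam hxS hv fun Z hZ hsep => ?_).mono
        (by ring_nf; omega)
      by_cases hxZ : x ∈ Z
      · have := hcross Z hZ x hx v (hS hv) hxZ (by tauto) p.reverse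
        rwa [SimpleGraph.Walk.edges_reverse, List.map_reverse, List.sum_reverse] at this
      · exact hcross Z hZ v (hS hv) x hx (by tauto) hxZ p
  induction q with
  | @nil x =>
    intro S v p B hv hS hB
    by_cases hx : x ∈ Sp
    · refine ⟨Insert.insert x S, Finset.insert_subset hx hS, Finset.subset_insert _ _, ?_, ?_⟩
      · simp
      · simpa using visit x S v p B hv hS hB hx
    · refine ⟨S, hS, subset_rfl, ?_, hB.mono (by omega)⟩
      intro z hz hz'
      simp only [SimpleGraph.Walk.support_nil, List.mem_singleton] at hz
      exact absurd (hz ▸ hz') hx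
  | @cons x x' y hadj q ih =>
    intro S v p B hv hS hB
    by_cases hx : x ∈ Sp
    -- The walk `p` has been charged; the next uncharged walk starts at `x` with the edge just
    -- taken.
    · obtain ⟨S', h1, h2, h3, h4⟩ := ih (Insert.insert x S) x (.cons hadj .nil)
        (B + 2 * (p.edges.map c).sum) (Finset.mem_insert_self x S)
        (Finset.insert_subset hx hS) (visit x S v p B hv hS hB hx)
      refine ⟨S', h1, (Finset.subset_insert _ _).trans h2, fun z hz hz' => ?_, h4.mono ?_⟩
      · rw [SimpleGraph.Walk.support_cons, List.mem_cons] at hz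
        rcases hz with rfl | hz
        · exact h2 (Finset.mem_insert_self _ S)
        · exact h3 z hz hz'
      · simp only [SimpleGraph.Walk.edges_cons, SimpleGraph.Walk.edges_nil, List.map_cons,
          List.map_nil, List.sum_cons, List.sum_nil]
        omega
    · obtain ⟨S', h1, h2, h3, h4⟩ := ih S v (p.concat hadj) B hv hS hB
      refine ⟨S', h1, h2, fun z hz hz' => ?_, h4.mono ?_⟩
      · rw [SimpleGraph.Walk.support_cons, List.mem_cons] at hz
        rcases hz with rfl | hz
        · exact absurd hz' hx
        · exact h3 z hz hz'
      · simp only [SimpleGraph.Walk.edges_concat, SimpleGraph.Walk.edges_cons, List.map_cons,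
          List.concat_eq_append, List.map_append, List.sum_append, List.map_nil,
          List.sum_cons, List.sum_nil]
        omega

end Laminar

/-! ### Segments and the approximation bound for local optima -/

section Local
variable {V : Type} [DecidableEq V]

open Classical in
/-- The edges of `A` whose removal separates the elements of `T`, `u` and `v` in the same way as
the removal of `e`. -/
noncomputable def segment (A : Finset (Sym2 V)) (r : V) (T : Finset V) (e : Sym2 V) (u v : V) :
    Finset (Sym2 V) :=
  A.filter fun e' => ∀ t ∈ insert u (insert v T),
    ((gr (A.erase e)).Reachable r t ↔ (gr (A.erase e')).Reachable r t)

theorem mem_segment {A : Finset (Sym2 V)} {r : V} {T : Finset V} {e e' : Sym2 V} {u v : V} :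
    e' ∈ segment A r T e u v ↔ e' ∈ A ∧ ∀ t ∈ insert u (insert v T),
      ((gr (A.erase e)).Reachable r t ↔ (gr (A.erase e')).Reachable r t) := by
  classical
  rw [segment, Finset.mem_filter]

/-- No edge of the segment separates two vertices of `T`, `u`, `v` that lie on the same side of `e`.
So after its removal the vertices on the side of `r` stay joined to `v`, those on the other side
stay joined to `u`, and the new edge `uv` reconnects both groups. -/
theorem reachable_insert_segment {A : Finset (Sym2 V)} {r : V} {T : Finset V}
    (hA : IsMinConn A r T) {e : Sym2 V} {u v : V} (hu : (gr A).Reachable r u)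
    (hv : (gr A).Reachable r v) (hue : ¬ (gr (A.erase e)).Reachable r u)
    (hve : (gr (A.erase e)).Reachable r v) :
    ∀ t ∈ T, (gr (insert s(u, v) (A \ segment A r T e u v))).Reachable r t := by
  have mono : ∀ a b, (gr (A \ segment A r T e u v)).Reachable a b →
      (gr (insert s(u, v) (A \ segment A r T e u v))).Reachable a b :=
    fun a b h => reachable_mono (Finset.subset_insert _ _) h
  have hseg : ∀ e' ∈ segment A r T e u v, ∀ t, t = u ∨ t = v ∨ t ∈ T →
      ((gr (A.erase e)).Reachable r t ↔ (gr (A.erase e')).Reachable r t) := fun e' he' t ht =>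
    (mem_segment.1 he').2 t (by simpa using ht)
  intro t ht
  have htA := hA.conn t ht
  by_cases h : (gr (A.erase e)).Reachable r t
  · exact mono _ _ (hA.reachable_sdiff (.refl r) htA fun e' he' =>
      iff_of_true (.refl r) ((hseg e' he' t (.inr (.inr ht))).1 h))
  · have h1 := hA.reachable_sdiff (D := segment A r T e u v) (.refl r) hv fun e' he' =>
      iff_of_true (.refl r) ((hseg e' he' v (.inr (.inl rfl))).1 hve)
    have h2 := hA.reachable_sdiff (D := segment A r T e u v) hu htA fun e' he' =>
      iff_of_false (fun h' => hue ((hseg e' he' u (.inl rfl)).2 h'))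
        (fun h' => h ((hseg e' he' t (.inr (.inr ht))).2 h'))
    have h3 : (gr (insert s(u, v) (A \ segment A r T e u v))).Reachable u v :=
      reachable_adj (Finset.mem_insert_self _ _)
    exact ((mono _ _ h1).trans h3.symm).trans (mono _ _ h2)

theorem list_sum_le_of_count_le (l : List (Sym2 V)) (F : Finset (Sym2 V)) (c : Sym2 V → ℕ)
    (hF : ∀ e ∈ l, e ∈ F) (hl : ∀ e, l.count e ≤ 2) : (l.map c).sum ≤ 2 * ∑ e ∈ F, c e := by
  rw [Finset.sum_list_map_count, Finset.mul_sum]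
  refine (Finset.sum_le_sum fun e _ => ?_).trans
    (Finset.sum_le_sum_of_subset fun e he => hF e (List.mem_toFinset.1 he))
  rw [smul_eq_mul]
  exact Nat.mul_le_mul_right _ (hl e)

theorem sum_toFinset_le (l : List (Sym2 V)) (c : Sym2 V → ℕ) :
    ∑ e ∈ l.toFinset, c e ≤ (l.map c).sum := by
  rw [Finset.sum_list_map_count]
  refine Finset.sum_le_sum fun e he => ?_
  rw [smul_eq_mul]
  exact Nat.le_mul_of_pos_left _ (List.count_pos_iff.2 (List.mem_toFinset.1 he))

/-- A minimal solution that cannot be improved by more than `g` by exchanging a segment for a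
walk is `4`-approximate in the difference sense, up to an error proportional to `g`. -/
theorem difference_bound [Fintype V] {A F : Finset (Sym2 V)} {r : V} {T : Finset V} (c : Sym2 V → ℕ) (g : ℕ)
    (hA : IsMinConn A r T) (hrT : T.Nonempty → r ∈ T) (hF : ∀ t ∈ T, (gr F).Reachable r t)
    (hswap : ∀ e ∈ A, ∀ u v, ∀ p : (gr F).Walk u v, p.IsPath →
      (∀ t ∈ T, (gr (insert s(u, v) (A \ segment A r T e u v))).Reachable r t) →
      ∑ e ∈ A, c e ≤ ∑ e ∈ A \ segment A r T e u v, c e +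
        ∑ e ∈ p.edges.toFinset \ (A \ segment A r T e u v), c e + g) :
    ∑ e ∈ A \ F, c e ≤ 4 * ∑ e ∈ F \ A, c e + 2 * g * Fintype.card V := by
  classical
  -- Only vertices joined to `r` in both graphs matter: sides are measured in `A`, while the tour
  -- runs in `F`.
  set Sp : Finset V := Finset.univ.filter fun v => (gr A).Reachable r v ∧ (gr F).Reachable r v
    with hSp
  have hTSp : T ⊆ Sp := fun t ht => by simp [hSp, hA.conn t ht, hF t ht]
  have hrSp : r ∈ Sp := by simp [hSp]
  set side : Sym2 V → Finset V := fun e => Sp.filter fun v => ¬ (gr (A.erase e)).Reachable r v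
    with hside
  set 𝓛 := (A \ F).image side with h𝓛
  set w : Finset V → ℕ := fun Z => ∑ e ∈ (A \ F).filter (fun e => side e = Z), c e with hw
  -- The walk is charged for its edges outside `A` only, which is what makes this a bound on
  -- differences.
  set c' : Sym2 V → ℕ := fun e => if e ∈ A then 0 else c e with hc'
  have mem_side : ∀ {e v}, v ∈ side e ↔ v ∈ Sp ∧ ¬ (gr (A.erase e)).Reachable r v := by
    intro e v; simp [hside]
  have hlam : ∀ Z ∈ 𝓛, ∀ Z' ∈ 𝓛, Z ⊆ Z' ∨ Z' ⊆ Z ∨ Disjoint Z Z' := by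
    intro Z hZ Z' hZ'
    obtain ⟨e, he, rfl⟩ := Finset.mem_image.1 hZ
    obtain ⟨e', he', rfl⟩ := Finset.mem_image.1 hZ'
    by_contra hcon
    push Not at hcon
    obtain ⟨h1, h2, h3⟩ := hcon
    obtain ⟨b, hb, hb'⟩ := Finset.not_subset.1 h1
    obtain ⟨d, hd, hd'⟩ := Finset.not_subset.1 h2
    obtain ⟨a, ha, ha'⟩ := Finset.not_disjoint_iff.1 h3
    have hA' : ∀ x, x ∈ Sp → (gr A).Reachable r x := fun x hx => (Finset.mem_filter.1 hx).2.1
    rw [mem_side] at hb hb' hd hd' ha ha'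
    exact laminar_aux (hA' a ha.1) (hA' d hd.1) ha.2 ha'.2 hb.2
      (not_not.1 fun h => hb' ⟨hb.1, h⟩) (not_not.1 fun h => hd' ⟨hd.1, h⟩) hd.2
  have hcross : ∀ Z ∈ 𝓛, ∀ u ∈ Sp, ∀ v ∈ Sp, u ∈ Z → v ∉ Z → ∀ p : (gr F).Walk u v,
      w Z ≤ (p.edges.map c').sum + g := by
    intro Z hZ u hu v hv huZ hvZ p
    obtain ⟨e, he, rfl⟩ := Finset.mem_image.1 hZ
    rw [mem_side] at huZ hvZ
    have hve := not_not.1 fun h => hvZ ⟨hv, h⟩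
    have hsw := hswap e (Finset.mem_sdiff.1 he).1 u v p.bypass p.bypass_isPath
      (reachable_insert_segment hA (Finset.mem_filter.1 hu).2.1 (Finset.mem_filter.1 hv).2.1
        huZ.2 hve)
    set D := segment A r T e u v with hD
    set P := p.bypass.edges.toFinset with hP
    have hPp : P ⊆ p.edges.toFinset := fun x hx => by
      rw [hP, List.mem_toFinset] at hx
      exact List.mem_toFinset.2 (p.edges_bypass_subset_edges hx)
    have hPF : P ⊆ F := fun x hx =>
      mem_of_mem_edges p (List.mem_toFinset.1 (hPp hx))
    have hDA : D ⊆ A := fun x hx => (mem_segment.1 hx).1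
    -- `Sp` contains `T`, `u` and `v`, so edges with the same trace on `Sp` lie in one segment. They
    -- also avoid the path, because they are outside `F`.
    have hsub : (A \ F).filter (fun e' => side e' = side e) ⊆ D \ P := by
      intro e' he'
      rw [Finset.mem_filter, Finset.mem_sdiff] at he'
      refine Finset.mem_sdiff.2 ⟨mem_segment.2 ⟨he'.1.1, fun t ht => ?_⟩,
        fun h => he'.1.2 (hPF h)⟩
      have htS : t ∈ Sp := by
        rw [Finset.mem_insert, Finset.mem_insert] at ht
        rcases ht with rfl | rfl | ht
        · exact hu
        · exact hv
        · exact hTSp ht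
      have := Finset.ext_iff.1 he'.2 t
      rw [mem_side, mem_side] at this
      clear * - htS this
      tauto
    have e1 : ∑ x ∈ A \ D, c x + ∑ x ∈ D, c x = ∑ x ∈ A, c x := Finset.sum_sdiff hDA
    have e2 : ∑ x ∈ D \ P, c x + ∑ x ∈ D ∩ P, c x = ∑ x ∈ D, c x := by
      rw [add_comm]; exact Finset.sum_inter_add_sum_sdiff D P c
    -- An edge of the path that was deleted with the segment has to be paid for again. This cost
    -- cancels against the same term in `e2` and leaves `c(D \ P) ≤ c(P \ A) + g`.
    have e3 : ∑ x ∈ P \ (A \ D), c x ≤ ∑ x ∈ P \ A, c x + ∑ x ∈ D ∩ P, c x := by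
      rw [← Finset.sum_union]
      · refine Finset.sum_le_sum_of_subset fun x hx => ?_
        simp only [Finset.mem_sdiff, Finset.mem_union, Finset.mem_inter] at hx ⊢
        tauto
      · rw [Finset.disjoint_left]
        intro x hx hx'
        exact (Finset.mem_sdiff.1 hx).2 (hDA (Finset.mem_inter.1 hx').1)
    have e4 : ∑ x ∈ P \ A, c x ≤ (p.edges.map c').sum := by
      refine le_trans ?_ (sum_toFinset_le p.edges c')
      refine le_trans (le_of_eq ?_)
        (Finset.sum_le_sum_of_subset (Finset.sdiff_subset.trans hPp : P \ A ⊆ _))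
      exact Finset.sum_congr rfl fun x hx => by simp [hc', (Finset.mem_sdiff.1 hx).2]
    have e5 : w (side e) ≤ ∑ x ∈ D \ P, c x := Finset.sum_le_sum_of_subset hsub
    omega
  obtain ⟨q, hq, hq2⟩ := exists_double_tour (gr F) r
  -- No side contains `r`, so there is no non-empty trace yet.
  have hbase : TraceBound 𝓛 w {r} (0 + 2 * g * ({r} : Finset V).card) := by
    intro I hI hne _
    rw [Finset.sum_eq_zero]
    · exact Nat.zero_le _
    · intro Z hZ
      obtain ⟨x, hx⟩ := hne Z hZ
      obtain ⟨e, he, rfl⟩ := Finset.mem_image.1 (hI hZ)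
      rw [Finset.mem_inter, Finset.mem_singleton, mem_side] at hx
      exact absurd (hx.2 ▸ .refl _) hx.1.2
  obtain ⟨S', hS', _, hvis, hbd⟩ := TraceBound.walk hlam hcross q {r} r .nil 0
    (Finset.mem_singleton_self r) (by simpa using hrSp) hbase
  have hSS : S' = Sp := Finset.Subset.antisymm hS' fun z hz =>
    hvis z (hq z (Finset.mem_filter.1 hz).2.2) hz
  rw [hSS] at hbd
  have hsubset : ∀ Z ∈ 𝓛, Z ∩ Sp = Z := by
    intro Z hZ
    obtain ⟨e, he, rfl⟩ := Finset.mem_image.1 hZ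
    exact Finset.inter_eq_left.2 (Finset.filter_subset _ _)
  -- On all of `Sp` every side is its own trace; it is non-empty because, by minimality, each edge
  -- cuts off some terminal.
  have hfin := hbd 𝓛 subset_rfl
    (fun Z hZ => by
      rw [hsubset Z hZ]
      obtain ⟨e, he, rfl⟩ := Finset.mem_image.1 hZ
      obtain ⟨t, ht, hn⟩ := hA.min e (Finset.mem_sdiff.1 he).1
      exact ⟨t, mem_side.2 ⟨hTSp ht, hn⟩⟩)
    (fun Z hZ Z' hZ' h => by rwa [hsubset Z hZ, hsubset Z' hZ'] at h)
  have hsum : ∑ Z ∈ 𝓛, w Z = ∑ e ∈ A \ F, c e :=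
    Finset.sum_fiberwise_of_maps_to (fun e he => Finset.mem_image_of_mem side he) c
  have hc : (q.edges.map c').sum ≤ 2 * ∑ e ∈ F \ A, c e := by
    refine (list_sum_le_of_count_le q.edges F c' (fun e he => mem_of_mem_edges q he) hq2).trans ?_
    refine Nat.mul_le_mul_left 2 (le_of_eq ?_)
    rw [Finset.sdiff_eq_filter, Finset.sum_filter]
    exact Finset.sum_congr rfl fun e _ => by simp only [hc']; split <;> simp_all
  rw [hsum] at hfin
  have hcard : 2 * g * Sp.card ≤ 2 * g * Fintype.card V :=
    Nat.mul_le_mul_left _ (Finset.card_le_univ _)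
  simp only [SimpleGraph.Walk.edges_nil, List.map_nil, List.sum_nil] at hfin
  omega

end Local

/-! ### The local search algorithm on lists of edges -/

/-- An edge with its end vertices and its cost. -/
abbrev Edge : Type := (ℕ × ℕ) × Bin

/-- `e` joins `u` and `v`. -/
def joins (e : Edge) (u v : ℕ) : Bool :=
  (e.1.1 == u && e.1.2 == v) || (e.1.1 == v && e.1.2 == u)

/-- The two edges have the same end vertices. -/
def same (e f : Edge) : Bool := e.1.1 == f.1.1 && e.1.2 == f.1.2

/-- Membership in a list of edges. -/
def memE (A : List Edge) (e : Edge) : Bool := A.any fun f => same f e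

/-- Remove an edge. -/
def eraseE (A : List Edge) (e : Edge) : List Edge := A.filter fun f => !same f e

/-- One step of a graph search. -/
def reachStep (n : ℕ) (A : List Edge) (l : List ℕ) : List ℕ :=
  (List.range n).filter fun v => l.any fun w => w == v || A.any fun e => joins e w v

/-- `t` can be reached from `r`. -/
def isReach (n : ℕ) (A : List Edge) (r t : ℕ) : Bool :=
  ((reachStep n A)^[n] [r]).any fun v => v == t

/-- All elements of `T` can be reached from `r`. -/
def connects (n r : ℕ) (T : List ℕ) (A : List Edge) : Bool := T.all fun t => isReach n A r t

/-- Remove the edge `e` if it is not needed to connect `r` to `T`. -/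
def reduceStep (n r : ℕ) (T : List ℕ) (A : List Edge) (e : Edge) : List Edge :=
  if connects n r T (eraseE A e) = true then eraseE A e else A

/-- Remove unneeded edges one by one. -/
def reduce (n r : ℕ) (T : List ℕ) (A : List Edge) : List Edge := A.foldl (reduceStep n r T) A

/-- The removals of `e` and of `e'` separate `T`, `u` and `v` in the same way. -/
def sameSplit (n r : ℕ) (T : List ℕ) (A : List Edge) (e e' : Edge) (u v : ℕ) : Bool :=
  (u :: v :: T).all fun t => isReach n (eraseE A e) r t == isReach n (eraseE A e') r t

/-- Remove a segment. -/
def rest (n r : ℕ) (T : List ℕ) (A : List Edge) (e : Edge) (u v : ℕ) : List Edge :=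
  A.filter fun e' => !sameSplit n r T A e e' u v

/-- The total cost. -/
def cost (A : List Edge) : Bin := binSum (A.map fun e => e.2)

/-- The total cost of the edges outside `R`. -/
def costOutside (R A : List Edge) : Bin :=
  binSum (A.map fun e => if memE R e = true then ⟨0⟩ else e.2)

/-- Replace the best list found so far if the new one is at least as good. -/
def bestStep (key : List Edge → Bin) (c : List (List Edge)) (p : List Edge) : List (List Edge) :=
  if (c.all fun q => (key p).le (key q)) = true then [p] else c

/-- A list that minimizes `key`, if there is any. -/
def best (key : List Edge → Bin) (l : List (List Edge)) : List (List Edge) :=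
  l.foldl (bestStep key) []

/-- The walks to `v` that extend those of the table by at most one edge. -/
def extend (E : List Edge) (tab : List (ℕ × List Edge)) (v : ℕ) : List (List Edge) :=
  (tab.filter fun x => x.1 == v).map (fun x => x.2) ++
    tab.flatMap fun x => (E.filter fun e => joins e x.1 v).map fun e => e :: x.2

/-- One round of the Bellman-Ford algorithm. -/
def relax (n : ℕ) (E R : List Edge) (tab : List (ℕ × List Edge)) : List (ℕ × List Edge) :=
  (List.range n).flatMap fun v =>
    (best (costOutside R) (extend E tab v)).map fun p => (v, p)

/-- Cheapest walks from `u`, where edges of `R` are free. -/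
def table (n : ℕ) (E R : List Edge) (u : ℕ) : List (ℕ × List Edge) :=
  (relax n E R)^[n] [(u, [])]

/-- Add the walk `p` to `R`. -/
def join (E R p : List Edge) : List Edge := E.filter fun e => memE R e || memE p e

/-- Exchange the rest of a solution and a walk for a minimal solution. -/
def exchange (n r : ℕ) (T : List ℕ) (E R p : List Edge) : List (List Edge) :=
  if connects n r T (join E R p) = true then [reduce n r T (join E R p)] else []

/-- Exchange a segment of `A` for walks between `u` and `v`. -/
def swaps (n r : ℕ) (T : List ℕ) (E R : List Edge) (u v : ℕ) : List (List Edge) :=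
  ((table n E R u).filter fun x => x.1 == v).flatMap fun x => exchange n r T E R x.2

/-- The neighbours of a solution. -/
def neighbours (n r : ℕ) (T : List ℕ) (E A : List Edge) : List (List Edge) :=
  A.flatMap fun e => (List.range n).flatMap fun u => (List.range n).flatMap fun v =>
    swaps n r T E (rest n r T A e u v) u v

/-- The best neighbour. -/
def step (n r : ℕ) (T : List ℕ) (E A : List Edge) : List Edge :=
  (best cost (A :: neighbours n r T E A)).headD A

/-- Multiplication by a unary number. -/
def times (m : ℕ) (b : Bin) : Bin := binSum ((List.range m).map fun _ => b)

/-- The improvement from `B` to `B'` is at most `1 / m` of that from `B` to `C`. -/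
def stops (m : ℕ) (B B' C : List Edge) : Bool :=
  ((times m (cost B)).add (cost C)).le ((cost B).add (times m (cost B')))

/-- One step of the second run of the local search. -/
def step' (m n r : ℕ) (T : List ℕ) (E C A : List Edge) : List Edge :=
  if stops m A (step n r T E A) C = true then A else step n r T E A

/-- The number of steps of the local search. -/
def rounds (m : ℕ) (A : List Edge) : ℕ := 2 * m * ((cost A).val.bits.length + 1)

/-- Local search, first with a fixed number of steps, then up to a solution that is almost
locally optimal with respect to the result of the first run. -/
def search (m n r : ℕ) (T : List ℕ) (E : List Edge) : List Edge :=
  (step' m n r T E ((step n r T E)^[rounds m (reduce n r T E)] (reduce n r T E)))^[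
    rounds m (reduce n r T E)] (reduce n r T E)

/-! ### Polynomial running time of the local search -/

section
variable {α β γ δ : Type} [Enc α] [Enc β] [Enc γ] [Enc δ]
  {m n r u v t : α → ℕ} {T : α → List ℕ} {A B C E R p : α → List Edge} {e f : α → Edge}

@[fun_prop]
theorem joins_polyTime (he : PT e) (hu : PT u) (hv : PT v) :
    PT fun a => joins (e a) (u a) (v a) := by unfold joins; fun_prop

@[fun_prop]
theorem same_polyTime (he : PT e) (hf : PT f) : PT fun a => same (e a) (f a) := by
  unfold same; fun_prop

@[fun_prop]
theorem memE_polyTime (hA : PT A) (he : PT e) : PT fun a => memE (A a) (e a) := by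
  unfold memE; fun_prop

@[fun_prop]
theorem eraseE_polyTime (hA : PT A) (he : PT e) : PT fun a => eraseE (A a) (e a) := by
  unfold eraseE; fun_prop

@[fun_prop]
theorem reachStep_polyTime {l : α → List ℕ} (hn : PT n) (hA : PT A) (hl : PT l) :
    PT fun a => reachStep (n a) (A a) (l a) := by
  unfold reachStep; fun_prop

theorem sz_range_le (n : ℕ) : sz (List.range n) ≤ n * (n + 1) := by
  refine (sz_list_le _ n fun b hb => ?_).trans (by rw [List.length_range])
  rw [sz_nat]; exact (List.mem_range.1 hb).le

@[fun_prop]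
theorem isReach_polyTime (hn : PT n) (hA : PT A) (hr : PT r) (ht : PT t) :
    PT fun a => isReach (n a) (A a) (r a) (t a) := by
  have : PT fun a => (reachStep (n a) (A a))^[n a] [r a] := by
    refine PT.iterate (f := fun a => reachStep (n a) (A a)) hn (by fun_prop) (by fun_prop) ?_
    obtain ⟨q, hq⟩ := hn.size_le
    obtain ⟨q', hq'⟩ := hr.size_le
    refine ⟨q' + 1 + q * (q + 1), fun a i _ => ?_⟩
    have h1 := hq a
    have h2 := hq' a
    rw [sz_nat] at h1
    simp only [eval_add, eval_mul, eval_one]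
    cases i with
    | zero =>
      simp only [Function.iterate_zero, _root_.id, sz_cons, sz_nil]
      omega
    | succ i =>
      rw [Function.iterate_succ_apply']
      refine (sz_le_of_sublist (List.filter_sublist)).trans ((sz_range_le _).trans ?_)
      have : n a * (n a + 1) ≤ q.eval (sz a) * (q.eval (sz a) + 1) := by gcongr
      omega
  unfold isReach
  fun_prop

@[fun_prop]
theorem connects_polyTime (hn : PT n) (hr : PT r) (hT : PT T) (hA : PT A) :
    PT fun a => connects (n a) (r a) (T a) (A a) := by unfold connects; fun_prop

@[fun_prop]
theorem reduceStep_polyTime (hn : PT n) (hr : PT r) (hT : PT T) (hA : PT A) (he : PT e) :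
    PT fun a => reduceStep (n a) (r a) (T a) (A a) (e a) := by unfold reduceStep; fun_prop

theorem reduceStep_sublist (n r : ℕ) (T : List ℕ) (A : List Edge) (e : Edge) :
    (reduceStep n r T A e).Sublist A := by
  unfold reduceStep
  split
  · exact List.filter_sublist
  · exact .refl _

theorem foldl_reduceStep_sublist (n r : ℕ) (T : List ℕ) (l A : List Edge) :
    (l.foldl (reduceStep n r T) A).Sublist A := by
  induction l generalizing A with
  | nil => exact .refl _
  | cons e l ih => exact (ih _).trans (reduceStep_sublist _ _ _ _ _)

theorem reduce_sublist (n r : ℕ) (T : List ℕ) (A : List Edge) : (reduce n r T A).Sublist A :=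
  foldl_reduceStep_sublist n r T A A

@[fun_prop]
theorem reduce_polyTime (hn : PT n) (hr : PT r) (hT : PT T) (hA : PT A) :
    PT fun a => reduce (n a) (r a) (T a) (A a) := by
  refine PT.foldl (f := fun a => reduceStep (n a) (r a) (T a)) hA hA (by fun_prop) ?_
  obtain ⟨q, hq⟩ := hA.size_le
  exact ⟨q, fun a l _ => (sz_le_of_sublist (foldl_reduceStep_sublist _ _ _ _ _)).trans (hq a)⟩

@[fun_prop]
theorem sameSplit_polyTime (hn : PT n) (hr : PT r) (hT : PT T) (hA : PT A) (he : PT e) (hf : PT f)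
    (hu : PT u) (hv : PT v) :
    PT fun a => sameSplit (n a) (r a) (T a) (A a) (e a) (f a) (u a) (v a) := by
  unfold sameSplit; fun_prop

@[fun_prop]
theorem rest_polyTime (hn : PT n) (hr : PT r) (hT : PT T) (hA : PT A) (he : PT e)
    (hu : PT u) (hv : PT v) : PT fun a => rest (n a) (r a) (T a) (A a) (e a) (u a) (v a) := by
  unfold rest; fun_prop

@[fun_prop]
theorem cost_polyTime (hA : PT A) : PT fun a => cost (A a) := by unfold cost; fun_prop

@[fun_prop]
theorem costOutside_polyTime (hR : PT R) (hA : PT A) : PT fun a => costOutside (R a) (A a) := by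
  unfold costOutside; fun_prop

theorem best_subset (key : List Edge → Bin) (l c : List (List Edge)) :
    ∀ p ∈ l.foldl (bestStep key) c, p ∈ l ∨ p ∈ c := by
  induction l generalizing c with
  | nil => exact fun p hp => .inr hp
  | cons q l ih =>
    intro p hp
    rcases ih _ p hp with h | h
    · exact .inl (List.mem_cons_of_mem _ h)
    · unfold bestStep at h
      split at h
      · rw [List.mem_singleton] at h; exact .inl (h ▸ List.mem_cons_self)
      · exact .inr h

theorem best_length_le (key : List Edge → Bin) (l c : List (List Edge)) (hc : c.length ≤ 1) :
    (l.foldl (bestStep key) c).length ≤ 1 := by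
  induction l generalizing c with
  | nil => exact hc
  | cons q l ih =>
    refine ih _ ?_
    unfold bestStep
    split
    · simp
    · exact hc

@[fun_prop]
theorem best_polyTime {key : α → List Edge → Bin} {l : α → List (List Edge)}
    (hk : PT fun x : α × List Edge => key x.1 x.2) (hl : PT l) :
    PT fun a => best (key a) (l a) := by
  unfold best
  refine PT.foldl (f := fun a => bestStep (key a)) hl (.const _) ?_ ?_
  · unfold bestStep
    have h1 : PT fun x : ((α × List (List Edge)) × List Edge) × List Edge =>
        key x.1.1.1 x.1.2 :=
      hk.comp (f := fun x : ((α × List (List Edge)) × List Edge) × List Edge =>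
        (x.1.1.1, x.1.2)) (by fun_prop)
    have h2 : PT fun x : ((α × List (List Edge)) × List Edge) × List Edge =>
        key x.1.1.1 x.2 :=
      hk.comp (f := fun x : ((α × List (List Edge)) × List Edge) × List Edge =>
        (x.1.1.1, x.2)) (by fun_prop)
    exact .ite (.all (by fun_prop) (.binLe h1 h2)) (by fun_prop) (by fun_prop)
  · obtain ⟨q, hq⟩ := hl.size_le
    refine ⟨q + 1, fun a l' hl' => ?_⟩
    refine (sz_list_le _ (q.eval (sz a)) fun p hp => ?_).trans ?_
    · have h := (best_subset _ _ _ p hp).resolve_right (by simp)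
      exact ((sz_le_of_mem (hl'.subset h)).le).trans (hq a)
    · simp only [eval_add, eval_one]
      exact (Nat.mul_le_mul_right _ (best_length_le _ _ _ (by simp))).trans (one_mul _).le

@[fun_prop]
theorem extend_polyTime {tab : α → List (ℕ × List Edge)} (hE : PT E) (ht : PT tab) (hv : PT v) :
    PT fun a => extend (E a) (tab a) (v a) := by unfold extend; fun_prop

@[fun_prop]
theorem relax_polyTime {tab : α → List (ℕ × List Edge)} (hn : PT n) (hE : PT E) (hR : PT R)
    (ht : PT tab) : PT fun a => relax (n a) (E a) (R a) (tab a) := by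
  unfold relax; fun_prop

theorem mem_extend {E : List Edge} {tab : List (ℕ × List Edge)} {v : ℕ} {p : List Edge} :
    p ∈ extend E tab v ↔ (v, p) ∈ tab ∨
      ∃ w q, (w, q) ∈ tab ∧ ∃ e ∈ E, joins e w v = true ∧ p = e :: q := by
  simp only [extend, List.mem_append, List.mem_map, List.mem_filter, List.mem_flatMap,
    Prod.exists, beq_iff_eq]
  constructor
  · rintro (⟨w, q, ⟨h, rfl⟩, rfl⟩ | ⟨w, q, h, a, b, c, ⟨h1, h2⟩, rfl⟩)
    · exact .inl h
    · exact .inr ⟨w, q, h, a, b, c, h1, h2, rfl⟩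
  · rintro (h | ⟨w, q, h, a, b, c, h1, h2, rfl⟩)
    · exact .inl ⟨v, p, ⟨h, rfl⟩, rfl⟩
    · exact .inr ⟨w, q, h, a, b, c, ⟨h1, h2⟩, rfl⟩

theorem mem_relax {n : ℕ} {E R : List Edge} {tab : List (ℕ × List Edge)} {x : ℕ × List Edge} :
    x ∈ relax n E R tab ↔ x.1 < n ∧ x.2 ∈ best (costOutside R) (extend E tab x.1) := by
  obtain ⟨v, p⟩ := x
  simp only [relax, List.mem_flatMap, List.mem_range, List.mem_map, Prod.mk.injEq]
  constructor
  · rintro ⟨v, hv, p, hp, rfl, rfl⟩; exact ⟨hv, hp⟩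
  · rintro ⟨hv, hp⟩; exact ⟨v, hv, p, hp, rfl, rfl⟩

theorem relax_length_le (n : ℕ) (E R : List Edge) (tab : List (ℕ × List Edge)) :
    (relax n E R tab).length ≤ n := by
  rw [relax, List.length_flatMap]
  refine (List.sum_le_card_nsmul _ 1 fun k hk => ?_).trans (by simp)
  obtain ⟨v, _, rfl⟩ := List.mem_map.1 hk
  rw [List.length_map]
  exact best_length_le _ _ _ (by simp)

/-- Keeping a single walk per vertex prevents the table from growing exponentially; a walk gains at
most one edge per round. -/
theorem relax_iterate_bound (n : ℕ) (E R : List Edge) (u i : ℕ) :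
    ((relax n E R)^[i] [(u, [])]).length ≤ n + 1 ∧ ∀ x ∈ (relax n E R)^[i] [(u, [])],
      x.1 ≤ n + u ∧ x.2.length ≤ i ∧ ∀ e ∈ x.2, e ∈ E := by
  induction i with
  | zero => simp
  | succ i ih =>
    rw [Function.iterate_succ_apply']
    refine ⟨(relax_length_le _ _ _ _).trans (Nat.le_succ n), fun x hx => ?_⟩
    obtain ⟨h1, h2⟩ := mem_relax.1 hx
    refine ⟨by omega, ?_⟩
    rcases mem_extend.1 ((best_subset _ _ _ _ h2).resolve_right (by simp)) with
      h | ⟨w, q, h, e, he, _, hp⟩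
    · exact ⟨(ih.2 _ h).2.1.trans (Nat.le_succ i), (ih.2 _ h).2.2⟩
    · obtain ⟨_, h3, h4⟩ := ih.2 _ h
      rw [hp]
      refine ⟨by simpa using h3, fun f hf => ?_⟩
      rcases List.mem_cons.1 hf with rfl | hf
      · exact he
      · exact h4 f hf

@[fun_prop]
theorem table_polyTime (hn : PT n) (hE : PT E) (hR : PT R) (hu : PT u) :
    PT fun a => table (n a) (E a) (R a) (u a) := by
  refine PT.iterate (f := fun a => relax (n a) (E a) (R a)) hn (by fun_prop) (by fun_prop) ?_
  obtain ⟨q, hq⟩ := hn.size_le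
  obtain ⟨q', hq'⟩ := hu.size_le
  obtain ⟨p, hp⟩ := hE.size_le
  refine ⟨(q + 1) * (q + q' + q * (p + 1) + 1 + 1), fun a i hi => ?_⟩
  have h1 := hq a
  have h2 := hq' a
  have h3 := hp a
  rw [sz_nat] at h1 h2
  obtain ⟨hl, hx⟩ := relax_iterate_bound (n a) (E a) (R a) (u a) i
  refine (sz_list_le _ (q.eval (sz a) + q'.eval (sz a) +
    q.eval (sz a) * (p.eval (sz a) + 1) + 1) fun x hx' => ?_).trans ?_
  · obtain ⟨h4, h5, h6⟩ := hx x hx'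
    have h7 := sz_list_le x.2 (p.eval (sz a)) fun e he => (sz_le_of_mem (h6 e he)).le.trans h3
    have h8 : x.2.length * (p.eval (sz a) + 1) ≤ q.eval (sz a) * (p.eval (sz a) + 1) :=
      Nat.mul_le_mul_right _ (by omega)
    have h9 : sz x = sz x.1 + sz x.2 + 1 := rfl
    rw [sz_nat] at h9
    omega
  · simp only [eval_mul, eval_add, eval_one]
    exact Nat.mul_le_mul_right _ (by omega)

@[fun_prop]
theorem join_polyTime (hE : PT E) (hR : PT R) (hp : PT p) :
    PT fun a => join (E a) (R a) (p a) := by unfold join; fun_prop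

@[fun_prop]
theorem exchange_polyTime (hn : PT n) (hr : PT r) (hT : PT T) (hE : PT E) (hR : PT R)
    (hp : PT p) : PT fun a => exchange (n a) (r a) (T a) (E a) (R a) (p a) := by
  unfold exchange; fun_prop

@[fun_prop]
theorem swaps_polyTime (hn : PT n) (hr : PT r) (hT : PT T) (hE : PT E) (hR : PT R) (hu : PT u)
    (hv : PT v) : PT fun a => swaps (n a) (r a) (T a) (E a) (R a) (u a) (v a) := by
  unfold swaps; fun_prop

@[fun_prop]
theorem neighbours_polyTime (hn : PT n) (hr : PT r) (hT : PT T) (hE : PT E) (hA : PT A) :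
    PT fun a => neighbours (n a) (r a) (T a) (E a) (A a) := by
  unfold neighbours; fun_prop

@[fun_prop]
theorem step_polyTime (hn : PT n) (hr : PT r) (hT : PT T) (hE : PT E) (hA : PT A) :
    PT fun a => step (n a) (r a) (T a) (E a) (A a) := by
  unfold step; fun_prop

@[fun_prop]
theorem times_polyTime {b : α → Bin} (hm : PT m) (hb : PT b) : PT fun a => times (m a) (b a) := by
  unfold times; fun_prop

@[fun_prop]
theorem stops_polyTime (hm : PT m) (hA : PT A) (hB : PT B) (hC : PT C) :
    PT fun a => stops (m a) (A a) (B a) (C a) := by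
  unfold stops; fun_prop

@[fun_prop]
theorem step'_polyTime (hm : PT m) (hn : PT n) (hr : PT r) (hT : PT T) (hE : PT E) (hC : PT C)
    (hA : PT A) : PT fun a => step' (m a) (n a) (r a) (T a) (E a) (C a) (A a) := by
  unfold step'; fun_prop

@[fun_prop]
theorem rounds_polyTime (hm : PT m) (hA : PT A) : PT fun a => rounds (m a) (A a) := by
  unfold rounds; fun_prop

theorem mem_neighbours {n r : ℕ} {T : List ℕ} {E A B : List Edge} :
    B ∈ neighbours n r T E A ↔ ∃ e ∈ A, ∃ u < n, ∃ v < n, ∃ p,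
      (v, p) ∈ table n E (rest n r T A e u v) u ∧
      connects n r T (join E (rest n r T A e u v) p) = true ∧
      B = reduce n r T (join E (rest n r T A e u v) p) := by
  simp only [neighbours, swaps, exchange, List.mem_flatMap, List.mem_range, List.mem_filter,
    beq_iff_eq]
  constructor
  · rintro ⟨e, he, u, hu, v, hv, ⟨w, p⟩, ⟨hx, rfl⟩, h⟩
    split at h
    · next hc => exact ⟨e, he, u, hu, _, hv, p, hx, hc, by simpa using h⟩
    · simp at h
  · rintro ⟨e, he, u, hu, v, hv, p, hx, hc, rfl⟩
    exact ⟨e, he, u, hu, v, hv, (v, p), ⟨hx, rfl⟩, by rw [if_pos hc]; simp⟩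

theorem bestStep_ne_nil (key : List Edge → Bin) (l c : List (List Edge)) (h : c ≠ []) :
    l.foldl (bestStep key) c ≠ [] := by
  induction l generalizing c with
  | nil => exact h
  | cons p l ih =>
    refine ih _ ?_
    unfold bestStep
    split <;> simp [h]

theorem step_mem (n r : ℕ) (T : List ℕ) (E A : List Edge) :
    step n r T E A ∈ A :: neighbours n r T E A := by
  have h : best cost (A :: neighbours n r T E A) ≠ [] :=
    bestStep_ne_nil cost (neighbours n r T E A) (bestStep cost [] A) (by simp [bestStep])
  obtain ⟨p, l, hp⟩ := List.exists_cons_of_ne_nil h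
  have h2 := best_subset cost (A :: neighbours n r T E A) [] p (by
    change p ∈ best _ _
    rw [hp]; exact List.mem_cons_self)
  rw [step, hp]
  exact h2.resolve_right (by simp)

theorem step_sublist {n r : ℕ} {T : List ℕ} {E A : List Edge} (h : A.Sublist E) :
    (step n r T E A).Sublist E := by
  rcases List.mem_cons.1 (step_mem n r T E A) with h' | h'
  · rwa [h']
  · obtain ⟨e, _, u, _, v, _, p, _, _, h''⟩ := mem_neighbours.1 h'
    rw [h'']
    exact (reduce_sublist _ _ _ _).trans List.filter_sublist

theorem step'_sublist {m n r : ℕ} {T : List ℕ} {E C A : List Edge} (h : A.Sublist E) :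
    (step' m n r T E C A).Sublist E := by
  unfold step'
  split
  · exact h
  · exact step_sublist h

theorem iterate_sublist {f : List Edge → List Edge} {E A : List Edge}
    (hf : ∀ A, A.Sublist E → (f A).Sublist E) (h : A.Sublist E) (i : ℕ) : (f^[i] A).Sublist E := by
  induction i with
  | zero => exact h
  | succ i ih => rw [Function.iterate_succ_apply']; exact hf _ ih

-- All solutions met are sublists of `E`, so the iterations never outgrow the input. Their number
-- can be written in unary, as it involves only the bit length of the cost.
@[fun_prop]
theorem search_polyTime (hm : PT m) (hn : PT n) (hr : PT r) (hT : PT T) (hE : PT E) :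
    PT fun a => search (m a) (n a) (r a) (T a) (E a) := by
  obtain ⟨q, hq⟩ := hE.size_le
  have h0 : ∀ a, (reduce (n a) (r a) (T a) (E a)).Sublist (E a) := fun a => reduce_sublist _ _ _ _
  have h1 : PT fun a => (step (n a) (r a) (T a) (E a))^[rounds (m a)
      (reduce (n a) (r a) (T a) (E a))] (reduce (n a) (r a) (T a) (E a)) := by
    refine PT.iterate (f := fun a => step (n a) (r a) (T a) (E a)) (by fun_prop) (by fun_prop)
      (by fun_prop) ⟨q, fun a i _ => ?_⟩
    exact (sz_le_of_sublist (iterate_sublist (fun A hA => step_sublist hA) (h0 a) i)).trans (hq a)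
  refine PT.iterate (f := fun a => step' (m a) (n a) (r a) (T a) (E a) ((step (n a) (r a) (T a)
    (E a))^[rounds (m a) (reduce (n a) (r a) (T a) (E a))] (reduce (n a) (r a) (T a) (E a))))
    (by fun_prop) (by fun_prop) ?_ ⟨q, fun a i _ => ?_⟩
  · have h2 := h1.comp (f := fun x : α × List Edge => x.1) (by fun_prop)
    fun_prop
  · exact (sz_le_of_sublist (iterate_sublist (fun A hA => step'_sublist hA) (h0 a) i)).trans (hq a)

end

/-! ### Correctness of the local search -/

section
variable {n : ℕ}

open Classical in
/-- The set of edges described by a list. -/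
noncomputable def edgeSet (n : ℕ) (A : List Edge) : Finset (Sym2 (Fin n)) :=
  Finset.univ.filter fun z => ∃ e ∈ A, ∃ u v : Fin n, z = s(u, v) ∧ joins e u v = true

theorem joins_iff {e : Edge} {u v : ℕ} :
    joins e u v = true ↔ (e.1.1 = u ∧ e.1.2 = v) ∨ (e.1.1 = v ∧ e.1.2 = u) := by
  simp [joins]

theorem joins_comm {e : Edge} {u v : ℕ} : joins e u v = true ↔ joins e v u = true := by
  rw [joins_iff, joins_iff, or_comm]

theorem mem_edgeSet {A : List Edge} {u v : Fin n} :
    s(u, v) ∈ edgeSet n A ↔ ∃ e ∈ A, joins e u v = true := by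
  simp only [edgeSet, Finset.mem_filter, Finset.mem_univ, true_and]
  constructor
  · rintro ⟨e, he, x, y, hxy, hj⟩
    rcases Sym2.eq_iff.1 hxy with ⟨rfl, rfl⟩ | ⟨rfl, rfl⟩
    · exact ⟨e, he, hj⟩
    · exact ⟨e, he, joins_comm.1 hj⟩
  · rintro ⟨e, he, hj⟩
    exact ⟨e, he, u, v, rfl, hj⟩

theorem edgeSet_mono {A B : List Edge} (h : A ⊆ B) : edgeSet n A ⊆ edgeSet n B := by
  intro z hz
  induction z with | _ u v
  rw [mem_edgeSet] at hz ⊢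
  obtain ⟨e, he, hj⟩ := hz
  exact ⟨e, h he, hj⟩

/-- The list describes a simple graph on `n` vertices with edge costs `c`. -/
structure IsGraph (n : ℕ) (c : Sym2 (Fin n) → ℕ) (E : List Edge) : Prop where
  lt : ∀ e ∈ E, e.1.1 < e.1.2 ∧ e.1.2 < n
  nodup : (E.map fun e => e.1).Nodup
  cost : ∀ e ∈ E, ∀ u v : Fin n, joins e u v = true → e.2.val = c s(u, v)

namespace IsGraph
variable {c : Sym2 (Fin n) → ℕ} {E A : List Edge}

theorem sublist (hE : IsGraph n c E) (h : A.Sublist E) : IsGraph n c A :=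
  ⟨fun e he => hE.lt e (h.subset he), hE.nodup.sublist (h.map _),
    fun e he => hE.cost e (h.subset he)⟩

theorem exists_ends (hE : IsGraph n c E) {e : Edge} (he : e ∈ E) :
    ∃ u v : Fin n, e.1 = ((u : ℕ), (v : ℕ)) ∧ u < v := by
  obtain ⟨h1, h2⟩ := hE.lt e he
  exact ⟨⟨e.1.1, h1.trans h2⟩, ⟨e.1.2, h2⟩, rfl, h1⟩

theorem eq_of_joins (hE : IsGraph n c E) {e f : Edge} (he : e ∈ E) (hf : f ∈ E) {u v : ℕ}
    (h1 : joins e u v = true) (h2 : joins f u v = true) : e = f := by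
  have h3 := hE.lt e he
  have h4 := hE.lt f hf
  rw [joins_iff] at h1 h2
  refine List.inj_on_of_nodup_map hE.nodup he hf (Prod.ext ?_ ?_) <;> omega

theorem same_iff (hE : IsGraph n c E) {e f : Edge} (he : e ∈ E) (hf : f ∈ E) :
    same e f = true ↔ e = f := by
  constructor
  · intro h
    simp only [same, Bool.and_eq_true, beq_iff_eq] at h
    exact List.inj_on_of_nodup_map hE.nodup he hf (Prod.ext h.1 h.2)
  · rintro rfl; simp [same]

theorem memE_iff (hE : IsGraph n c E) (hA : A ⊆ E) {e : Edge} (he : e ∈ E) :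
    memE A e = true ↔ e ∈ A := by
  simp only [memE, List.any_eq_true]
  constructor
  · rintro ⟨f, hf, h⟩; rwa [← (hE.same_iff (hA hf) he).1 h]
  · intro h; exact ⟨e, h, (hE.same_iff he he).2 rfl⟩

theorem edgeSet_filter (hE : IsGraph n c E) {P : Edge → Bool} {e : Edge} (he : e ∈ E)
    {u v : Fin n} (hj : joins e u v = true) :
    s(u, v) ∈ edgeSet n (E.filter P) ↔ P e = true := by
  rw [mem_edgeSet]
  constructor
  · rintro ⟨f, hf, hf'⟩
    rw [List.mem_filter] at hf
    rw [hE.eq_of_joins he hf.1 hj hf']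
    exact hf.2
  · exact fun h => ⟨e, List.mem_filter.2 ⟨he, h⟩, hj⟩

theorem edgeSet_eraseE (hA : IsGraph n c A) {e : Edge} (he : e ∈ A) {u v : Fin n}
    (hj : joins e u v = true) : edgeSet n (eraseE A e) = (edgeSet n A).erase s(u, v) := by
  ext z
  induction z with | _ x y
  rw [Finset.mem_erase]
  constructor
  · intro h
    have h' := edgeSet_mono (List.filter_subset_self _) h
    refine ⟨fun hxy => ?_, h'⟩
    rw [hxy, eraseE, hA.edgeSet_filter he hj] at h
    simp [same] at h
  · rintro ⟨hne, h⟩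
    obtain ⟨f, hf, hj'⟩ := mem_edgeSet.1 h
    refine (hA.edgeSet_filter hf hj').2 ?_
    rw [Bool.not_eq_true', ← Bool.not_eq_true, hA.same_iff hf he]
    rintro rfl
    rw [joins_iff] at hj hj'
    apply hne
    rw [Sym2.eq_iff]
    simp only [Fin.ext_iff]
    omega

theorem sum_edgeSet (hA : IsGraph n c A) : ∑ z ∈ edgeSet n A, c z = (SteinerTree.cost A).val := by
  rw [SteinerTree.cost, binSum_val, List.map_map]
  induction A with
  | nil => simp [edgeSet]
  | cons e A ih =>
    obtain ⟨u, v, huv, hlt⟩ := hA.exists_ends List.mem_cons_self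
    have hj : joins e u v = true := joins_iff.2 (.inl (by simp [huv]))
    have hA' := hA.sublist (List.sublist_cons_self e A)
    have hins : edgeSet n (e :: A) = insert s(u, v) (edgeSet n A) := by
      ext z
      induction z with | _ x y
      rw [Finset.mem_insert, mem_edgeSet, mem_edgeSet]
      have : joins e x y = true ↔ s(x, y) = s(u, v) := by
        rw [joins_iff, Sym2.eq_iff, huv]
        simp only [Fin.ext_iff]
        omega
      simp [this]
    have hnot : s(u, v) ∉ edgeSet n A := by
      rw [mem_edgeSet]
      rintro ⟨f, hf, hj'⟩
      have := hA.eq_of_joins List.mem_cons_self (List.mem_cons_of_mem _ hf) hj hj'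
      have h2 := hA.nodup
      rw [List.map_cons, List.nodup_cons] at h2
      exact h2.1 (List.mem_map.2 ⟨f, hf, by rw [this]⟩)
    rw [hins, Finset.sum_insert hnot, ih hA', List.map_cons, List.sum_cons,
      ← hA.cost e List.mem_cons_self u v hj]
    rfl

end IsGraph

theorem mem_reachStep {A : List Edge} {l : List ℕ} {v : ℕ} :
    v ∈ reachStep n A l ↔ v < n ∧ ∃ w ∈ l, w = v ∨ ∃ e ∈ A, joins e w v = true := by
  simp [reachStep]

/-- A search step keeps what has been found, and a path has fewer than `n` edges, so `n` steps find
everything. -/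
theorem isReach_iff {A : List Edge} {r t : Fin n} :
    isReach n A r t = true ↔ (gr (edgeSet n A)).Reachable r t := by
  have hmem : isReach n A r t = true ↔ (t : ℕ) ∈ (reachStep n A)^[n] [(r : ℕ)] := by
    simp [isReach]
  rw [hmem]
  constructor
  · have key : ∀ i, ∀ v ∈ (reachStep n A)^[i] [(r : ℕ)], ∃ hv : v < n,
        (gr (edgeSet n A)).Reachable r ⟨v, hv⟩ := by
      intro i
      induction i with
      | zero =>
        intro v hv
        simp only [Function.iterate_zero, id, List.mem_singleton] at hv
        subst hv
        exact ⟨r.2, .refl _⟩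
      | succ i ih =>
        intro v hv
        rw [Function.iterate_succ_apply', mem_reachStep] at hv
        obtain ⟨hvn, w, hw, h⟩ := hv
        obtain ⟨hwn, hr⟩ := ih w hw
        refine ⟨hvn, hr.trans ?_⟩
        rcases h with rfl | h
        · exact .refl _
        · exact reachable_adj (mem_edgeSet.2 h)
    exact fun h => (key n _ h).2
  · intro h
    obtain ⟨p, hp⟩ := h.exists_isPath
    have hlen := hp.length_lt
    rw [Fintype.card_fin] at hlen
    have mono : ∀ i k (v : Fin n), (v : ℕ) ∈ (reachStep n A)^[i] [(r : ℕ)] →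
        (v : ℕ) ∈ (reachStep n A)^[i + k] [(r : ℕ)] := by
      intro i k v hv
      induction k with
      | zero => exact hv
      | succ k ih =>
        rw [← add_assoc, Function.iterate_succ_apply', mem_reachStep]
        exact ⟨v.2, v, ih, .inl rfl⟩
    have key : ∀ (v w : Fin n) (p : (gr (edgeSet n A)).Walk v w) i,
        (v : ℕ) ∈ (reachStep n A)^[i] [(r : ℕ)] →
        (w : ℕ) ∈ (reachStep n A)^[i + p.length] [(r : ℕ)] := by
      intro v w p
      induction p with
      | nil => exact fun i h => h
      | @cons v v' w hadj p ih =>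
        intro i hv
        rw [SimpleGraph.Walk.length_cons, add_comm p.length, ← add_assoc]
        refine ih (i + 1) ?_
        rw [Function.iterate_succ_apply', mem_reachStep]
        exact ⟨v'.2, v, hv, .inr (mem_edgeSet.1 ((SimpleGraph.fromEdgeSet_adj _).1 hadj).1)⟩
    have h1 := mono _ (n - p.length) t (key r t p 0 (by simp))
    rwa [zero_add, Nat.add_sub_cancel' hlen.le] at h1

/-- The list describes the set of vertices. -/
def IsVerts (n : ℕ) (T : List ℕ) (S : Finset (Fin n)) : Prop :=
  (∀ t ∈ T, t < n) ∧ ∀ t : Fin n, (t : ℕ) ∈ T ↔ t ∈ S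

theorem connects_iff {A : List Edge} {r : Fin n} {T : List ℕ} {S : Finset (Fin n)}
    (hT : IsVerts n T S) :
    connects n r T A = true ↔ ∀ t ∈ S, (gr (edgeSet n A)).Reachable r t := by
  simp only [connects, List.all_eq_true]
  constructor
  · exact fun h t ht => isReach_iff.1 (h t ((hT.2 t).2 ht))
  · exact fun h t ht => isReach_iff (t := ⟨t, hT.1 t ht⟩).2 (h _ ((hT.2 ⟨t, hT.1 t ht⟩).1 ht))

variable {c : Sym2 (Fin n) → ℕ} {E A : List Edge} {r : Fin n} {T : List ℕ} {S : Finset (Fin n)}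

/-- One pass suffices: an edge that could not be dropped from a larger list cannot be dropped from
the smaller list left at the end. -/
theorem isMinConn_reduce (hT : IsVerts n T S) (hA : IsGraph n c A)
    (h : connects n r T A = true) : IsMinConn (edgeSet n (reduce n r T A)) r S := by
  have key : ∀ (l cur : List Edge), connects n r T cur = true →
      connects n r T (l.foldl (reduceStep n r T) cur) = true ∧
      ∀ e ∈ l, e ∈ l.foldl (reduceStep n r T) cur →
        ¬ connects n r T (eraseE (l.foldl (reduceStep n r T) cur) e) = true := by
    intro l
    induction l with
    | nil => exact fun cur h => ⟨h, by simp⟩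
    | cons e l ih =>
      intro cur hcur
      rw [List.foldl_cons]
      have hsub := foldl_reduceStep_sublist n r T l (reduceStep n r T cur e)
      by_cases hc : connects n r T (eraseE cur e) = true
      · have hstep : reduceStep n r T cur e = eraseE cur e := if_pos hc
        rw [hstep] at hsub ⊢
        obtain ⟨h1, h2⟩ := ih _ hc
        refine ⟨h1, fun f hf hf' => ?_⟩
        rcases List.mem_cons.1 hf with rfl | hf
        · have := hsub.subset hf'
          simp [eraseE, same] at this
        · exact h2 f hf hf'
      · have hstep : reduceStep n r T cur e = cur := if_neg hc
        rw [hstep] at hsub ⊢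
        obtain ⟨h1, h2⟩ := ih _ hcur
        refine ⟨h1, fun f hf hf' => ?_⟩
        rcases List.mem_cons.1 hf with rfl | hf
        · intro hcon
          refine hc ?_
          rw [connects_iff hT] at hcon ⊢
          exact fun t ht => reachable_mono (edgeSet_mono (hsub.filter _).subset) (hcon t ht)
        · exact h2 f hf hf'
  obtain ⟨h1, h2⟩ := key A A h
  have hsub := reduce_sublist n r T A
  refine ⟨(connects_iff hT).1 h1, fun z hz => ?_⟩
  induction z with | _ u v
  obtain ⟨e, he, hj⟩ := mem_edgeSet.1 hz
  have h3 := h2 e (hsub.subset he) he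
  rw [connects_iff hT] at h3
  push Not at h3
  rw [← (hA.sublist hsub).edgeSet_eraseE he hj]
  exact h3

theorem edgeSet_rest (hT : IsVerts n T S) (hA : IsGraph n c A) {e : Edge} (he : e ∈ A)
    {x y : Fin n} (hj : joins e x y = true) (u v : Fin n) :
    edgeSet n (rest n r T A e u v) =
      edgeSet n A \ segment (edgeSet n A) r S s(x, y) u v := by
  ext z
  induction z with | _ a b
  by_cases hz : s(a, b) ∈ edgeSet n A
  · obtain ⟨f, hf, hj'⟩ := mem_edgeSet.1 hz
    rw [rest, hA.edgeSet_filter hf hj', Finset.mem_sdiff, mem_segment,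
      Bool.not_eq_true', ← Bool.not_eq_true]
    have : sameSplit n r T A e f u v = true ↔ ∀ t ∈ insert u (insert v S),
        ((gr ((edgeSet n A).erase s(x, y))).Reachable r t ↔
          (gr ((edgeSet n A).erase s(a, b))).Reachable r t) := by
      rw [← hA.edgeSet_eraseE he hj, ← hA.edgeSet_eraseE hf hj']
      simp only [sameSplit, List.all_eq_true, beq_iff_eq]
      constructor
      · intro h t ht
        rw [← isReach_iff, ← isReach_iff, ← Bool.eq_iff_iff]
        refine h t ?_
        rw [List.mem_cons, List.mem_cons, hT.2]
        simpa [Fin.ext_iff] using ht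
      · intro h t ht
        rw [List.mem_cons, List.mem_cons] at ht
        have htn : t < n := by
          rcases ht with rfl | rfl | ht
          · exact u.2
          · exact v.2
          · exact hT.1 t ht
        have := h ⟨t, htn⟩ (by
          rw [Finset.mem_insert, Finset.mem_insert, ← hT.2]
          simpa [Fin.ext_iff] using ht)
        rwa [← isReach_iff, ← isReach_iff, ← Bool.eq_iff_iff] at this
    rw [this]
    tauto
  · refine iff_of_false (fun h => hz ?_) fun h => hz (Finset.mem_sdiff.1 h).1
    exact edgeSet_mono (List.filter_subset_self _) h

theorem edgeSet_join (hE : IsGraph n c E) {R p : List Edge} (hR : R ⊆ E) (hp : p ⊆ E) :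
    edgeSet n (join E R p) = edgeSet n R ∪ edgeSet n p := by
  ext z
  induction z with | _ u v
  rw [Finset.mem_union]
  constructor
  · intro h
    obtain ⟨e, he, hj⟩ := mem_edgeSet.1 h
    simp only [join, List.mem_filter, Bool.or_eq_true] at he
    rcases he.2 with h' | h'
    · exact .inl (mem_edgeSet.2 ⟨e, (hE.memE_iff hR he.1).1 h', hj⟩)
    · exact .inr (mem_edgeSet.2 ⟨e, (hE.memE_iff hp he.1).1 h', hj⟩)
  · rintro (h | h) <;> obtain ⟨e, he, hj⟩ := mem_edgeSet.1 h
    · refine mem_edgeSet.2 ⟨e, List.mem_filter.2 ⟨hR he, ?_⟩, hj⟩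
      rw [(hE.memE_iff hR (hR he)).2 he, Bool.true_or]
    · refine mem_edgeSet.2 ⟨e, List.mem_filter.2 ⟨hp he, ?_⟩, hj⟩
      rw [(hE.memE_iff hp (hp he)).2 he, Bool.or_true]

theorem mem_best_le (key : List Edge → Bin) (l : List (List Edge)) :
    ∀ p ∈ best key l, ∀ q ∈ l, (key p).val ≤ (key q).val := by
  have h : ∀ l c : List (List Edge), c.length ≤ 1 → ∀ p ∈ l.foldl (bestStep key) c,
      (∀ q ∈ l, (key p).val ≤ (key q).val) ∧ ∀ q ∈ c, (key p).val ≤ (key q).val := by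
    intro l
    induction l with
    | nil =>
      intro c hc p hp
      refine ⟨by simp, fun q hq => ?_⟩
      match c, hc, hp, hq with
      | [x], _, hp, hq =>
        rw [List.foldl_nil, List.mem_singleton] at hp
        rw [List.mem_singleton] at hq
        rw [hp, hq]
    | cons x l ih =>
      intro c hc p hp
      rw [List.foldl_cons] at hp
      have hlen : (bestStep key c x).length ≤ 1 := by
        unfold bestStep; split
        · simp
        · exact hc
      obtain ⟨h1, h2⟩ := ih _ hlen p hp
      unfold bestStep at h2
      split at h2
      · next hall =>
        have hx := h2 x (by simp)
        simp only [List.all_eq_true, Bin.le, decide_eq_true_eq] at hall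
        exact ⟨fun q hq => (List.mem_cons.1 hq).elim (fun h => h ▸ hx) (h1 q),
          fun q hq => hx.trans (hall q hq)⟩
      · next hall =>
        simp only [List.all_eq_true, Bin.le, decide_eq_true_eq] at hall
        push Not at hall
        obtain ⟨y, hy, hlt⟩ := hall
        exact ⟨fun q hq => (List.mem_cons.1 hq).elim
          (fun h => h ▸ ((h2 y hy).trans hlt.le)) (h1 q), h2⟩
  exact fun p hp q hq => (h l [] (by simp) p hp).1 q hq

theorem exists_mem_best (key : List Edge → Bin) {l : List (List Edge)} (h : l ≠ []) :
    ∃ p, p ∈ best key l := by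
  obtain ⟨x, l, rfl⟩ := List.exists_cons_of_ne_nil h
  exact List.exists_mem_of_ne_nil _
    (bestStep_ne_nil key l (bestStep key [] x) (by simp [bestStep]))

theorem cost_step_le (B : List Edge) (hB : B ∈ A :: neighbours n r T E A) :
    (cost (step n r T E A)).val ≤ (cost B).val := by
  obtain ⟨p, hp⟩ := exists_mem_best cost (l := A :: neighbours n r T E A) (by simp)
  obtain ⟨q, l, hq⟩ := List.exists_cons_of_ne_nil (List.ne_nil_of_mem hp)
  rw [step, hq]
  exact mem_best_le cost _ q (by rw [hq]; exact List.mem_cons_self) B hB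

end

/-! ### Cheapest walks, exchanges and the bound for one step -/

section
variable {n : ℕ} {c : Sym2 (Fin n) → ℕ} {E A R : List Edge} {r : Fin n} {T : List ℕ}
  {S : Finset (Fin n)}

/-- An exchange needs no more of a table entry than that its edges lie in `E` and join `u` to the
recorded vertex. -/
theorem table_sound (E R : List Edge) (u : Fin n) (i : ℕ) :
    ∀ x ∈ (relax n E R)^[i] [((u : ℕ), [])], ∃ hx : x.1 < n, x.2 ⊆ E ∧
      (gr (edgeSet n x.2)).Reachable u ⟨x.1, hx⟩ := by
  induction i with
  | zero =>
    intro x hx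
    simp only [Function.iterate_zero, id, List.mem_singleton] at hx
    subst hx
    exact ⟨u.2, by simp, .refl _⟩
  | succ i ih =>
    intro x hx
    rw [Function.iterate_succ_apply'] at hx
    obtain ⟨h1, h2⟩ := mem_relax.1 hx
    refine ⟨h1, ?_⟩
    rcases mem_extend.1 ((best_subset _ _ _ _ h2).resolve_right (by simp)) with
      h | ⟨w, q, h, e, he, hj, hp⟩
    · exact (ih _ h).2
    · obtain ⟨hw, hq, hr⟩ := ih _ h
      rw [hp]
      refine ⟨List.cons_subset.2 ⟨he, hq⟩, ?_⟩
      exact (reachable_mono (edgeSet_mono (List.subset_cons_self _ _)) hr).trans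
        (reachable_adj (mem_edgeSet.2 ⟨e, List.mem_cons_self, hj⟩))

theorem costOutside_cons (e : Edge) (p : List Edge) : (costOutside R (e :: p)).val =
    (if memE R e = true then 0 else e.2.val) + (costOutside R p).val := by
  simp only [costOutside, binSum_val, List.map_cons, List.sum_cons]
  split <;> rfl

theorem relax_complete {tab : List (ℕ × List Edge)} {v : ℕ} (hv : v < n) {p : List Edge}
    (hp : p ∈ extend E tab v) :
    ∃ q, (v, q) ∈ relax n E R tab ∧ (costOutside R q).val ≤ (costOutside R p).val := by
  obtain ⟨q, hq⟩ := exists_mem_best (costOutside R) (List.ne_nil_of_mem hp)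
  exact ⟨q, mem_relax.2 ⟨hv, hq⟩, mem_best_le _ _ q hq p hp⟩

/-- The costs of the edges outside `R`. -/
noncomputable def outCost (c : Sym2 (Fin n) → ℕ) (R : List Edge) (z : Sym2 (Fin n)) : ℕ :=
  if z ∈ edgeSet n R then 0 else c z

theorem memE_iff_mem_edgeSet (hE : IsGraph n c E) (hR : R ⊆ E) {e : Edge} (he : e ∈ E)
    {u v : Fin n} (hj : joins e u v = true) : memE R e = true ↔ s(u, v) ∈ edgeSet n R := by
  rw [hE.memE_iff hR he, mem_edgeSet]
  constructor
  · exact fun h => ⟨e, h, hj⟩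
  · rintro ⟨f, hf, hf'⟩
    rwa [hE.eq_of_joins he (hR hf) hj hf']

theorem ite_memE (hE : IsGraph n c E) (hR : R ⊆ E) {e : Edge} (he : e ∈ E)
    {u v : Fin n} (hj : joins e u v = true) :
    (if memE R e = true then 0 else e.2.val) = outCost c R s(u, v) := by
  rw [outCost, hE.cost e he u v hj]
  exact if_congr (memE_iff_mem_edgeSet hE hR he hj) rfl rfl

/-- Induction along `p`: each round extends the recorded walk by the next edge or finds one at least
as cheap. Later rounds do not lose quality, since the old entry is among the candidates. -/
theorem table_complete (hE : IsGraph n c E) (hR : R ⊆ E) {u v : Fin n}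
    (p : (gr (edgeSet n E)).Walk u v) (hp : p.length ≤ n) :
    ∃ q, ((v : ℕ), q) ∈ table n E R u ∧
      (costOutside R q).val ≤ (p.edges.map (outCost c R)).sum := by
  set f := fun i => (relax n E R)^[i] [((u : ℕ), ([] : List Edge))] with hf
  have mono : ∀ i k (v : Fin n) x, (∃ q, ((v : ℕ), q) ∈ f i ∧ (costOutside R q).val ≤ x) →
      ∃ q, ((v : ℕ), q) ∈ f (i + k) ∧ (costOutside R q).val ≤ x := by
    intro i k v x h
    induction k with
    | zero => exact h
    | succ k ih =>
      obtain ⟨q, hq, hx⟩ := ih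
      obtain ⟨q', hq', hx'⟩ := relax_complete (R := R) v.2 (mem_extend.2 (.inl hq))
      refine ⟨q', ?_, hx'.trans hx⟩
      simp only [hf, ← add_assoc, Function.iterate_succ_apply']
      exact hq'
  have key : ∀ (v w : Fin n) (p : (gr (edgeSet n E)).Walk v w) i x,
      (∃ q, ((v : ℕ), q) ∈ f i ∧ (costOutside R q).val ≤ x) →
      ∃ q, ((w : ℕ), q) ∈ f (i + p.length) ∧
        (costOutside R q).val ≤ x + (p.edges.map (outCost c R)).sum := by
    intro v w p
    induction p with
    | nil => exact fun i x h => by simpa using h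
    | @cons v v' w hadj p ih =>
      rintro i x ⟨q, hq, hx⟩
      obtain ⟨e, he, hj⟩ := mem_edgeSet.1 ((SimpleGraph.fromEdgeSet_adj _).1 hadj).1
      obtain ⟨q', hq', hx'⟩ := relax_complete (R := R) v'.2
        (mem_extend.2 (.inr ⟨v, q, hq, e, he, hj, rfl⟩))
      rw [costOutside_cons, ite_memE hE hR he hj] at hx'
      rw [SimpleGraph.Walk.length_cons, add_comm p.length, ← add_assoc,
        SimpleGraph.Walk.edges_cons, List.map_cons, List.sum_cons, ← add_assoc]
      refine ih (i + 1) _ ⟨q', ?_, by omega⟩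
      simp only [hf, Function.iterate_succ_apply']
      exact hq'
  have h1 := mono _ (n - p.length) v _ (key u v p 0 0 ⟨[], by simp [hf], by
    simp [costOutside, binSum]⟩)
  rwa [zero_add, zero_add, Nat.add_sub_cancel' hp] at h1

/-- Only an inequality, because a walk in the table may repeat edges and `costOutside` counts
repetitions. -/
theorem sum_edgeSet_sdiff_le (hE : IsGraph n c E) (hR : R ⊆ E) {p : List Edge} (hp : p ⊆ E) :
    ∑ z ∈ edgeSet n p \ edgeSet n R, c z ≤ (costOutside R p).val := by
  induction p with
  | nil => simp [edgeSet]
  | cons e p ih =>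
    obtain ⟨he, hp'⟩ := List.cons_subset.1 hp
    obtain ⟨u, v, huv, -⟩ := hE.exists_ends he
    have hj : joins e u v = true := joins_iff.2 (.inl (by simp [huv]))
    rw [costOutside_cons, ite_memE hE hR he hj]
    refine le_trans ?_ (Nat.add_le_add_left (ih hp') _)
    have hsub : edgeSet n (e :: p) ⊆ insert s(u, v) (edgeSet n p) := by
      intro z hz
      induction z with | _ x y
      obtain ⟨f, hf, hjf⟩ := mem_edgeSet.1 hz
      rw [Finset.mem_insert]
      rcases List.mem_cons.1 hf with rfl | hf
      · left
        rw [joins_iff] at hj hjf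
        rw [Sym2.eq_iff]
        simp only [Fin.ext_iff]
        omega
      · exact .inr (mem_edgeSet.2 ⟨f, hf, hjf⟩)
    by_cases h : s(u, v) ∈ edgeSet n R
    · refine le_trans (Finset.sum_le_sum_of_subset fun z hz => ?_) (Nat.le_add_left _ _)
      rw [Finset.mem_sdiff] at hz ⊢
      refine ⟨(Finset.mem_insert.1 (hsub hz.1)).resolve_left ?_, hz.2⟩
      rintro rfl
      exact hz.2 h
    · rw [outCost, if_neg h]
      refine le_trans (Finset.sum_le_sum_of_subset (t := insert s(u, v)
        (edgeSet n p \ edgeSet n R)) fun z hz => ?_) ?_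
      · rw [Finset.mem_sdiff] at hz
        rw [Finset.mem_insert, Finset.mem_sdiff]
        exact (Finset.mem_insert.1 (hsub hz.1)).imp id fun h => ⟨h, hz.2⟩
      · by_cases h' : s(u, v) ∈ edgeSet n p \ edgeSet n R
        · rw [Finset.insert_eq_of_mem h']; exact Nat.le_add_left _ _
        · rw [Finset.sum_insert h']

theorem reachable_of_insert {V : Type} [DecidableEq V] {B C : Finset (Sym2 V)} {u v a b : V}
    (h : (gr (insert s(u, v) B)).Reachable a b) (hB : B ⊆ C) (huv : (gr C).Reachable u v) :
    (gr C).Reachable a b := by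
  obtain ⟨p⟩ := h
  induction p with
  | nil => exact .refl _
  | @cons x y z hadj p ih =>
    refine SimpleGraph.Reachable.trans ?_ ih
    rcases Finset.mem_insert.1 (Finset.mem_coe.1 ((SimpleGraph.fromEdgeSet_adj _).1 hadj).1) with
      h | h
    · rcases Sym2.eq_iff.1 h with ⟨rfl, rfl⟩ | ⟨rfl, rfl⟩
      · exact huv
      · exact huv.symm
    · exact reachable_adj (hB h)

theorem cost_le_of_sublist {A B : List Edge} (hB : IsGraph n c B) (h : A.Sublist B) :
    (cost A).val ≤ (cost B).val := by
  rw [← hB.sum_edgeSet, ← (hB.sublist h).sum_edgeSet]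
  exact Finset.sum_le_sum_of_subset (edgeSet_mono h.subset)

/-- The best neighbour is at least as good as every exchange of a segment for a path. -/
theorem cost_step_le_swap (hE : IsGraph n c E) (hA : A.Sublist E) (hT : IsVerts n T S)
    {z : Sym2 (Fin n)} (hz : z ∈ edgeSet n A) {u v : Fin n} {F : Finset (Sym2 (Fin n))}
    (hF : F ⊆ edgeSet n E) (p : (gr F).Walk u v) (hp : p.IsPath)
    (hconn : ∀ t ∈ S, (gr (insert s(u, v) (edgeSet n A \ segment (edgeSet n A) r S z u v))).Reachable
      r t) :
    (cost (step n r T E A)).val ≤ ∑ e ∈ edgeSet n A \ segment (edgeSet n A) r S z u v, c e +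
      ∑ e ∈ p.edges.toFinset \ (edgeSet n A \ segment (edgeSet n A) r S z u v), c e := by
  induction z with | _ x y
  obtain ⟨e, he, hj⟩ := mem_edgeSet.1 hz
  have hAg := hE.sublist hA
  rw [← edgeSet_rest hT hAg he hj] at hconn ⊢
  set R := rest n r T A e u v with hRdef
  have hRs : R.Sublist E := List.filter_sublist.trans hA
  have hle : gr F ≤ gr (edgeSet n E) := SimpleGraph.fromEdgeSet_mono (by exact_mod_cast hF)
  obtain ⟨q, hq, hcost⟩ := table_complete hE hRs.subset (p.mapLe hle) (by
    rw [SimpleGraph.Walk.length_mapLe]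
    exact hp.length_lt.le.trans (Fintype.card_fin n).le)
  rw [SimpleGraph.Walk.edges_mapLe_eq_edges] at hcost
  obtain ⟨_, hqE, hreach⟩ := table_sound E R u n _ hq
  have hjoin := edgeSet_join hE hRs.subset hqE
  have hc : connects n r T (join E R q) = true := by
    rw [connects_iff hT, hjoin]
    exact fun t ht => reachable_of_insert (hconn t ht) Finset.subset_union_left
      (reachable_mono Finset.subset_union_right hreach)
  have hmem : reduce n r T (join E R q) ∈ neighbours n r T E A :=
    mem_neighbours.2 ⟨e, he, u, u.2, v, v.2, q, hq, hc, rfl⟩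
  have hJ : (join E R q).Sublist E := List.filter_sublist
  refine (cost_step_le _ (List.mem_cons_of_mem _ hmem)).trans
    ((cost_le_of_sublist (hE.sublist hJ) (reduce_sublist _ _ _ _)).trans ?_)
  rw [← (hE.sublist hJ).sum_edgeSet, hjoin, ← Finset.union_sdiff_self_eq_union,
    Finset.sum_union Finset.disjoint_sdiff]
  refine Nat.add_le_add_left ((sum_edgeSet_sdiff_le hE hRs.subset hqE).trans
    (hcost.trans (le_of_eq ?_))) _
  rw [← List.sum_toFinset _ hp.isTrail.edges_nodup, Finset.sdiff_eq_filter, Finset.sum_filter]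
  refine Finset.sum_congr rfl fun e _ => ?_
  rw [outCost]
  split <;> simp_all

/-- A minimal solution contained in the list `E`. -/
structure IsSol (E : List Edge) (r : Fin n) (S : Finset (Fin n)) (A : List Edge) : Prop where
  sublist : A.Sublist E
  minConn : IsMinConn (edgeSet n A) r S

theorem isSol_reduce (hE : IsGraph n c E) (hT : IsVerts n T S) {B : List Edge} (hB : B.Sublist E)
    (h : connects n r T B = true) : IsSol E r S (reduce n r T B) :=
  ⟨(reduce_sublist _ _ _ _).trans hB, isMinConn_reduce hT (hE.sublist hB) h⟩

theorem IsSol.step (hE : IsGraph n c E) (hT : IsVerts n T S) (h : IsSol E r S A) :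
    IsSol E r S (step n r T E A) := by
  rcases List.mem_cons.1 (step_mem n r T E A) with h' | h'
  · rwa [h']
  · obtain ⟨e, _, u, _, v, _, p, _, hc, h''⟩ := mem_neighbours.1 h'
    rw [h'']
    exact isSol_reduce hE hT List.filter_sublist hc

/-- The slack `g` of `difference_bound` is taken to be the actual gain of the best move from `A`. -/
theorem difference_bound_step (hE : IsGraph n c E) (hT : IsVerts n T S) (h : IsSol E r S A)
    (hrS : S.Nonempty → r ∈ S) {F : Finset (Sym2 (Fin n))} (hF : F ⊆ edgeSet n E)
    (hFS : ∀ t ∈ S, (gr F).Reachable r t) :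
    ∑ e ∈ edgeSet n A \ F, c e ≤ 4 * ∑ e ∈ F \ edgeSet n A, c e +
      2 * ((cost A).val - (cost (step n r T E A)).val) * n := by
  have := difference_bound c ((cost A).val - (cost (step n r T E A)).val) h.minConn hrS hFS
    fun e he u v p hp hconn => by
      have h1 := cost_step_le_swap hE h.sublist hT he hF p hp hconn
      rw [(hE.sublist h.sublist).sum_edgeSet]
      omega
  rwa [Fintype.card_fin] at this

/-! ### The number of steps -/

/-- Otherwise every drop exceeds a `1 / m` fraction of the remaining distance to the final value, so
this distance at least halves every `2 * m` steps. Being an integer below `2 ^ L`, it vanishes after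
`2 * m * L` steps. The next step would still have to drop strictly; the last block of `2 * m` steps
leaves room for it. -/
theorem exists_almost_stationary {α : Type} (f : α → α) (φ : α → ℕ) (hφ : ∀ x, φ (f x) ≤ φ x) (x : α)
    {m L M : ℕ} (hM : 2 * m * (L + 1) = M) (hm : 0 < m) (hL : φ x < 2 ^ L) :
    ∃ i < M, m * φ (f^[i] x) + φ (f^[M] x) ≤ φ (f^[i] x) + m * φ (f^[i + 1] x) := by
  by_contra hcon
  push Not at hcon
  set a := fun i => φ (f^[i] x) with ha
  have anti : Antitone a := antitone_nat_of_succ_le fun i => by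
    simp only [ha, Function.iterate_succ_apply']; exact hφ _
  have hcon' : ∀ i < M, a i + m * a (i + 1) < m * a i + a M := hcon
  -- The distance to `a M` never increases, so each of the `k` drops is bounded below by the
  -- distance at the end of the block. Taking `k = 2 * m` gives the halving.
  have slow : ∀ i k, i + k ≤ M → m * a (i + k) + k * (a (i + k) - a M) ≤ m * a i := by
    intro i k
    induction k with
    | zero => simp
    | succ k ih =>
      intro hk
      have h1 := ih (by omega)
      have h2 : a (i + k) + m * a (i + (k + 1)) < m * a (i + k) + a M := hcon' (i + k) (by omega)
      have h3 : a (i + (k + 1)) ≤ a (i + k) := anti (by omega)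
      have h4 : k * (a (i + (k + 1)) - a M) ≤ k * (a (i + k) - a M) :=
        Nat.mul_le_mul_left _ (by omega)
      have h5 : a M ≤ a (i + (k + 1)) := anti (by omega)
      rw [add_mul, one_mul]
      omega
  have half : ∀ j ≤ L, 2 ^ j * (a (2 * m * j) - a M) ≤ a 0 - a M := by
    intro j
    induction j with
    | zero => simp
    | succ j ih =>
      intro hj
      refine le_trans ?_ (ih (by omega))
      rw [pow_succ, mul_assoc]
      refine Nat.mul_le_mul_left _ ?_
      have hle : 2 * m * j + 2 * m ≤ M := by
        rw [← hM, ← Nat.mul_succ]; exact Nat.mul_le_mul_left _ (by omega)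
      have h1 := slow (2 * m * j) (2 * m) hle
      have h5 : a M ≤ a (2 * m * j + 2 * m) := anti hle
      have h6 : a M ≤ a (2 * m * j) := anti (by omega)
      rw [Nat.mul_succ]
      have h7 : m * (2 * (a (2 * m * j + 2 * m) - a M)) ≤ m * (a (2 * m * j) - a M) := by
        rw [Nat.mul_sub m (a (2 * m * j))]
        have : m * a M ≤ m * a (2 * m * j + 2 * m) := Nat.mul_le_mul_left _ h5
        have e : m * (2 * (a (2 * m * j + 2 * m) - a M)) = 2 * m * (a (2 * m * j + 2 * m) - a M) := by
          ring
        omega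
      exact Nat.le_of_mul_le_mul_left h7 hm
  have h0 := half L le_rfl
  have hlt : 2 * m * L < M := by rw [← hM, Nat.mul_succ]; omega
  have hz : a (2 * m * L) - a M = 0 := by
    by_contra hne
    have h1 : 2 ^ L * 1 ≤ 2 ^ L * (a (2 * m * L) - a M) := Nat.mul_le_mul_left _ (by omega)
    have h2 : a 0 < 2 ^ L := hL
    omega
  have h2 := hcon' _ hlt
  have h3 : a M ≤ a (2 * m * L + 1) := anti (by omega)
  have h4 : m * a (2 * m * L) ≤ m * a (2 * m * L + 1) := Nat.mul_le_mul_left _ (by omega)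
  have h5 : a M ≤ a (2 * m * L) := anti hlt.le
  omega

/-- The halting iteration follows `f` until the test succeeds and then stays fixed. Thus a success
anywhere on the orbit of `f` up to `M` guarantees one at the end, without storing the orbit. -/
theorem iterate_halting {α : Type} {f g : α → α} {halt : α → Prop}
    (h1 : ∀ x, halt x → g x = x) (h2 : ∀ x, ¬ halt x → g x = f x) (x : α) {i M : ℕ} (hi : i ≤ M)
    (hs : halt (f^[i] x)) : halt (g^[M] x) := by
  have h3 : ∀ k, halt (g^[k] x) → ∀ l, g^[k + l] x = g^[k] x := by
    intro k hk l
    induction l with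
    | zero => rfl
    | succ l ih => rw [← add_assoc, Function.iterate_succ_apply', ih, h1 _ hk]
  suffices h : ∃ k ≤ M, halt (g^[k] x) by
    obtain ⟨k, hk, h⟩ := h
    have := h3 k h (M - k)
    rw [Nat.add_sub_cancel' hk] at this
    rwa [this]
  by_contra hcon
  push Not at hcon
  have h4 : ∀ k ≤ i, g^[k] x = f^[k] x := by
    intro k
    induction k with
    | zero => exact fun _ => rfl
    | succ k ih =>
      intro hk
      rw [Function.iterate_succ_apply', h2 _ (hcon k (by omega)), ih (by omega),
        Function.iterate_succ_apply']
  exact hcon i hi (by rwa [h4 i le_rfl])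

theorem times_val (m : ℕ) (b : Bin) : (times m b).val = m * b.val := by
  simp [times, binSum_val]

theorem stops_iff {m : ℕ} {B B' C : List Edge} : stops m B B' C = true ↔
    m * (cost B).val + (cost C).val ≤ (cost B).val + m * (cost B').val := by
  simp [stops, Bin.le, Bin.add, times_val]

theorem cost_step_le_self : (cost (step n r T E A)).val ≤ (cost A).val :=
  cost_step_le A List.mem_cons_self

/-- The result of the local search, and a solution with respect to which it is almost locally
optimal. -/
theorem search_spec (hE : IsGraph n c E) (hT : IsVerts n T S) (h : connects n r T E = true)
    {m : ℕ} (hm : 0 < m) :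
    IsSol E r S (search m n r T E) ∧ ∃ C, IsSol E r S C ∧
      m * ((cost (search m n r T E)).val - (cost (step n r T E (search m n r T E))).val) +
        (cost C).val ≤ (cost (search m n r T E)).val := by
  set A₀ := reduce n r T E with hA₀
  set M := rounds m A₀ with hM
  set C := (step n r T E)^[M] A₀ with hC
  have h0 : IsSol E r S A₀ := isSol_reduce hE hT (.refl E) h
  have hstep : ∀ i, IsSol E r S ((step n r T E)^[i] A₀) := by
    intro i
    induction i with
    | zero => exact h0
    | succ i ih => rw [Function.iterate_succ_apply']; exact ih.step hE hT
  have hstep' : ∀ i, IsSol E r S ((step' m n r T E C)^[i] A₀) := by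
    intro i
    induction i with
    | zero => exact h0
    | succ i ih =>
      rw [Function.iterate_succ_apply', step']
      split
      · exact ih
      · exact ih.step hE hT
  obtain ⟨i, hi, hhalt⟩ := exists_almost_stationary (step n r T E) (fun A => (cost A).val)
    (fun A => cost_step_le_self) A₀ (m := m) (L := (cost A₀).val.bits.length) (M := M) rfl hm
    (by rw [Nat.size_eq_bits_len]; exact Nat.lt_size_self _)
  have hs : stops m ((step' m n r T E C)^[M] A₀)
      (step n r T E ((step' m n r T E C)^[M] A₀)) C = true :=
    iterate_halting (f := step n r T E) (g := step' m n r T E C)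
      (halt := fun A => stops m A (step n r T E A) C = true)
      (fun A hA => if_pos hA) (fun A hA => if_neg hA) A₀ hi.le
      (stops_iff.2 (by rw [Function.iterate_succ_apply'] at hhalt; exact hhalt))
  refine ⟨hstep' M, C, hstep M, ?_⟩
  change m * ((cost ((step' m n r T E C)^[M] A₀)).val -
    (cost (step n r T E ((step' m n r T E C)^[M] A₀))).val) + _ ≤
      (cost ((step' m n r T E C)^[M] A₀)).val
  rw [stops_iff] at hs
  have h1 := cost_step_le_self (n := n) (r := r) (T := T) (E := E)
    (A := (step' m n r T E C)^[M] A₀)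
  have h2 := Nat.mul_le_mul_left m h1
  rw [Nat.mul_sub]
  omega

end

/-! ### Reading the input and writing the output -/

/-- Restricted to pairs, whose trees are never `nil`, so that `nil` is free to represent `none`.
This matches the given matrix encoding. -/
instance {α β : Type} [Enc α] [Enc β] : Enc (Option (α × β)) :=
  ⟨fun x => x.elim .nil enc⟩

section
variable {α β γ : Type} [Enc α] [Enc β] [Enc γ]

@[fun_prop]
theorem PT.isSome {f : α → Option (β × γ)} (hf : PT f) : PT fun a => (f a).isSome :=
  PT.comp (g := Option.isSome) (.of_prog (.ite .id (.pair .nil .nil) .nil) 5 fun x => by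
    cases x with
    | none =>
      refine ⟨_, ?_, .ite_false (.id _) (.nil _)⟩
      simp only [enc, Option.elim_none, BinaryTree.numNodes]
      omega
    | some x =>
      refine ⟨_, ?_, .ite_true (.id _) nofun (.pair (.nil _) (.nil _))⟩
      simp only [sz]; omega) hf

@[fun_prop]
theorem PT.optionGetD {f : α → Option (β × γ)} {d : α → β × γ} (hf : PT f) (hd : PT d) :
    PT fun a => (f a).getD (d a) :=
  PT.comp (g := fun x : Option (β × γ) × (β × γ) => x.1.getD x.2)
    (.of_prog (.ite .fst .fst .snd) 5 fun x => by
      obtain ⟨x, d⟩ := x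
      cases x with
      | none =>
        refine ⟨_, ?_, .ite_false (.fst _) (.snd _)⟩
        simp only [sz]; omega
      | some x =>
        refine ⟨_, ?_, .ite_true (.fst _) nofun (.fst _)⟩
        simp only [sz]; omega) (hf.pair hd)
end

/-- The input of the algorithm: the matrix of the edge costs, as fractions of binary numbers, and
the indicator vector of the terminals. -/
abbrev Input : Type := List (List (Option (List Bool × List Bool))) × List Bool

/-- An entry of the matrix. -/
def entry (x : Input) (e : ℕ × ℕ) : Option (List Bool × List Bool) :=
  (x.1.getD e.1 []).getD e.2 none

/-- The numerator of the cost of an edge. -/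
def numer (x : Input) (e : ℕ × ℕ) : Bin := ⟨bval ((entry x e).getD ([], [])).1⟩

/-- The denominator of the cost of an edge. -/
def denom (x : Input) (e : ℕ × ℕ) : Bin := ⟨bval ((entry x e).getD ([], [])).2⟩

/-- The ends of the edges. -/
def pairs (x : Input) : List (ℕ × ℕ) :=
  ((List.range x.2.length).flatMap fun u => (List.range x.2.length).map fun v => (u, v)).filter
    fun e => e.1.blt e.2 && (entry x e).isSome

/-- The cost of an edge multiplied by the product of all denominators. -/
def scaledCost (x : Input) (e : ℕ × ℕ) : Bin :=
  binProd ((pairs x).map fun f =>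
    if (f.1 == e.1 && f.2 == e.2) = true then numer x f else denom x f)

/-- The edges with integral costs. -/
def edges (x : Input) : List Edge := (pairs x).map fun e => (e, scaledCost x e)

/-- The terminals. -/
def terms (x : Input) : List ℕ := (List.range x.2.length).filter fun i => x.2.getD i false

/-- The Steiner tree found by the local search. -/
def solve (K : ℕ) (x : Input) : List Edge :=
  search (K * x.2.length) x.2.length ((terms x).headD 0) (terms x) (edges x)

/-- The matrix of a set of edges. -/
def output (n : ℕ) (A : List Edge) : List (List Bool) :=
  (List.range n).map fun u => (List.range n).map fun v => A.any fun e => joins e u v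

section
variable {α : Type} [Enc α]

@[fun_prop]
theorem entry_polyTime {x : α → Input} {e : α → ℕ × ℕ} (hx : PT x) (he : PT e) :
    PT fun a => entry (x a) (e a) := by unfold entry; fun_prop

@[fun_prop]
theorem numer_polyTime {x : α → Input} {e : α → ℕ × ℕ} (hx : PT x) (he : PT e) :
    PT fun a => numer (x a) (e a) := by unfold numer; fun_prop

@[fun_prop]
theorem denom_polyTime {x : α → Input} {e : α → ℕ × ℕ} (hx : PT x) (he : PT e) :
    PT fun a => denom (x a) (e a) := by unfold denom; fun_prop

@[fun_prop]
theorem pairs_polyTime {x : α → Input} (hx : PT x) : PT fun a => pairs (x a) := by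
  unfold pairs; fun_prop

@[fun_prop]
theorem scaledCost_polyTime {x : α → Input} {e : α → ℕ × ℕ} (hx : PT x) (he : PT e) :
    PT fun a => scaledCost (x a) (e a) := by unfold scaledCost; fun_prop

@[fun_prop]
theorem edges_polyTime {x : α → Input} (hx : PT x) : PT fun a => edges (x a) := by
  unfold edges; fun_prop

@[fun_prop]
theorem terms_polyTime {x : α → Input} (hx : PT x) : PT fun a => terms (x a) := by
  unfold terms; fun_prop

theorem solve_polyTime (K : ℕ) : PT fun x : Input => output x.2.length (solve K x) := by
  unfold output solve; fun_prop

end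

theorem ofFn_eq_map_range {α : Type} (n : ℕ) (f : ℕ → α) :
    List.ofFn (fun i : Fin n => f i) = (List.range n).map f :=
  List.ext_getElem (by simp) (by simp)

/-! ### Encoded instances, integral costs and the final estimate -/

namespace Instance
variable (I : Instance)

open Classical in
/-- The input of the algorithm for an instance. -/
noncomputable def input : Input :=
  (List.ofFn fun u => List.ofFn fun v => if I.graph.Adj u v then
    some ((I.cost s(u, v)).num.bits, (I.cost s(u, v)).den.bits) else none,
    List.ofFn fun u => decide (u ∈ I.terminals))

theorem enc_input : enc I.input = I.encode := by
  simp only [input, Instance.encode, encodeMatrix]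
  change BinaryTree.node () (encodeList (List.map enc _)) (encodeList (List.map enc _)) = _
  rw [List.map_ofFn, List.map_ofFn]
  congr 3
  funext u
  change encodeList (List.map enc _) = _
  rw [List.map_ofFn]
  congr 2
  funext v
  dsimp only [Function.comp]
  split <;> rfl

theorem input_length : I.input.2.length = I.n := by simp [input]

open Classical in
theorem entry_input (u v : Fin I.n) : entry I.input (u, v) = if I.graph.Adj u v then
    some ((I.cost s(u, v)).num.bits, (I.cost s(u, v)).den.bits) else none := by
  simp [entry, input, List.getD_eq_getElem?_getD]

theorem enc_output (A : List Edge) : enc (output I.n A) = encodeEdges (edgeSet I.n A) := by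
  have h : output I.n A = List.ofFn fun u : Fin I.n => List.ofFn fun v : Fin I.n =>
      decide (s(u, v) ∈ edgeSet I.n A) := by
    rw [output, ← ofFn_eq_map_range]
    congr 1
    funext u
    rw [← ofFn_eq_map_range]
    congr 1
    funext v
    rw [Bool.eq_iff_iff, decide_eq_true_iff, mem_edgeSet, List.any_eq_true]
  rw [h, encodeEdges, encodeMatrix]
  change encodeList (List.map enc _) = _
  rw [List.map_ofFn]
  congr 2
  funext u
  change encodeList (List.map enc _) = _
  rw [List.map_ofFn]
  rfl

/-- The typed input and output have literally the prescribed trees, so the program and polynomial of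
`solve_polyTime` apply unchanged. -/
theorem isPolyTime_solve (K : ℕ) : IsPolyTime fun I => edgeSet I.n (solve K I.input) := by
  obtain ⟨P, q, h⟩ := solve_polyTime K
  refine ⟨P, q, fun I => ?_⟩
  obtain ⟨k, hk, hP⟩ := h I.input
  rw [sz, enc_input] at hk
  dsimp only at hP
  rw [enc_input, input_length, enc_output] at hP
  exact ⟨k, hk, hP⟩

theorem isVerts_terms : IsVerts I.n (terms I.input) I.terminals := by
  have h : ∀ t, t ∈ terms I.input ↔ ∃ h : t < I.n, (⟨t, h⟩ : Fin I.n) ∈ I.terminals := by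
    intro t
    rw [terms, input_length, List.mem_filter, List.mem_range]
    constructor
    · rintro ⟨h1, h2⟩
      exact ⟨h1, by simpa [input, List.getD_eq_getElem?_getD, h1] using h2⟩
    · rintro ⟨h1, h2⟩
      exact ⟨h1, by simpa [input, List.getD_eq_getElem?_getD, h1] using h2⟩
  exact ⟨fun t ht => ((h t).1 ht).1, fun t => (h t).trans ⟨fun h => h.2, fun h => ⟨t.2, h⟩⟩⟩

theorem mem_pairs {u v : ℕ} : (u, v) ∈ pairs I.input ↔
    u < v ∧ ∃ (hu : u < I.n) (hv : v < I.n), I.graph.Adj ⟨u, hu⟩ ⟨v, hv⟩ := by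
  classical
  simp only [pairs, input_length, List.mem_filter, List.mem_flatMap, List.mem_range, List.mem_map,
    Prod.mk.injEq, Bool.and_eq_true, Nat.blt_eq]
  constructor
  · rintro ⟨⟨a, ha, b, hb, rfl, rfl⟩, hlt, hs⟩
    refine ⟨hlt, ha, hb, ?_⟩
    have := I.entry_input ⟨a, ha⟩ ⟨b, hb⟩
    simp only at this
    rw [this] at hs
    by_contra hn
    simp [hn] at hs
  · rintro ⟨hlt, hu, hv, hadj⟩
    refine ⟨⟨u, hu, v, hv, rfl, rfl⟩, hlt, ?_⟩
    have := I.entry_input ⟨u, hu⟩ ⟨v, hv⟩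
    simp only at this
    rw [this, if_pos hadj]
    rfl

theorem pairs_nodup : (pairs I.input).Nodup :=
  List.Nodup.filter _ (List.Nodup.product List.nodup_range List.nodup_range)

/-- The product of all denominators. -/
noncomputable def scale : ℕ := ((pairs I.input).map fun f => (denom I.input f).val).prod

/-- The integral edge costs. -/
noncomputable def natCost (z : Sym2 (Fin I.n)) : ℕ := (I.scale * I.cost z).num

theorem denom_val {u v : Fin I.n} (h : I.graph.Adj u v) :
    (denom I.input (u, v)).val = (I.cost s(u, v)).den := by
  rw [denom, entry_input, if_pos h]; exact bval_bits _

theorem numer_val {u v : Fin I.n} (h : I.graph.Adj u v) :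
    (numer I.input (u, v)).val = (I.cost s(u, v)).num := by
  rw [numer, entry_input, if_pos h]; exact bval_bits _

theorem scale_pos : 0 < I.scale := by
  refine Nat.pos_of_ne_zero (List.prod_ne_zero fun h => ?_)
  obtain ⟨⟨u, v⟩, hf, h0⟩ := List.mem_map.1 h
  obtain ⟨_, hu, hv, hadj⟩ := I.mem_pairs.1 hf
  have := I.denom_val hadj
  simp only at this
  rw [this] at h0
  exact NNRat.den_ne_zero _ h0

/-- Replacing one denominator by the numerator in the product of all denominators multiplies it by
the fraction; stated without division. -/
theorem prod_ite_mul {l : List (ℕ × ℕ)} (hl : l.Nodup) {e : ℕ × ℕ} (he : e ∈ l)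
    (a d : ℕ × ℕ → ℕ) :
    (l.map fun f => if f = e then a f else d f).prod * d e = a e * (l.map d).prod := by
  induction l with
  | nil => simp at he
  | cons f l ih =>
    obtain ⟨h1, h2⟩ := List.nodup_cons.1 hl
    rw [List.map_cons, List.map_cons, List.prod_cons, List.prod_cons]
    rcases List.mem_cons.1 he with rfl | he
    · have h3 : l.map (fun f => if f = e then a e else d f) = l.map d :=
        List.map_congr_left fun f hf => if_neg fun (h : f = e) => h1 (h ▸ hf)
      have h4 : l.map (fun f => if f = e then a f else d f) =
          l.map (fun f => if f = e then a e else d f) :=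
        List.map_congr_left fun f _ => by split <;> simp_all
      rw [if_pos rfl, h4, h3]
      ring
    · rw [if_neg fun (h : f = e) => h1 (h ▸ he), mul_assoc, ih h2 he]
      ring

theorem scaledCost_eq {u v : Fin I.n} (hlt : u < v) (h : I.graph.Adj u v) :
    ((scaledCost I.input (u, v)).val : ℚ≥0) = I.scale * I.cost s(u, v) := by
  have he : ((u : ℕ), (v : ℕ)) ∈ pairs I.input := I.mem_pairs.2 ⟨hlt, u.2, v.2, h⟩
  have h1 := prod_ite_mul I.pairs_nodup he (fun f => (numer I.input f).val)
    fun f => (denom I.input f).val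
  rw [I.denom_val h, I.numer_val h] at h1
  have h2 : (scaledCost I.input (u, v)).val = ((pairs I.input).map fun f =>
      if f = ((u : ℕ), (v : ℕ)) then (numer I.input f).val else (denom I.input f).val).prod := by
    rw [scaledCost, binProd_val, List.map_map]
    congr 1
    refine List.map_congr_left fun f _ => ?_
    simp only [Function.comp, Bool.and_eq_true, beq_iff_eq, Prod.ext_iff]
    split <;> rfl
  rw [← h2] at h1
  have h3 : ((I.cost s(u, v)).den : ℚ≥0) ≠ 0 := by exact_mod_cast NNRat.den_ne_zero _
  refine mul_right_cancel₀ h3 ?_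
  rw [mul_assoc, NNRat.mul_den_eq_num, mul_comm (I.scale : ℚ≥0)]
  exact_mod_cast h1

theorem mem_edgeSet_edges {u v : Fin I.n} :
    s(u, v) ∈ edgeSet I.n (edges I.input) ↔ I.graph.Adj u v := by
  rw [mem_edgeSet]
  constructor
  · rintro ⟨e, he, hj⟩
    obtain ⟨⟨a, b⟩, hf, rfl⟩ := List.mem_map.1 he
    obtain ⟨_, ha, hb, hadj⟩ := I.mem_pairs.1 hf
    rcases joins_iff.1 hj with ⟨h1, h2⟩ | ⟨h1, h2⟩ <;> simp only at h1 h2 <;> subst h1 h2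
    · exact hadj
    · exact hadj.symm
  · intro h
    rcases lt_or_gt_of_ne h.ne with hlt | hlt
    · exact ⟨_, List.mem_map_of_mem (I.mem_pairs.2 ⟨hlt, u.2, v.2, h⟩),
        joins_iff.2 (.inl ⟨rfl, rfl⟩)⟩
    · exact ⟨_, List.mem_map_of_mem (I.mem_pairs.2 ⟨hlt, v.2, u.2, h.symm⟩),
        joins_iff.2 (.inr ⟨rfl, rfl⟩)⟩

theorem natCost_eq {z : Sym2 (Fin I.n)} (hz : z ∈ edgeSet I.n (edges I.input)) :
    (I.natCost z : ℚ≥0) = I.scale * I.cost z := by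
  induction z with | _ u v
  rw [mem_edgeSet_edges] at hz
  rw [natCost]
  rcases lt_or_gt_of_ne hz.ne with hlt | hlt
  · rw [← I.scaledCost_eq hlt hz, NNRat.num_natCast]
  · rw [Sym2.eq_swap, ← I.scaledCost_eq hlt hz.symm, NNRat.num_natCast]

theorem isGraph_edges : IsGraph I.n I.natCost (edges I.input) := by
  refine ⟨fun e he => ?_, ?_, fun e he u v hj => ?_⟩
  · obtain ⟨⟨a, b⟩, hf, rfl⟩ := List.mem_map.1 he
    obtain ⟨h, _, hb, _⟩ := I.mem_pairs.1 hf
    exact ⟨h, hb⟩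
  · rw [edges, List.map_map]
    exact (List.map_id (pairs I.input)).symm ▸ I.pairs_nodup
  · have hz := I.mem_edgeSet_edges.1 (mem_edgeSet.2 ⟨e, he, hj⟩)
    obtain ⟨⟨a, b⟩, hf, rfl⟩ := List.mem_map.1 he
    have hlt := (I.mem_pairs.1 hf).1
    rcases joins_iff.1 hj with ⟨h1, h2⟩ | ⟨h1, h2⟩ <;> simp only at h1 h2 <;> subst h1 h2
    · rw [natCost, ← I.scaledCost_eq hlt hz, NNRat.num_natCast]
    · rw [natCost, Sym2.eq_swap, ← I.scaledCost_eq hlt hz.symm, NNRat.num_natCast]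

theorem sum_natCost {A : Finset (Sym2 (Fin I.n))} (hA : A ⊆ edgeSet I.n (edges I.input)) :
    ((∑ z ∈ A, I.natCost z : ℕ) : ℚ≥0) = I.scale * I.totalCost A := by
  rw [Nat.cast_sum, totalCost, Finset.mul_sum]
  exact Finset.sum_congr rfl fun z hz => I.natCost_eq (hA hz)

variable {I}

theorem IsSolution.reachable {F : Finset (Sym2 (Fin I.n))} (h : I.IsSolution F) {a b : Fin I.n}
    (ha : a ∈ I.terminals) (hb : b ∈ I.terminals) : (gr F).Reachable a b := by
  obtain ⟨H, hH, hT, hF⟩ := h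
  have := hH.coe.preconnected ⟨a, hT ha⟩ ⟨b, hT hb⟩
  exact this.map (⟨Subtype.val, fun {x y} hxy => (SimpleGraph.fromEdgeSet_adj _).2
    ⟨by rw [← hF]; exact hxy, (H.adj_sub hxy).ne⟩⟩ : H.coe →g gr F)

theorem IsSolution.subset {F : Finset (Sym2 (Fin I.n))} (h : I.IsSolution F) :
    F ⊆ edgeSet I.n (edges I.input) := by
  obtain ⟨H, hH, hT, hF⟩ := h
  intro z hz
  induction z with | _ u v
  rw [mem_edgeSet_edges]
  rw [← Finset.mem_coe, ← hF] at hz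
  exact H.adj_sub hz

theorem IsSteinerTree.isSolution {F : Finset (Sym2 (Fin I.n))} (h : I.IsSteinerTree F) :
    I.IsSolution F := by
  obtain ⟨H, hH, hT, hF⟩ := h
  exact ⟨H, ⟨hH.connected⟩, hT, hF⟩

/-- Take the component of `r` as vertex set. Every edge lies in it, because it separates some
terminal from `r`, so `r` reaches one of its ends. With no terminals this yields the single vertex
`r`. -/
theorem isSteinerTree_of_isMinConn {A : Finset (Sym2 (Fin I.n))} {r : Fin I.n}
    (hA : IsMinConn A r I.terminals) (hAE : A ⊆ edgeSet I.n (edges I.input)) :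
    I.IsSteinerTree A := by
  have hadj : ∀ {u v}, s(u, v) ∈ A → I.graph.Adj u v := fun h => I.mem_edgeSet_edges.1 (hAE h)
  have hr : ∀ {u v}, s(u, v) ∈ A → (gr A).Reachable r u := by
    intro u v h
    obtain ⟨t, ht, hn⟩ := hA.min _ h
    have mono : ∀ {b}, (gr (A.erase s(u, v))).Reachable r b → (gr A).Reachable r b :=
      fun h => reachable_mono (Finset.erase_subset _ _) h
    rcases (reachable_erase_or (hA.conn t ht)).resolve_left hn with h' | h'
    · exact mono h'
    · exact (mono h').trans (reachable_adj h).symm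
  let H : I.graph.Subgraph :=
    { verts := {v | (gr A).Reachable r v}
      Adj := fun u v => s(u, v) ∈ A
      adj_sub := hadj
      edge_vert := hr
      symm := ⟨fun u v h => by rwa [Sym2.eq_swap] at h⟩ }
  have hreach : ∀ u v (p : (gr A).Walk u v) (hu : (gr A).Reachable r u)
      (hv : (gr A).Reachable r v), H.coe.Reachable ⟨u, hu⟩ ⟨v, hv⟩ := by
    intro u v p
    induction p with
    | nil => exact fun hu hv => .refl _
    | @cons u w v h p ih =>
      intro hu hv
      have hw : (gr A).Reachable r w := hu.trans h.reachable
      have h1 : H.coe.Adj ⟨u, hu⟩ ⟨w, hw⟩ := ((SimpleGraph.fromEdgeSet_adj _).1 h).1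
      exact h1.reachable.trans (ih hw hv)
  have hconn : H.coe.Connected :=
    { preconnected := fun u v => by
        obtain ⟨u, hu⟩ := u
        obtain ⟨v, hv⟩ := v
        have hu' : (gr A).Reachable r u := hu
        obtain ⟨p⟩ := hu'.symm.trans hv
        exact hreach u v p hu hv
      nonempty := ⟨⟨r, .refl r⟩⟩ }
  refine ⟨H, { connected := hconn, isAcyclic := ?_ }, fun t ht => hA.conn t ht, ?_⟩
  · exact hA.isAcyclic.comap (⟨Subtype.val, fun {x y} hxy => (SimpleGraph.fromEdgeSet_adj _).2
      ⟨hxy, (hadj hxy).ne⟩⟩ : H.coe →g gr A) Subtype.val_injective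
  · ext z
    induction z with | _ u v
    exact Iff.rfl

/-- The local search computes a Steiner tree that is close to every optimal solution. -/
theorem solve_spec {K : ℕ} (hK : 0 < K) (hI : ∃ S, I.IsSolution S) :
    I.IsSteinerTree (edgeSet I.n (solve K I.input)) ∧ ∀ opt, I.IsOptimal opt →
      (K : ℚ≥0) * I.totalCost (edgeSet I.n (solve K I.input) \ opt) ≤
        4 * K * I.totalCost (opt \ edgeSet I.n (solve K I.input)) +
          2 * I.totalCost (edgeSet I.n (solve K I.input) \ opt) := by
  obtain ⟨F₀, hF₀⟩ := hI
  have hT := I.isVerts_terms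
  have hE := I.isGraph_edges
  have hn : 0 < I.n := by
    obtain ⟨H, hH, -⟩ := hF₀
    obtain ⟨x⟩ := hH.coe.nonempty
    exact x.1.pos
  obtain ⟨r, hr, hrS⟩ : ∃ r : Fin I.n, (terms I.input).headD 0 = r ∧
      (I.terminals.Nonempty → r ∈ I.terminals) := by
    cases h : terms I.input with
    | nil =>
      refine ⟨⟨0, hn⟩, rfl, fun ⟨t, ht⟩ => ?_⟩
      have := (hT.2 t).2 ht
      simp [h] at this
    | cons t l =>
      have ht : t ∈ terms I.input := by rw [h]; exact List.mem_cons_self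
      exact ⟨⟨t, hT.1 t ht⟩, rfl, fun _ => (hT.2 ⟨t, hT.1 t ht⟩).1 ht⟩
  have hconn : connects I.n r (terms I.input) (edges I.input) = true :=
    (connects_iff hT).2 fun t ht => reachable_mono hF₀.subset (hF₀.reachable (hrS ⟨t, ht⟩) ht)
  have hsolve : solve K I.input =
      search (K * I.n) I.n r (terms I.input) (edges I.input) := by
    rw [solve, input_length, hr]
  obtain ⟨hB, C, hC, hBC⟩ := search_spec hE hT hconn (Nat.mul_pos hK hn)
  rw [← hsolve] at hB hBC
  set B := solve K I.input
  have hBE := edgeSet_mono (n := I.n) hB.sublist.subset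
  have hCE := edgeSet_mono (n := I.n) hC.sublist.subset
  refine ⟨isSteinerTree_of_isMinConn hB.minConn hBE, fun opt hopt => ?_⟩
  have hoE := hopt.1.subset
  have hdiff := difference_bound_step hE hT hB hrS hoE
    fun t ht => hopt.1.reachable (hrS ⟨t, ht⟩) ht
  -- The result `C` of the first run is feasible, so its cost is an upper bound for the optimum.
  have hle : ∑ z ∈ opt, I.natCost z ≤ ∑ z ∈ edgeSet I.n C, I.natCost z := by
    have h1 := hopt.2 _ (isSteinerTree_of_isMinConn hC.minConn hCE).isSolution
    have h2 : ((∑ z ∈ opt, I.natCost z : ℕ) : ℚ≥0) ≤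
        ((∑ z ∈ edgeSet I.n C, I.natCost z : ℕ) : ℚ≥0) := by
      rw [I.sum_natCost hoE, I.sum_natCost hCE]; gcongr
    exact_mod_cast h2
  rw [(hE.sublist hC.sublist).sum_edgeSet] at hle
  have hB' := (hE.sublist hB.sublist).sum_edgeSet
  have e1 := Finset.sum_inter_add_sum_sdiff (edgeSet I.n B) opt I.natCost
  have e2 := Finset.sum_inter_add_sum_sdiff opt (edgeSet I.n B) I.natCost
  rw [Finset.inter_comm] at e2
  set g := (SteinerTree.cost B).val - (SteinerTree.cost (step I.n r (terms I.input) (edges I.input) B)).val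
  set x := ∑ z ∈ edgeSet I.n B \ opt, I.natCost z with hx
  set y := ∑ z ∈ opt \ edgeSet I.n B, I.natCost z with hy
  -- The stopping rule bounds the left side by `c(B) - c(C) ≤ c(B) - c(opt)`. Cancelling the common
  -- edges gives `x - y`.
  have hgx : K * I.n * g ≤ x := by omega
  have key : K * x ≤ 4 * K * y + 2 * x := by
    have := Nat.mul_le_mul_left K hdiff
    linarith [this, hgx]
  have hx' := I.sum_natCost (Finset.sdiff_subset.trans hBE : edgeSet I.n B \ opt ⊆ _)
  have hy' := I.sum_natCost (Finset.sdiff_subset.trans hoE : opt \ edgeSet I.n B ⊆ _)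
  rw [← hx] at hx'
  rw [← hy] at hy'
  have hs : (0 : ℚ≥0) < I.scale := by exact_mod_cast I.scale_pos
  have key' : (K : ℚ≥0) * x ≤ 4 * K * y + 2 * x := by exact_mod_cast key
  rw [hx', hy'] at key'
  refine le_of_mul_le_mul_left ?_ hs
  convert key' using 1 <;> ring

end Instance

end SteinerTree

theorem mainTheorem7 (ε : ℝ) (hε : 0 < ε) :
    ∃ alg : (I : SteinerTree.Instance) → Finset (Sym2 (Fin I.n)),
      SteinerTree.IsPolyTime alg ∧
      ∀ I : SteinerTree.Instance, (∃ S, I.IsSolution S) →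
        I.IsSteinerTree (alg I) ∧
        ∀ opt : Finset (Sym2 (Fin I.n)), I.IsOptimal opt →
          (I.totalCost (alg I \ opt) : ℝ) ≤ (4 + ε) * (I.totalCost (opt \ alg I) : ℝ) := by
  -- With `k = ⌈8 / ε⌉₊` and `K = k + 2`, the bound `K * x ≤ 4 * K * y + 2 * x` becomes `k * x ≤ 4 *
  -- k * y + 8 * y`, and `8 ≤ k * ε`.
  refine ⟨fun I => SteinerTree.edgeSet I.n (SteinerTree.solve (⌈8 / ε⌉₊ + 2) I.input),
    SteinerTree.Instance.isPolyTime_solve _, fun I hI => ?_⟩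
  obtain ⟨h1, h2⟩ := SteinerTree.Instance.solve_spec (K := ⌈8 / ε⌉₊ + 2) (by omega) hI
  refine ⟨h1, fun opt hopt => ?_⟩
  have h3 := h2 opt hopt
  set x := I.totalCost (SteinerTree.edgeSet I.n (SteinerTree.solve (⌈8 / ε⌉₊ + 2) I.input) \ opt)
  set y := I.totalCost (opt \ SteinerTree.edgeSet I.n (SteinerTree.solve (⌈8 / ε⌉₊ + 2) I.input))
  have h4 : (((⌈8 / ε⌉₊ + 2 : ℕ) : ℚ≥0) : ℝ) * x ≤
      4 * ((⌈8 / ε⌉₊ + 2 : ℕ) : ℚ≥0) * y + 2 * x := by exact_mod_cast h3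
  push_cast at h4
  have hk : 8 ≤ (⌈8 / ε⌉₊ : ℝ) * ε := (div_le_iff₀ hε).1 (Nat.le_ceil _)
  have hy : (0 : ℝ) ≤ y := by exact_mod_cast y.2
  have hk0 : (0 : ℝ) < ⌈8 / ε⌉₊ := by exact_mod_cast Nat.ceil_pos.2 (by positivity)
  refine le_of_mul_le_mul_left ?_ hk0
  have h5 := mul_le_mul_of_nonneg_right hk hy
  linarith
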